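/- **Conventions.** Let $U$ be an open convex subset of a real Banach space $B$ and $Z$ a Banach space. For $k\in\mathbb N_0$, $\alpha\in(0,1]$, a map $f:U\to Z$ is $C^{k+\alpha}$ if it is $k$ times continuously Fréchet differentiable, $f$ and its derivatives of order $\le k$ are bounded on $U$, and $D^kf$ is $\alpha$-Hölder continuous on $U$; $C^0$ means bounded and continuous. For a measurable space $\Omega$ and a Banach space $E$, $L^\infty(\Omega;E)$ is the Banach space of all bounded strongly (Bochner) measurable maps $\Omega\to E$ with norm $\sup_\omega\|\phi_\omega\|$ (no identification almost everywhere). **Scale.** Let $r_0>0$ and, for $r\in(0,r_0]$, let $E_r$ be a real Banach space, $\mathcal C_r\subset E_r$ a closed convex cone, $\ell_r\in E_r'$ with $\|\ell_r\|=1$, and $K_r\ge1$, $\rho_r\in(0,1]$, $\vartheta_r\ge 1$ constants such that $\langle\ell_r,\phi\rangle\ge K_r^{-1}\|\phi\|$ for $\phi\in\mathcal C_r$ and $\mathcal C_r(\rho_r)=\{\phi\in\mathcal C_r: B(\phi,\rho_r\|\phi\|)\subset\mathcal C_r\}$ contains a nonzero element. Let $j_{s,r}:E_r\to E_s$ ($0<s<r\le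 r_0$) be continuous linear injections with $\sup_{s<r}\|j_{s,r}\|<\infty$, $j_{t,s}j_{s,r}=j_{t,r}$, $j_{s,r}(\mathcal C_r)\subset\mathcal C_s$ and $\ell_r=\ell_s\circ j_{s,r}$. Assume that $K_r$, $\vartheta_r$, $1/\rho_r$ are bounded for $r$ in compact subsets of $(0,r_0]$. **Cocycle.** Let $(\Omega,\mathcal F,\mathbb P)$ be a probability space and $\tau:\Omega\to\Omega$ an invertible, bimeasurable, measure-preserving, ergodic map. For $r\in(0,r_0]$, $u\in U$, $\omega\in\Omega$ let $\mathcal L_{r,u,\omega}\in L(E_r)$ be such that $\omega\mapsto\mathcal L_{r,u,\omega}x$ is strongly measurable for each $x\in E_r$, $\mathcal L_{r,u,\omega}(\mathcal C_r\setminus\{0\})\subset\mathcal C_r(\rho_r)\setminus\{0\}$, $\vartheta_r^{-1}\le\|\mathcal L_{r,u,\omega}\|\le\vartheta_r$, and $j_{s,r}\mathcal L_{r,u,\omega}=\mathcal L_{s,u,\omega}j_{s,r}$ for $s<r$. Put $X_r=L^\infty(\Omega;E_r)$, write $\mathbf j_{s,r}:X_r\to X_s$ for the fibrewise action of $j_{s,r}$,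 and define $\mathbf L_{r,u}\in L(X_r)$, $(\mathbf L_{r,u}\phi)_\omega=\mathcal L_{r,u,\tau^{-1}\omega}\phi_{\tau^{-1}\omega}$, and $\Lambda_{r,u}(\phi)=\langle\ell_r,\mathbf L_{r,u}\phi\rangle\in L^\infty(\Omega;\mathbb R)$. **Theorem.** Suppose that for all $0<s<r\le r_0$ and $t\in[0,r-s)$ the map $u\in U\mapsto\mathbf L_{s,u}\mathbf j_{s,r}\in L(X_r,X_s)$ is $C^t$. Then there is a unique family $f_r(u)\in X_r$ ($r\in(0,r_0]$, $u\in U$) such that for all $r,u,\omega$: $f_r(u)_\omega\in\mathcal C_r$, $\langle\ell_r,f_r(u)_\omega\rangle=1$, $f_r(u)=\Lambda_{r,u}(f_r(u))^{-1}\mathbf L_{r,u}f_r(u)$, and $f_s(u)=\mathbf j_{s,r}f_r(u)$ for $s<r$. The function $\Lambda_u(f):=\Lambda_{r,u}(f_r(u))$ is everywhere positive and independent of $r$, $\log\Lambda_u(f)$ is $\mathbb P$-integrable, and for every $r$, $u$ and $\mathbb P$-almost every $\omega$ the characteristic exponent is $$\limsup_{n\to\infty}\tfrac1n\log\big\|\mathcal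 L_{r,u,\tau^{-1}\omega}\circ\cdots\circ\mathcal L_{r,u,\tau^{-n}\omega}\big\|_{L(E_r)}=\int_\Omega\log\Lambda_u(f)\,d\mathbb P .$$ Finally, for all $s\in(0,r_0)$ and $t\in(0,r_0-s)$ the maps $$u\mapsto f_s(u)\in X_s,\qquad u\mapsto\Lambda_u(f)\in L^\infty(\Omega;\mathbb R),\qquad u\mapsto\int_\Omega\log\Lambda_u(f)\,d\mathbb P\in\mathbb R$$ are $C^t$. In particular the characteristic exponent $u\mapsto\int_\Omega\log\Lambda_u(f)\,d\mathbb P$ is $C^{r_0-\epsilon}$ for every $\epsilon\in(0,r_0)$. -/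

import Mathlib

open Set MeasureTheory Filter
open scoped ENNReal

/-! ### Bounded Bochner measurable sections -/

/-- The bounded strongly measurable maps `Ω → E`, as a subspace of the space of all bounded maps
with the uniform norm. No measure is involved: maps are not identified almost everywhere.
(A strongly measurable map is a measurable one with separable range, equivalently a uniform limit
of measurable maps with countable range.) -/
def boundedSections (Ω : Type*) [MeasurableSpace Ω] (E : Type*) [NormedAddCommGroup E]
    [NormedSpace ℝ E] : Submodule ℝ (lp (fun _ : Ω => E) ∞) where
  carrier := {φ | StronglyMeasurable (φ : Ω → E)}
  zero_mem' := by
    show StronglyMeasurable ((0 : lp (fun _ : Ω => E) ∞) : Ω → E)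
    rw [lp.coeFn_zero]
    exact stronglyMeasurable_zero
  add_mem' := by
    intro φ ψ hφ hψ
    show StronglyMeasurable ((φ + ψ : lp (fun _ : Ω => E) ∞) : Ω → E)
    rw [lp.coeFn_add]
    exact StronglyMeasurable.add hφ hψ
  smul_mem' := by
    intro c φ hφ
    show StronglyMeasurable ((c • φ : lp (fun _ : Ω => E) ∞) : Ω → E)
    rw [lp.coeFn_smul]
    exact StronglyMeasurable.const_smul hφ c

/-- `LInf Ω E` is the space `L^∞(Ω; E)` of bounded Bochner measurable sections, normed by
`‖φ‖ = sup_ω ‖φ_ω‖`. -/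
abbrev LInf (Ω : Type*) [MeasurableSpace Ω] (E : Type*) [NormedAddCommGroup E]
    [NormedSpace ℝ E] : Type _ :=
  ↥(boundedSections Ω E)

namespace LInf

variable {Ω : Type*} [MeasurableSpace Ω]
variable {E : Type*} [NormedAddCommGroup E] [NormedSpace ℝ E]
variable {F : Type*} [NormedAddCommGroup F] [NormedSpace ℝ F]

/-- The value `φ_ω` of a section. -/
def val (φ : LInf Ω E) (ω : Ω) : E := (φ : lp (fun _ : Ω => E) ∞) ω

theorem stronglyMeasurable_val (φ : LInf Ω E) : StronglyMeasurable φ.val := φ.2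

theorem norm_val_le (φ : LInf Ω E) (ω : Ω) : ‖φ.val ω‖ ≤ ‖φ‖ :=
  lp.norm_apply_le_norm ENNReal.top_ne_zero (φ : lp (fun _ : Ω => E) ∞) ω

/-- A bounded strongly measurable function, as an element of `LInf Ω E`. -/
def mk (f : Ω → E) (hf : StronglyMeasurable f) (C : ℝ) (hC : ∀ ω, ‖f ω‖ ≤ C) : LInf Ω E :=
  ⟨⟨f, memℓp_infty ⟨C, by rintro _ ⟨ω, rfl⟩; exact hC ω⟩⟩, hf⟩

@[simp] theorem val_mk (f : Ω → E) (hf : StronglyMeasurable f) (C : ℝ) (hC : ∀ ω, ‖f ω‖ ≤ C)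
    (ω : Ω) : (mk f hf C hC).val ω = f ω := rfl

theorem ext {φ ψ : LInf Ω E} (h : ∀ ω, φ.val ω = ψ.val ω) : φ = ψ :=
  Subtype.ext (lp.ext (funext h))

theorem norm_le {φ : LInf Ω E} {C : ℝ} (hC : 0 ≤ C) (h : ∀ ω, ‖φ.val ω‖ ≤ C) : ‖φ‖ ≤ C :=
  lp.norm_le_of_forall_le hC h

theorem stronglyMeasurable_apply {A : Ω → E →L[ℝ] F}
    (hA : ∀ x, StronglyMeasurable fun ω => A ω x) {φ : Ω → E} (hφ : StronglyMeasurable φ) :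
    StronglyMeasurable fun ω => A ω (φ ω) := by
  refine stronglyMeasurable_of_tendsto (f := fun (n : ℕ) ω => A ω (hφ.approx n ω)) atTop
    (fun n => ?_) ?_
  · have key : (fun ω => A ω (hφ.approx n ω)) = fun ω => ∑ x ∈ (hφ.approx n).range,
        ((hφ.approx n) ⁻¹' {x}).indicator (fun ω => A ω x) ω := by
      funext ω
      rw [Finset.sum_eq_single (hφ.approx n ω)]
      · simp [Set.indicator]
      · intro b _ hb
        exact Set.indicator_of_notMem (fun h => hb (by simpa using h.symm)) _
      · intro h
        exact absurd (SimpleFunc.mem_range_self _ ω) h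
    rw [key]
    exact Finset.stronglyMeasurable_fun_sum _ fun x _ =>
      (hA x).indicator ((hφ.approx n).measurableSet_fiber x)
  · rw [tendsto_pi_nhds]
    exact fun ω => ((A ω).continuous.tendsto _).comp (hφ.tendsto_approx ω)

/-- The action `(A φ)_ω = A_{τ⁻¹ ω} φ_{τ⁻¹ ω}` over an invertible base map `τ` of a uniformly
bounded, strongly Bochner measurable family `A = (A_ω)` of bounded operators. -/
noncomputable def bundleMap (τ : Ω ≃ᵐ Ω) (A : Ω → E →L[ℝ] F)
    (hA : ∀ x, StronglyMeasurable fun ω => A ω x) (C : ℝ) (hC0 : 0 ≤ C) (hC : ∀ ω, ‖A ω‖ ≤ C) :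
    LInf Ω E →L[ℝ] LInf Ω F :=
  LinearMap.mkContinuous
    { toFun := fun φ => mk (fun ω => A (τ.symm ω) (φ.val (τ.symm ω)))
        ((stronglyMeasurable_apply hA φ.stronglyMeasurable_val).comp_measurable τ.symm.measurable)
        (C * ‖φ‖) fun ω => (A (τ.symm ω)).le_of_opNorm_le_of_le (hC _) (φ.norm_val_le _)
      map_add' := fun _ _ => ext fun ω => (A (τ.symm ω)).map_add _ _
      map_smul' := fun c _ => ext fun ω => (A (τ.symm ω)).map_smul c _ }
    C fun φ => norm_le (mul_nonneg hC0 (norm_nonneg φ)) fun ω =>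
      (A (τ.symm ω)).le_of_opNorm_le_of_le (hC _) (φ.norm_val_le _)

@[simp] theorem val_bundleMap (τ : Ω ≃ᵐ Ω) (A : Ω → E →L[ℝ] F)
    (hA : ∀ x, StronglyMeasurable fun ω => A ω x) (C : ℝ) (hC0 : 0 ≤ C) (hC : ∀ ω, ‖A ω‖ ≤ C)
    (φ : LInf Ω E) (ω : Ω) :
    (bundleMap τ A hA C hC0 hC φ).val ω = A (τ.symm ω) (φ.val (τ.symm ω)) := rfl

/-- Fibrewise action `(T φ)_ω = T φ_ω` of one bounded operator. -/
noncomputable def postcomp (Ω : Type*) [MeasurableSpace Ω] (T : E →L[ℝ] F) :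
    LInf Ω E →L[ℝ] LInf Ω F :=
  bundleMap (MeasurableEquiv.refl Ω) (fun _ => T) (fun _ => stronglyMeasurable_const) ‖T‖
    (norm_nonneg T) fun _ => le_rfl

@[simp] theorem val_postcomp (T : E →L[ℝ] F) (φ : LInf Ω E) (ω : Ω) :
    (postcomp Ω T φ).val ω = T (φ.val ω) := rfl

end LInf

/-! ### Regularity classes -/

/-- `f : U → Z` is of class `C^{(k,α)}` on `U`: it has `k` continuous derivatives, all derivatives
of order at most `k` (including `f` itself) are bounded on `U`, and the `k`-th one is `α`-Hölder
continuous on `U`. (`F` only serves to extend `f` to a function on the whole space; for open `U`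
nothing depends on its values outside `U`.) -/
def IsHolderCk {B : Type*} [NormedAddCommGroup B] [NormedSpace ℝ B] {U : Set B}
    {Z : Type*} [NormedAddCommGroup Z] [NormedSpace ℝ Z] (k : ℕ) (α : ℝ) (f : U → Z) : Prop :=
  ∃ F : B → Z, (∀ u : U, F u = f u) ∧ ContDiffOn ℝ k F U ∧
    (∀ q ≤ k, ∃ C : ℝ, ∀ u ∈ U, ‖iteratedFDerivWithin ℝ q F U u‖ ≤ C) ∧
    ∃ C : ℝ, ∀ u ∈ U, ∀ v ∈ U,
      ‖iteratedFDerivWithin ℝ k F U u - iteratedFDerivWithin ℝ k F U v‖ ≤ C * ‖u - v‖ ^ α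

/-- `f : U → Z` is of class `C^t`, `t ≥ 0`: for `t > 0` this is `C^{(k,α)}` with the unique
`k ∈ ℕ`, `α ∈ (0,1]` for which `t = k + α`; for `t = 0` the formula gives `k = 0`, `α = 0`, which
means bounded and continuous. -/
def IsCt {B : Type*} [NormedAddCommGroup B] [NormedSpace ℝ B] {U : Set B}
    {Z : Type*} [NormedAddCommGroup Z] [NormedSpace ℝ Z] (t : ℝ) (f : U → Z) : Prop :=
  IsHolderCk (⌈t⌉₊ - 1) (t - ((⌈t⌉₊ - 1 : ℕ) : ℝ)) f

/-! ### Regular cones and cone contractions -/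

/-- A closed convex cone `cone` in `E`, with a functional `ℓ` of norm one and constants `K`, `ρ`
witnessing outer and inner regularity, and a constant `ϑ` used to bound operators. -/
structure RegularCone (E : Type*) [NormedAddCommGroup E] [NormedSpace ℝ E] where
  cone : ProperCone ℝ E
  ℓ : E →L[ℝ] ℝ
  K : ℝ
  ρ : ℝ
  ϑ : ℝ
  norm_ℓ : ‖ℓ‖ = 1
  one_le_K : 1 ≤ K
  outer : ∀ φ ∈ cone, (1 / K) * ‖φ‖ ≤ ℓ φ
  ρ_pos : 0 < ρ
  ρ_le_one : ρ ≤ 1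
  inner : ∃ φ ∈ cone, φ ≠ 0 ∧ Metric.ball φ (ρ * ‖φ‖) ⊆ (cone : Set E)
  one_le_ϑ : 1 ≤ ϑ

/-- The sub-cone `C(ρ)` of the `φ ∈ C` with `B(φ, ρ‖φ‖) ⊆ C`. -/
def RegularCone.core {E : Type*} [NormedAddCommGroup E] [NormedSpace ℝ E] (D : RegularCone E) :
    Set E :=
  {φ | φ ∈ D.cone ∧ Metric.ball φ (D.ρ * ‖φ‖) ⊆ (D.cone : Set E)}

/-- Uniform cone contraction with uniform bounds: `A (C \ {0}) ⊆ C(ρ) \ {0}` and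
`1/ϑ ≤ ‖A‖ ≤ ϑ`. -/
structure RegularCone.IsContraction {E : Type*} [NormedAddCommGroup E] [NormedSpace ℝ E]
    (D : RegularCone E) (A : E →L[ℝ] E) : Prop where
  mapsTo : ∀ φ ∈ D.cone, φ ≠ 0 → A φ ∈ D.core ∧ A φ ≠ 0
  le_norm : 1 / D.ϑ ≤ ‖A‖
  norm_le : ‖A‖ ≤ D.ϑ

/-! ### Graded scales and cocycles over them -/

/-- A graded scale `(E_r)`, `0 < r ≤ r₀`, of Banach spaces with regular cones. -/
structure GradedScale {r₀ : ℝ} (E : Ioc 0 r₀ → Type*) [∀ r, NormedAddCommGroup (E r)]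
    [∀ r, NormedSpace ℝ (E r)] where
  D : ∀ r, RegularCone (E r)
  /-- the injection `j_{s,r} : E_r → E_s`, `s < r` -/
  j : ∀ {s r : Ioc 0 r₀}, s < r → (E r →L[ℝ] E s)
  j_injective : ∀ {s r : Ioc 0 r₀} (h : s < r), Function.Injective (j h)
  j_bounded : ∃ C : ℝ, ∀ {s r : Ioc 0 r₀} (h : s < r), ‖j h‖ ≤ C
  j_trans : ∀ {t s r : Ioc 0 r₀} (h₁ : t < s) (h₂ : s < r), j h₁ ∘L j h₂ = j (h₁.trans h₂)
  j_cone : ∀ {s r : Ioc 0 r₀} (h : s < r), ∀ φ ∈ (D r).cone, j h φ ∈ (D s).cone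
  j_ℓ : ∀ {s r : Ioc 0 r₀} (h : s < r), (D r).ℓ = (D s).ℓ ∘L j h
  /-- the constants are uniformly controlled on compact subsets of `(0, r₀]` -/
  bounded_on_compacts : ∀ Q : Set (Ioc 0 r₀), IsCompact Q →
    ∃ M : ℝ, ∀ r ∈ Q, (D r).K ≤ M ∧ (D r).ϑ ≤ M ∧ 1 / (D r).ρ ≤ M

/-- A family of cone-contracting cocycles `L_{r,u,ω} ∈ L(E_r)`, parametrized by `u ∈ U`, strongly
Bochner measurable in `ω` and commuting with the injections of the scale. -/
structure ConeCocycle {r₀ : ℝ} {E : Ioc 0 r₀ → Type*} [∀ r, NormedAddCommGroup (E r)]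
    [∀ r, NormedSpace ℝ (E r)] (S : GradedScale E) {B : Type*} (U : Set B)
    (Ω : Type*) [MeasurableSpace Ω] where
  L : ∀ r : Ioc 0 r₀, U → Ω → (E r →L[ℝ] E r)
  measurable : ∀ r u (x : E r), StronglyMeasurable fun ω => L r u ω x
  contraction : ∀ r u ω, (S.D r).IsContraction (L r u ω)
  equivariant : ∀ {s r : Ioc 0 r₀} (h : s < r) (u : U) (ω : Ω),
    S.j h ∘L L r u ω = L s u ω ∘L S.j h

namespace ConeCocycle

variable {r₀ : ℝ} {E : Ioc 0 r₀ → Type*} [∀ r, NormedAddCommGroup (E r)]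
  [∀ r, NormedSpace ℝ (E r)] {S : GradedScale E} {B : Type*} {U : Set B}
  {Ω : Type*} [MeasurableSpace Ω]

/-- The operator `𝐋_{r,u}` on `X_r = L^∞(Ω; E_r)`:
`(𝐋_{r,u} φ)_ω = L_{r,u,τ⁻¹ω} φ_{τ⁻¹ω}`. -/
noncomputable def op (c : ConeCocycle S U Ω) (τ : Ω ≃ᵐ Ω) (r : Ioc 0 r₀) (u : U) :
    LInf Ω (E r) →L[ℝ] LInf Ω (E r) :=
  LInf.bundleMap τ (c.L r u) (c.measurable r u) (S.D r).ϑ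
    (zero_le_one.trans (S.D r).one_le_ϑ) fun ω => (c.contraction r u ω).norm_le

/-- The normalization `Λ_{r,u}(φ) = ⟨ℓ_r, 𝐋_{r,u} φ⟩ ∈ L^∞(Ω; ℝ)`. -/
noncomputable def normalization (c : ConeCocycle S U Ω) (τ : Ω ≃ᵐ Ω) (r : Ioc 0 r₀) (u : U)
    (φ : LInf Ω (E r)) : LInf Ω ℝ :=
  LInf.postcomp Ω (S.D r).ℓ (c.op τ r u φ)

/-- The fractional linear map `π_{r,u}(φ) = Λ_{r,u}(φ)⁻¹ 𝐋_{r,u} φ`, as a section of `E_r`. -/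
noncomputable def fracLin (c : ConeCocycle S U Ω) (τ : Ω ≃ᵐ Ω) (r : Ioc 0 r₀) (u : U)
    (φ : LInf Ω (E r)) (ω : Ω) : E r :=
  ((c.normalization τ r u φ).val ω)⁻¹ • (c.op τ r u φ).val ω

/-- `f` is a consistent family of fixed point sections: each `f_r(u)` takes values in the slice
`{φ ∈ C_r : ⟨ℓ_r, φ⟩ = 1}`, is fixed by `π_{r,u}`, and `f_s(u) = j_{s,r} f_r(u)` for `s < r`. -/
structure IsFixedFamily (c : ConeCocycle S U Ω) (τ : Ω ≃ᵐ Ω)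
    (f : ∀ r : Ioc 0 r₀, U → LInf Ω (E r)) : Prop where
  mem_cone : ∀ r u ω, (f r u).val ω ∈ (S.D r).cone
  normalized : ∀ r u ω, (S.D r).ℓ ((f r u).val ω) = 1
  fixed : ∀ r u ω, (f r u).val ω = c.fracLin τ r u (f r u) ω
  consistent : ∀ {s r : Ioc 0 r₀} (h : s < r) (u : U),
    f s u = LInf.postcomp Ω (S.j h) (f r u)

end ConeCocycle

/-! ### Characteristic exponents -/

/-- `(𝐋ⁿ)_ω = L_{τ⁻¹ω} ∘ ⋯ ∘ L_{τ⁻ⁿω}`. -/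
noncomputable def cocycleIterate {Ω : Type*} [MeasurableSpace Ω] {E : Type*}
    [NormedAddCommGroup E] [NormedSpace ℝ E] (τ : Ω ≃ᵐ Ω) (A : Ω → E →L[ℝ] E) :
    ℕ → Ω → (E →L[ℝ] E)
  | 0, _ => ContinuousLinearMap.id ℝ E
  | n + 1, ω => A (τ.symm ω) ∘L cocycleIterate τ A n (τ.symm ω)

/-- The top characteristic exponent `limsup_n (1/n) log ‖(𝐋ⁿ)_ω‖`. -/
noncomputable def charExponent {Ω : Type*} [MeasurableSpace Ω] {E : Type*}
    [NormedAddCommGroup E] [NormedSpace ℝ E] (τ : Ω ≃ᵐ Ω) (A : Ω → E →L[ℝ] E) (ω : Ω) : ℝ :=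
  limsup (fun n : ℕ => (1 / (n : ℝ)) * Real.log ‖cocycleIterate τ A n ω‖) atTop

/-! Existence and exponent. An operator that sends the cone into its core shrinks order intervals:
if `φ` lies between `m • ψ` and `M • ψ`, then `A (φ - m • ψ)` and `A (M • ψ - φ)` lie in the core,
hence dominate definite multiples of `A ψ`, and the interval for `A φ` has length `(1 - ρ / K) (M -
m)` (`RegularCone.IsContraction.exists_interval`). The rate does not depend on `ω` or `u`, so the
normalized map contracts exponentially on sections of the core, uniformly over the fibres. Its fixed
point is `f_r(u)` (`ConeCocycle.exists_step_eq`), and uniqueness forces consistency between levels.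
Iterating the fixed point equation gives `(𝐋ⁿ)_ω f_{τ⁻ⁿω} = exp(S_n) f_ω`, where `S_n` is a Birkhoff
sum of `log Λ`. A cone preserving operator is comparable in norm with its value on one normalized
core element, so the exponent is the limit of `S_n / n`, which the ergodic theorem identifies.

Regularity. At a fixed level `u ↦ 𝐋_{s,u}` need not even be continuous, so the implicit function
theorem does not apply. Instead one uses the exact equation `(1 - T(u))(f(v) - f(u)) = P(u)(𝐋_v -
𝐋_u) f(v) - (quadratic remainder)`, where `P(u)` is the derivative of the normalization and `T(u) =
P(u) 𝐋_u` (`sub_sub_tangent`). Reading `f_s(v)` as `j_{s,r} f_r(v)` makes the difference of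
operators regular of every order below `r - s`. The interval contraction also makes the powers of
`T(u)` decay, so `1 - T(u)` has an inverse bounded uniformly in `u`. Only this boundedness is used,
never regularity of the inverse: the derivative satisfies `(1 - T) Df = P (D𝐋) f`, a linear equation
on a scale shortened by one, and induction applies (`HolderBelow.of_linear_equation`,
`HolderBelow.of_implicit_equation`). Products are controlled by a Leibniz rule in which the level is
chosen according to how the total order is split between the factors (`HolderBelow.bilin`).

Bookkeeping. `HolderBelow` has an open threshold `θ`, so levels strictly between two others always
leave room. Its depth `n` makes it a structural recursion and supplies the induction variable. All
spaces sit in one universe because the recursion replaces `Z` by `B →L[ℝ] Z`; the general case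
follows by lifting the parameters and the base. -/

open scoped Topology

universe w

/-! ### Functions of class `C^t` for every `t` below a threshold -/

section HolderBelow

variable {B : Type w} [NormedAddCommGroup B] [NormedSpace ℝ B]

/-- `F` is of class `C^t` on `U` for all `t < min n θ`. -/
def HolderBelow (U : Set B) : ℕ → ∀ {Z : Type w} [NormedAddCommGroup Z] [NormedSpace ℝ Z],
    ℝ → (B → Z) → Prop
  | 0, _, _, _, _, _ => True
  | n + 1, _, _, _, θ, F => 0 < θ →
      (∃ C, ∀ u ∈ U, ‖F u‖ ≤ C) ∧
      (∀ α, 0 < α → α < 1 → α < θ → ∃ C, ∀ u ∈ U, ∀ v ∈ U, ‖F u - F v‖ ≤ C * ‖u - v‖ ^ α) ∧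
      (1 < θ → (∀ u ∈ U, DifferentiableAt ℝ F u) ∧ HolderBelow U n (θ - 1) (fderiv ℝ F))

namespace HolderBelow

variable {U : Set B} {Z : Type w} [NormedAddCommGroup Z] [NormedSpace ℝ Z]
variable {W : Type w} [NormedAddCommGroup W] [NormedSpace ℝ W]

theorem congr (hU : IsOpen U) {n : ℕ} {θ : ℝ} {F G : B → Z} (h : HolderBelow U n θ F)
    (hFG : ∀ u ∈ U, F u = G u) : HolderBelow U n θ G := by
  induction n generalizing Z θ with
  | zero => trivial
  | succ n ih =>
    intro hθ
    obtain ⟨⟨C, hC⟩, h2, h3⟩ := h hθ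
    have hev : ∀ u ∈ U, F =ᶠ[𝓝 u] G := fun u hu => by
      filter_upwards [hU.mem_nhds hu] with v hv using hFG v hv
    refine ⟨⟨C, fun u hu => hFG u hu ▸ hC u hu⟩, fun α h0 h1 hα => ?_, fun h1 => ?_⟩
    · obtain ⟨C, hC⟩ := h2 α h0 h1 hα
      refine ⟨C, fun u hu v hv => ?_⟩
      rw [← hFG u hu, ← hFG v hv]
      exact hC u hu v hv
    · obtain ⟨h4, h5⟩ := h3 h1
      exact ⟨fun u hu => (h4 u hu).congr_of_eventuallyEq (hev u hu).symm,
        ih h5 fun u hu => (hev u hu).fderiv_eq⟩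

theorem of_nonpos {n : ℕ} {θ : ℝ} {F : B → Z} (hθ : θ ≤ 0) : HolderBelow U n θ F := by
  cases n with
  | zero => trivial
  | succ n => exact fun h => absurd h hθ.not_gt

/-- To check the recursive step it suffices to exhibit a derivative. -/
theorem succ (hU : IsOpen U) {n : ℕ} {θ : ℝ} {F : B → Z} (F' : B → B →L[ℝ] Z)
    (hb : 0 < θ → ∃ C, ∀ u ∈ U, ‖F u‖ ≤ C)
    (hh : ∀ α, 0 < α → α < 1 → α < θ → ∃ C, ∀ u ∈ U, ∀ v ∈ U, ‖F u - F v‖ ≤ C * ‖u - v‖ ^ α)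
    (hd : 1 < θ → ∀ u ∈ U, HasFDerivAt F (F' u) u)
    (h' : 1 < θ → HolderBelow U n (θ - 1) F') : HolderBelow U (n + 1) θ F :=
  fun hθ => ⟨hb hθ, hh, fun h1 => ⟨fun u hu => (hd h1 u hu).differentiableAt,
    (h' h1).congr hU fun u hu => (hd h1 u hu).fderiv.symm⟩⟩

theorem mono {n : ℕ} {θ θ' : ℝ} {F : B → Z} (h : HolderBelow U n θ F) (hθ : θ' ≤ θ) :
    HolderBelow U n θ' F := by
  induction n generalizing Z θ θ' with
  | zero => trivial
  | succ n ih =>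
    intro h0
    obtain ⟨h1, h2, h3⟩ := h (h0.trans_le hθ)
    exact ⟨h1, fun α a b c => h2 α a b (c.trans_le hθ), fun h4 =>
      ⟨(h3 (h4.trans_le hθ)).1, ih (h3 (h4.trans_le hθ)).2 (by linarith)⟩⟩

theorem of_succ {n : ℕ} {θ : ℝ} {F : B → Z} (h : HolderBelow U (n + 1) θ F) :
    HolderBelow U n θ F := by
  induction n generalizing Z θ with
  | zero => trivial
  | succ n ih =>
    intro h0
    obtain ⟨h1, h2, h3⟩ := h h0
    exact ⟨h1, h2, fun h4 => ⟨(h3 h4).1, ih (h3 h4).2⟩⟩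

theorem bounded {n : ℕ} {θ : ℝ} {F : B → Z} (h : HolderBelow U (n + 1) θ F) (hθ : 0 < θ) :
    ∃ C, 0 ≤ C ∧ ∀ u ∈ U, ‖F u‖ ≤ C := by
  obtain ⟨⟨C, hC⟩, -, -⟩ := h hθ
  exact ⟨max C 0, le_max_right _ _, fun u hu => (hC u hu).trans (le_max_left _ _)⟩

theorem holder {n : ℕ} {θ : ℝ} {F : B → Z} (h : HolderBelow U (n + 1) θ F) {α : ℝ} (h0 : 0 < α)
    (h1 : α < 1) (hα : α < θ) :
    ∃ C, 0 ≤ C ∧ ∀ u ∈ U, ∀ v ∈ U, ‖F u - F v‖ ≤ C * ‖u - v‖ ^ α := by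
  obtain ⟨-, h2, -⟩ := h (h0.trans hα)
  obtain ⟨C, hC⟩ := h2 α h0 h1 hα
  exact ⟨max C 0, le_max_right _ _, fun u hu v hv => (hC u hu v hv).trans
    (mul_le_mul_of_nonneg_right (le_max_left _ _) (by positivity))⟩

theorem hasFDerivAt {n : ℕ} {θ : ℝ} {F : B → Z} (h : HolderBelow U (n + 1) θ F) (hθ : 1 < θ)
    {u : B} (hu : u ∈ U) : HasFDerivAt F (fderiv ℝ F u) u :=
  (((h (one_pos.trans hθ)).2.2 hθ).1 u hu).hasFDerivAt

theorem fderiv {n : ℕ} {θ : ℝ} {F : B → Z} (h : HolderBelow U (n + 1) θ F) :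
    HolderBelow U n (θ - 1) (fderiv ℝ F) := by
  rcases le_or_gt θ 1 with hθ | hθ
  · exact of_nonpos (by linarith)
  · exact ((h (one_pos.trans hθ)).2.2 hθ).2

theorem continuousAt (hU : IsOpen U) {n : ℕ} {θ : ℝ} {F : B → Z}
    (h : HolderBelow U (n + 1) θ F) (hθ : 0 < θ) {u : B} (hu : u ∈ U) : ContinuousAt F u := by
  obtain ⟨C, -, hC⟩ := h.holder (α := min (1 / 2) (θ / 2)) (by positivity)
    ((min_le_left _ _).trans_lt (by norm_num)) ((min_le_right _ _).trans_lt (by linarith))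
  set α := min (1 / 2) (θ / 2) with hα
  have hα0 : 0 < α := by positivity
  rw [ContinuousAt, tendsto_iff_norm_sub_tendsto_zero]
  have h1 : Tendsto (fun v => C * ‖v - u‖ ^ α) (𝓝 u) (𝓝 (C * 0)) := by
    refine Tendsto.const_mul _ ?_
    have h2 : Tendsto (fun v => ‖v - u‖) (𝓝 u) (𝓝 0) :=
      tendsto_iff_norm_sub_tendsto_zero.1 tendsto_id
    simpa [Real.zero_rpow hα0.ne'] using h2.rpow_const (p := α) (Or.inr hα0.le)
  rw [mul_zero] at h1
  refine squeeze_zero' (Eventually.of_forall fun _ => norm_nonneg _) ?_ h1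
  filter_upwards [hU.mem_nhds hu] with v hv using hC v hv u hu

theorem clm_comp (hU : IsOpen U) {n : ℕ} {θ : ℝ} {F : B → Z} (h : HolderBelow U n θ F)
    (Φ : Z →L[ℝ] W) : HolderBelow U n θ fun u => Φ (F u) := by
  induction n generalizing Z W θ with
  | zero => trivial
  | succ n ih =>
    refine succ hU (fun u => Φ ∘L _root_.fderiv ℝ F u) (fun h0 => ?_) (fun α h0 h1 h2 => ?_)
      (fun h1 u hu => Φ.hasFDerivAt.comp u (h.hasFDerivAt h1 hu))
      (fun _ => ih h.fderiv (ContinuousLinearMap.compL ℝ B Z W Φ))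
    · obtain ⟨C, -, hC⟩ := h.bounded h0
      exact ⟨‖Φ‖ * C, fun u hu => Φ.le_opNorm_of_le (hC u hu)⟩
    · obtain ⟨C, -, hC⟩ := h.holder h0 h1 h2
      refine ⟨‖Φ‖ * C, fun u hu v hv => ?_⟩
      rw [← map_sub, mul_assoc]
      exact Φ.le_opNorm_of_le (hC u hu v hv)

theorem const (hU : IsOpen U) {n : ℕ} {θ : ℝ} (z : Z) : HolderBelow U n θ fun _ => z := by
  induction n generalizing Z θ with
  | zero => trivial
  | succ n ih =>
    refine succ hU (fun _ => 0) (fun _ => ⟨‖z‖, fun _ _ => le_rfl⟩)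
      (fun _ _ _ _ => ⟨0, fun _ _ _ _ => by simp⟩) (fun _ u _ => hasFDerivAt_const _ _)
      (fun _ => ih 0)

theorem add (hU : IsOpen U) {n : ℕ} {θ : ℝ} {F G : B → Z} (hF : HolderBelow U n θ F)
    (hG : HolderBelow U n θ G) : HolderBelow U n θ fun u => F u + G u := by
  induction n generalizing Z θ with
  | zero => trivial
  | succ n ih =>
    refine succ hU (fun u => _root_.fderiv ℝ F u + _root_.fderiv ℝ G u) (fun h0 => ?_)
      (fun α h0 h1 h2 => ?_)
      (fun h1 u hu => (hF.hasFDerivAt h1 hu).add (hG.hasFDerivAt h1 hu))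
      (fun _ => ih hF.fderiv hG.fderiv)
    · obtain ⟨C, -, hC⟩ := hF.bounded h0
      obtain ⟨D, -, hD⟩ := hG.bounded h0
      exact ⟨C + D, fun u hu => norm_add_le_of_le (hC u hu) (hD u hu)⟩
    · obtain ⟨C, -, hC⟩ := hF.holder h0 h1 h2
      obtain ⟨D, -, hD⟩ := hG.holder h0 h1 h2
      refine ⟨C + D, fun u hu v hv => ?_⟩
      rw [add_sub_add_comm, add_mul]
      exact norm_add_le_of_le (hC u hu v hv) (hD u hu v hv)

theorem sub (hU : IsOpen U) {n : ℕ} {θ : ℝ} {F G : B → Z} (hF : HolderBelow U n θ F)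
    (hG : HolderBelow U n θ G) : HolderBelow U n θ fun u => F u - G u := by
  refine (hF.add hU (hG.clm_comp hU (-ContinuousLinearMap.id ℝ Z))).congr hU fun u _ => ?_
  simp [sub_eq_add_neg]

end HolderBelow

/-- The derivative of `v ↦ β (a v) (b v)` at `u` when the first factor is only continuous and
the second one vanishes at `u`. -/
theorem hasFDerivAt_bilin_of_continuousAt {P Q Z : Type*} [NormedAddCommGroup P] [NormedSpace ℝ P]
    [NormedAddCommGroup Q] [NormedSpace ℝ Q] [NormedAddCommGroup Z] [NormedSpace ℝ Z]
    (β : P →L[ℝ] Q →L[ℝ] Z) {a : B → P} {b : B → Q} {b' : B →L[ℝ] Q} {u : B}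
    (ha : ContinuousAt a u) (hb : HasFDerivAt b b' u) :
    HasFDerivAt (fun v => β (a v) (b v - b u)) (β (a u) ∘L b') u := by
  have h1 : HasFDerivAt (fun v => β (a u) (b v - b u)) (β (a u) ∘L b') u :=
    (β (a u)).hasFDerivAt.comp u (hb.sub_const _)
  have h2 : HasFDerivAt (fun v => β (a v - a u) (b v - b u)) (0 : B →L[ℝ] Z) u := by
    rw [hasFDerivAt_iff_isLittleO_nhds_zero]
    have hu0 : Tendsto (fun h => u + h) (𝓝 0) (𝓝 u) := by
      simpa using (continuous_const_add u).tendsto (0 : B)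
    have hb0 := (hb.isBigO_sub).comp_tendsto hu0
    have ha0 : (fun h => a (u + h) - a u) =o[𝓝 0] fun _ => (1 : ℝ) := by
      rw [Asymptotics.isLittleO_one_iff]
      have : Tendsto (fun h => a (u + h)) (𝓝 0) (𝓝 (a u)) :=
        ha.tendsto.comp hu0
      simpa using this.sub_const (a u)
    have := ha0.norm_norm.mul_isBigO hb0.norm_norm
    refine Asymptotics.IsBigO.trans_isLittleO (g := fun h => ‖a (u + h) - a u‖ * ‖b (u + h) - b u‖)
      ?_ ?_
    · refine Asymptotics.IsBigO.of_bound ‖β‖ (Eventually.of_forall fun h => ?_)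
      simp only [sub_self, map_zero, sub_zero, zero_apply, norm_mul, norm_norm]
      rw [← mul_assoc]
      exact β.le_opNorm₂ _ _
    · rw [← Asymptotics.isLittleO_norm_right]
      simpa [Function.comp_def] using this
  have := h1.add h2
  rw [add_zero] at this
  refine this.congr_of_eventuallyEq (Eventually.of_forall fun v => ?_)
  simp

namespace HolderBelow

variable {U : Set B}

/-- **Leibniz rule in a graded scale.** A product of two factors may be formed at any level `i` of
a scale; the regularity of the product is the total regularity `θ`, if for every
distribution of `θ` among the two factors there is a level where they have this regularity. -/
theorem bilin (hU : IsOpen U) {ι : Type*} {n : ℕ} {P Q : ι → Type w}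
    [∀ i, NormedAddCommGroup (P i)] [∀ i, NormedSpace ℝ (P i)]
    [∀ i, NormedAddCommGroup (Q i)] [∀ i, NormedSpace ℝ (Q i)]
    {Z : Type w} [NormedAddCommGroup Z] [NormedSpace ℝ Z]
    (β : ∀ i, P i →L[ℝ] Q i →L[ℝ] Z) {x y : ι → ℝ} {θ : ℝ}
    {a : ∀ i, B → P i} {b : ∀ i, B → Q i} {G : B → Z}
    (hι : ∀ p, 0 < p → p < θ → ∃ i, p ≤ x i ∧ θ - p ≤ y i)
    (ha : ∀ i, HolderBelow U n (x i) (a i)) (hb : ∀ i, HolderBelow U n (y i) (b i))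
    (hc : ∀ i i', 0 < x i → 0 < y i → 0 < x i' → 0 < y i' → ∀ u ∈ U, ∀ v ∈ U,
      β i (a i u) (b i v) = β i' (a i' u) (b i' v))
    (hG : ∀ i, 0 < x i → 0 < y i → ∀ u ∈ U, G u = β i (a i u) (b i u)) :
    HolderBelow U n θ G := by
  induction n generalizing P Q Z x y θ with
  | zero => trivial
  | succ n ih =>
    -- One unit of regularity is reserved for the factor to be differentiated, and half of the
    -- remaining `θ - 1` goes to each factor. The two terms of the product rule thus live at
    -- different levels.
    have key : 1 < θ → ∃ i i', 0 < x i ∧ 1 < y i ∧ 1 < x i' ∧ 0 < y i' := fun hθ => by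
      obtain ⟨i, h1, h2⟩ := hι ((θ - 1) / 2) (by linarith) (by linarith)
      obtain ⟨i', h3, h4⟩ := hι ((θ + 1) / 2) (by linarith) (by linarith)
      exact ⟨i, i', by linarith, by linarith, by linarith, by linarith⟩
    rcases le_or_gt θ 0 with hθ0 | hθ0
    · exact of_nonpos hθ0
    refine fun _ => ⟨?_, fun α h0 h1 h2 => ?_, fun hθ => ?_⟩
    · obtain ⟨i, h1, h2⟩ := hι (θ / 2) (by linarith) (by linarith)
      have hx : 0 < x i := by linarith
      have hy : 0 < y i := by linarith
      obtain ⟨C, hC0, hC⟩ := (ha i).bounded hx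
      obtain ⟨D, hD0, hD⟩ := (hb i).bounded hy
      refine ⟨‖β i‖ * C * D, fun u hu => ?_⟩
      rw [hG i hx hy u hu]
      exact (β i).le_of_opNorm₂_le_of_le le_rfl (hC u hu) (hD u hu)
    -- The difference is telescoped: at level `i` the factor `b` is `α`-Hölder and `a` bounded, at
    -- level `i'` the roles are exchanged. The mixed term `β (a u) (b v)` is the same at both levels
    -- by `hc`.
    · obtain ⟨i, h3, h4⟩ := hι ((θ - α) / 2) (by linarith) (by linarith)
      obtain ⟨i', h5, h6⟩ := hι ((θ + α) / 2) (by linarith) (by linarith)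
      have hx : 0 < x i := by linarith
      have hy : α < y i := by linarith
      have hx' : α < x i' := by linarith
      have hy' : 0 < y i' := by linarith
      obtain ⟨C, hC0, hC⟩ := (ha i).bounded hx
      obtain ⟨D, hD0, hD⟩ := (hb i).holder h0 h1 hy
      obtain ⟨C', hC'0, hC'⟩ := (ha i').holder h0 h1 hx'
      obtain ⟨D', hD'0, hD'⟩ := (hb i').bounded hy'
      refine ⟨‖β i‖ * C * D + ‖β i'‖ * C' * D', fun u hu v hv => ?_⟩
      have h7 : G u - G v = β i (a i u) (b i u - b i v) + β i' (a i' u - a i' v) (b i' v) := by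
        rw [hG i hx (h0.trans hy) u hu, hG i' (h0.trans hx') hy' v hv, map_sub, map_sub,
          sub_apply, hc i i' hx (h0.trans hy) (h0.trans hx') hy' u hu v hv]
        abel
      rw [h7, add_mul]
      refine norm_add_le_of_le ?_ ?_
      · rw [mul_assoc _ D]
        exact (β i).le_of_opNorm₂_le_of_le le_rfl (hC u hu) (hD u hu v hv)
      · rw [show ‖β i'‖ * C' * D' * ‖u - v‖ ^ α = ‖β i'‖ * (C' * ‖u - v‖ ^ α) * D' by ring]
        exact (β i').le_of_opNorm₂_le_of_le le_rfl (hC' u hu v hv) (hD' v hv)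
    · obtain ⟨i, i', hx, hy, hx', hy'⟩ := key hθ
      have hy0 := one_pos.trans hy
      have hx0 := one_pos.trans hx'
      set G₁ : B → B →L[ℝ] Z := fun u => (β i).precompR B (a i u) (_root_.fderiv ℝ (b i) u)
      set G₂ : B → B →L[ℝ] Z := fun u => (β i').precompL B (_root_.fderiv ℝ (a i') u) (b i' u)
      have hc1 : ∀ k k', 0 < x k → 0 < y k - 1 → 0 < x k' → 0 < y k' - 1 → ∀ u ∈ U, ∀ v ∈ U,
          (β k).precompR B (a k u) (_root_.fderiv ℝ (b k) v) =
            (β k').precompR B (a k' u) (_root_.fderiv ℝ (b k') v) := by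
        intro k k' h1 h2 h3 h4 u hu v hv
        have e1 : HasFDerivAt (fun v => β k (a k u) (b k v))
            ((β k).precompR B (a k u) (_root_.fderiv ℝ (b k) v)) v :=
          (β k (a k u)).hasFDerivAt.comp v ((hb k).hasFDerivAt (by linarith) hv)
        have e2 : HasFDerivAt (fun v => β k' (a k' u) (b k' v))
            ((β k').precompR B (a k' u) (_root_.fderiv ℝ (b k') v)) v :=
          (β k' (a k' u)).hasFDerivAt.comp v ((hb k').hasFDerivAt (by linarith) hv)
        -- Compatibility of the differentiated factors follows from uniqueness of the derivative,
        -- since the undifferentiated products agree near `v`.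
        refine e1.unique (e2.congr_of_eventuallyEq ?_)
        filter_upwards [hU.mem_nhds hv] with v' hv'
        exact hc k k' h1 (by linarith) h3 (by linarith) u hu v' hv'
      have hc2 : ∀ k k', 0 < x k - 1 → 0 < y k → 0 < x k' - 1 → 0 < y k' → ∀ u ∈ U, ∀ v ∈ U,
          (β k).precompL B (_root_.fderiv ℝ (a k) u) (b k v) =
            (β k').precompL B (_root_.fderiv ℝ (a k') u) (b k' v) := by
        intro k k' h1 h2 h3 h4 u hu v hv
        have e1 : HasFDerivAt (fun u => (β k).flip (b k v) (a k u))
            ((β k).precompL B (_root_.fderiv ℝ (a k) u) (b k v)) u :=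
          ((β k).flip (b k v)).hasFDerivAt.comp u ((ha k).hasFDerivAt (by linarith) hu)
        have e2 : HasFDerivAt (fun u => (β k').flip (b k' v) (a k' u))
            ((β k').precompL B (_root_.fderiv ℝ (a k') u) (b k' v)) u :=
          ((β k').flip (b k' v)).hasFDerivAt.comp u ((ha k').hasFDerivAt (by linarith) hu)
        refine e1.unique (e2.congr_of_eventuallyEq ?_)
        filter_upwards [hU.mem_nhds hu] with u' hu'
        exact hc k k' (by linarith) h2 (by linarith) h4 u' hu' v hv
      have hd : ∀ u ∈ U, HasFDerivAt G (G₁ u + G₂ u) u := by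
        intro u hu
        -- `G v` is split as `β (a v) (b v - b u) + β (a v) (b u)`. In the first term, read at level
        -- `i`, `a` need only be continuous; in the second, read at level `i'`, `b u` is frozen.
        have e1 := hasFDerivAt_bilin_of_continuousAt (β i) ((ha i).continuousAt hU hx hu)
          ((hb i).hasFDerivAt hy hu)
        have e2 : HasFDerivAt (fun u' => (β i').flip (b i' u) (a i' u')) (G₂ u) u :=
          ((β i').flip (b i' u)).hasFDerivAt.comp u ((ha i').hasFDerivAt hx' hu)
        refine (e1.add e2).congr_of_eventuallyEq ?_
        filter_upwards [hU.mem_nhds hu] with v hv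
        simp only [Pi.add_apply, ContinuousLinearMap.flip_apply, map_sub]
        rw [hG i hx hy0 v hv, hc i i' hx hy0 hx0 hy' v hv u hu]
        abel
      refine ⟨fun u hu => (hd u hu).differentiableAt,
        HolderBelow.congr hU (F := fun u => G₁ u + G₂ u) ?_ fun u hu => (hd u hu).fderiv.symm⟩
      refine HolderBelow.add hU ?_ ?_
      · refine ih (fun k => (β k).precompR B) (x := x) (y := fun k => y k - 1) ?_
          (fun k => (ha k).of_succ) (fun k => (hb k).fderiv) hc1
          fun k h1 h2 u hu => hc1 i k hx (by linarith) h1 h2 u hu u hu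
        intro p h1 h2
        obtain ⟨k, h3, h4⟩ := hι p h1 (by linarith)
        exact ⟨k, h3, by linarith⟩
      · refine ih (fun k => (β k).precompL B) (x := fun k => x k - 1) (y := y) ?_
          (fun k => (ha k).fderiv) (fun k => (hb k).of_succ) hc2
          fun k h1 h2 u hu => hc2 i' k (by linarith) hy' h1 h2 u hu u hu
        intro p h1 h2
        obtain ⟨k, h3, h4⟩ := hι (p + 1) (by linarith) (by linarith)
        exact ⟨k, by linarith, by linarith⟩

/-- The Leibniz rule without a scale. -/
theorem bilin' (hU : IsOpen U) {n : ℕ} {P Q Z : Type w}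
    [NormedAddCommGroup P] [NormedSpace ℝ P] [NormedAddCommGroup Q] [NormedSpace ℝ Q]
    [NormedAddCommGroup Z] [NormedSpace ℝ Z]
    (β : P →L[ℝ] Q →L[ℝ] Z) {θ : ℝ} {a : B → P} {b : B → Q}
    (ha : HolderBelow U n θ a) (hb : HolderBelow U n θ b) :
    HolderBelow U n θ fun u => β (a u) (b u) :=
  bilin hU (ι := Unit) (fun _ => β) (x := fun _ => θ) (y := fun _ => θ) (a := fun _ => a)
    (b := fun _ => b) (fun p h0 h1 => ⟨(), h1.le, by linarith⟩) (fun _ => ha) (fun _ => hb)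
    (fun _ _ _ _ _ _ _ _ _ _ => rfl) fun _ _ _ _ _ => rfl

end HolderBelow

end HolderBelow

/-- Composition of operators, as a bounded bilinear map. -/
noncomputable abbrev compBilin (X Y Z : Type*) [NormedAddCommGroup X] [NormedSpace ℝ X]
    [NormedAddCommGroup Y] [NormedSpace ℝ Y] [NormedAddCommGroup Z] [NormedSpace ℝ Z] :
    (Y →L[ℝ] Z) →L[ℝ] (X →L[ℝ] Y) →L[ℝ] (X →L[ℝ] Z) :=
  ContinuousLinearMap.compL ℝ X Y Z

theorem norm_compBilin_apply_le (X : Type*) {Y Z : Type*} [NormedAddCommGroup X] [NormedSpace ℝ X]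
    [NormedAddCommGroup Y] [NormedSpace ℝ Y] [NormedAddCommGroup Z] [NormedSpace ℝ Z]
    (A : Y →L[ℝ] Z) : ‖compBilin X Y Z A‖ ≤ ‖A‖ :=
  ContinuousLinearMap.opNorm_le_bound _ (norm_nonneg A) fun x =>
    ContinuousLinearMap.opNorm_comp_le A x

theorem HolderBelow.compBilin {B X Y Z : Type w} [NormedAddCommGroup B] [NormedSpace ℝ B]
    [NormedAddCommGroup X] [NormedSpace ℝ X] [NormedAddCommGroup Y] [NormedSpace ℝ Y]
    [NormedAddCommGroup Z] [NormedSpace ℝ Z] {U : Set B} (hU : IsOpen U) {n : ℕ} {θ : ℝ}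
    {F : B → Y →L[ℝ] Z} (h : HolderBelow U n θ F) :
    HolderBelow U n θ fun u => compBilin X Y Z (F u) :=
  h.clm_comp hU _

/-! ### Products and linear equations along the levels of a scale. -/

namespace HolderBelow

variable {B : Type w} [NormedAddCommGroup B] [NormedSpace ℝ B] {U : Set B}

/-- The levels of the scale strictly between `s` and `R`. -/
abbrev Levels {r₀ : ℝ} (s : Ioc 0 r₀) (R : ℝ) : Type := {r : Ioc 0 r₀ // s < r ∧ (r : ℝ) < R}

theorem exists_level {r₀ : ℝ} {s : Ioc 0 r₀} {R x : ℝ} (hR : R ≤ r₀) (hx : (s : ℝ) < x)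
    (hxR : x < R) : ∃ i : Levels s R, (i.1 : ℝ) = x :=
  ⟨⟨⟨x, s.2.1.trans hx, hxR.le.trans hR⟩, Subtype.coe_lt_coe.1 hx, hxR⟩, rfl⟩

/-- Application of operators to vectors at intermediate levels of a scale. -/
theorem apply (hU : IsOpen U) {r₀ : ℝ} {X : Ioc 0 r₀ → Type w}
    [∀ s, NormedAddCommGroup (X s)] [∀ s, NormedSpace ℝ (X s)]
    {Z : Type w} [NormedAddCommGroup Z] [NormedSpace ℝ Z] {n : ℕ} {s : Ioc 0 r₀} {R : ℝ}
    (hR : R ≤ r₀) {a : ∀ i : Levels s R, B → X i.1 →L[ℝ] Z} {g : ∀ r : Ioc 0 r₀, B → X r}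
    {G : B → Z} (ha : ∀ i, HolderBelow U n (i.1 - s : ℝ) (a i))
    (hg : ∀ i : Levels s R, HolderBelow U n (R - i.1) (g i.1))
    (hc : ∀ i i', ∀ u ∈ U, ∀ v ∈ U, a i u (g i.1 v) = a i' u (g i'.1 v))
    (hG : ∀ i, ∀ u ∈ U, G u = a i u (g i.1 u)) : HolderBelow U n (R - s) G := by
  refine bilin hU (ι := Levels s R) (P := fun i => X i.1 →L[ℝ] Z) (Q := fun i => X i.1)
    (fun i => ContinuousLinearMap.id ℝ (X i.1 →L[ℝ] Z))
    (x := fun i => (i.1 : ℝ) - s) (y := fun i => R - i.1) (a := a) (b := fun i => g i.1)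
    (fun p h5 h6 => ?_) ha hg (fun i i' _ _ _ _ => hc i i') (fun i _ _ => hG i)
  obtain ⟨i, hi⟩ := exists_level hR (show (s : ℝ) < s + p by linarith) (by linarith)
  exact ⟨i, by simp only [hi]; linarith, by simp only [hi]; linarith⟩

/-- Application of the derivative of operators to vectors at intermediate levels of a scale. -/
theorem fderiv_apply (hU : IsOpen U) {r₀ : ℝ} {X : Ioc 0 r₀ → Type w}
    [∀ s, NormedAddCommGroup (X s)] [∀ s, NormedSpace ℝ (X s)]
    {Z : Type w} [NormedAddCommGroup Z] [NormedSpace ℝ Z] {n : ℕ} {s : Ioc 0 r₀} {R : ℝ}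
    (hR : R ≤ r₀) {a : ∀ i : Levels s R, B → X i.1 →L[ℝ] Z} {g : ∀ r : Ioc 0 r₀, B → X r}
    (ha : ∀ i, HolderBelow U (n + 1) (i.1 - s : ℝ) (a i))
    (hg : ∀ i : Levels s R, HolderBelow U n (R - i.1) (g i.1))
    (hc : ∀ i i', ∀ u ∈ U, ∀ v ∈ U, a i u (g i.1 v) = a i' u (g i'.1 v))
    (i : Levels s R) (hi : (s : ℝ) + 1 < i.1) :
    HolderBelow U n (R - 1 - s) fun u => (_root_.fderiv ℝ (a i) u).flip (g i.1 u) := by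
  have hcomp : ∀ i i' : Levels s R, 0 < (i.1 : ℝ) - s - 1 → 0 < (i'.1 : ℝ) - s - 1 →
      ∀ u ∈ U, ∀ v ∈ U, (_root_.fderiv ℝ (a i) u).flip (g i.1 v) =
        (_root_.fderiv ℝ (a i') u).flip (g i'.1 v) := by
    intro i i' h5 h6 u hu v hv
    have e1 : ∀ i : Levels s R, 0 < (i.1 : ℝ) - s - 1 → HasFDerivAt (fun u => a i u (g i.1 v))
        ((_root_.fderiv ℝ (a i) u).flip (g i.1 v)) u := fun i h5 =>
      (ContinuousLinearMap.apply ℝ Z (g i.1 v)).hasFDerivAt.comp u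
        ((ha i).hasFDerivAt (by linarith) hu)
    refine (e1 i h5).unique ((e1 i' h6).congr_of_eventuallyEq ?_)
    filter_upwards [hU.mem_nhds hu] with u' hu' using hc i i' u' hu' v hv
  refine bilin hU (ι := Levels s R)
    (P := fun i => B →L[ℝ] X i.1 →L[ℝ] Z) (Q := fun i => X i.1)
    (fun i => (ContinuousLinearMap.flipₗᵢ ℝ B (X i.1) Z).toContinuousLinearEquiv)
    (x := fun i => (i.1 : ℝ) - s - 1) (y := fun i => R - i.1)
    (a := fun i => _root_.fderiv ℝ (a i)) (b := fun i => g i.1) (fun p h5 h6 => ?_)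
    (fun i => (ha i).fderiv) hg (fun i i' h5 _ h6 _ => hcomp i i' h5 h6)
    fun i' h5 _ u hu => hcomp i i' (by linarith) h5 u hu u hu
  obtain ⟨i, hi⟩ := exists_level hR (show (s : ℝ) < s + 1 + p by linarith) (by linarith)
  exact ⟨i, by simp only [hi]; linarith, by simp only [hi]; linarith⟩

/-- **Regularity of solutions of linear equations in a graded scale.** If `(1 - T(u)) g(u) = b(u)`
at every level of the scale, the inverses of `1 - T(u)` are bounded at each level, and `T(u)` gains
regularity in `u` as it loses regularity in the scale, then `g` inherits the regularity of `b`. -/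
theorem of_linear_equation (hU : IsOpen U) {r₀ : ℝ} {X : Ioc 0 r₀ → Type w}
    [∀ s, NormedAddCommGroup (X s)] [∀ s, NormedSpace ℝ (X s)] {n : ℕ} {R : ℝ} (hR : R ≤ r₀)
    (j : ∀ {s r : Ioc 0 r₀}, s < r → (X r →L[ℝ] X s))
    {g b : ∀ s, B → X s} {T N : ∀ s, B → X s →L[ℝ] X s}
    (hg : ∀ {s r : Ioc 0 r₀} (h : s < r), (r : ℝ) < R → ∀ u ∈ U, g s u = j h (g r u))
    (heq : ∀ s : Ioc 0 r₀, (s : ℝ) < R → ∀ u ∈ U, g s u - T s u (g s u) = b s u)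
    (hN : ∀ s, ∃ C, ∀ u ∈ U, ‖N s u‖ ≤ C)
    (hNl : ∀ s, ∀ u ∈ U, ∀ x, N s u (x - T s u x) = x)
    (hNr : ∀ s, ∀ u ∈ U, ∀ x, N s u x - T s u (N s u x) = x)
    (hT : ∀ {s r : Ioc 0 r₀} (h : s < r), HolderBelow U n (r - s : ℝ) fun u => T s u ∘L j h)
    (hb : ∀ s : Ioc 0 r₀, (s : ℝ) < R → HolderBelow U n (R - s) (b s)) :
    ∀ s : Ioc 0 r₀, (s : ℝ) < R → HolderBelow U n (R - s) (g s) := by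
  induction n generalizing X R with
  | zero => exact fun _ _ => trivial
  | succ n ih =>
    have between : ∀ (s : Ioc 0 r₀) (y : ℝ), 0 ≤ y → (s : ℝ) + y < R →
        ∃ r : Ioc 0 r₀, s < r ∧ (s : ℝ) + y < r ∧ (r : ℝ) < R := fun s y hy hsy => by
      have hs := s.2.1
      refine ⟨⟨(s + y + R) / 2, by constructor <;> linarith⟩, ?_, ?_, ?_⟩
      · rw [← Subtype.coe_lt_coe]; simp only; linarith
      all_goals simp only; linarith
    have bdd : ∀ s : Ioc 0 r₀, (s : ℝ) < R → ∃ C, 0 ≤ C ∧ ∀ u ∈ U, ‖g s u‖ ≤ C := fun s hs => by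
      obtain ⟨C, hC⟩ := hN s
      obtain ⟨D, hD0, hD⟩ := (hb s hs).bounded (by linarith)
      refine ⟨|C| * D, by positivity, fun u hu => ?_⟩
      rw [← hNl s u hu (g s u), heq s hs u hu]
      exact (N s u).le_of_opNorm_le_of_le ((hC u hu).trans (le_abs_self C)) (hD u hu)
    -- Subtracting the equations at `v` and `u` leaves `(1 - T(u))(g(v) - g(u))` on one side. The
    -- remaining difference of operators acts on `g v`, which is lifted to the level `r` where `T ∘
    -- j` is regular; only `N s u`, at one fixed point, is needed to solve.
    have formula : ∀ (s r : Ioc 0 r₀) (h : s < r), (r : ℝ) < R → ∀ u ∈ U, ∀ v ∈ U,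
        g s v = g s u + N s u (b s v - b s u + ((T s v ∘L j h) (g r v) -
          (T s u ∘L j h) (g r v))) := fun s r h hr u hu v hv => by
      have hs : (s : ℝ) < R := lt_trans (Subtype.coe_lt_coe.2 h) hr
      rw [← sub_eq_iff_eq_add', ← hNl s u hu (g s v - g s u)]
      congr 1
      rw [← heq s hs u hu, ← heq s hs v hv, map_sub]
      simp only [ContinuousLinearMap.comp_apply, ← hg h hr v hv]
      abel
    have hol : ∀ s : Ioc 0 r₀, (s : ℝ) < R → ∀ α, 0 < α → α < 1 → α < R - s →
        ∃ C, ∀ u ∈ U, ∀ v ∈ U, ‖g s u - g s v‖ ≤ C * ‖u - v‖ ^ α := fun s hs α h0 h1 h2 => by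
      obtain ⟨r, hsr, h3, h4⟩ := between s α h0.le (by linarith)
      obtain ⟨C, hC⟩ := hN s
      obtain ⟨D, hD0, hD⟩ := (hb s hs).holder h0 h1 h2
      obtain ⟨G, hG0, hG⟩ := bdd r h4
      obtain ⟨M, hM0, hM⟩ := (hT hsr).holder h0 h1 (by linarith)
      refine ⟨|C| * (D + M * G), fun u hu v hv => ?_⟩
      rw [formula s r hsr h4 v hv u hu, add_sub_cancel_left, mul_assoc]
      refine (N s v).le_of_opNorm_le_of_le ((hC v hv).trans (le_abs_self C)) ?_
      rw [add_mul, ← sub_apply]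
      refine norm_add_le_of_le (hD u hu v hv) ?_
      rw [mul_right_comm]
      exact ContinuousLinearMap.le_of_opNorm_le_of_le _ (hM u hu v hv) (hG u hu)
    -- With threshold at most one the derivative clause of `HolderBelow` is vacuous, so the bound
    -- and the Hölder estimates suffice.
    have cont : ∀ s : Ioc 0 r₀, (s : ℝ) < R → ∀ u ∈ U, ContinuousAt (g s) u := fun s hs u hu =>
      continuousAt (n := 0) hU (θ := min 1 (R - s)) (fun _ => ⟨(bdd s hs).imp fun _ h => h.2,
        fun α h0 h1 h2 => hol s hs α h0 h1 (h2.trans_le (min_le_right _ _)),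
        fun h => absurd (min_le_left _ _) h.not_ge⟩) (by simpa using hs) hu
    have der : ∀ (s r : Ioc 0 r₀) (h : s < r), (s : ℝ) + 1 < r → (r : ℝ) < R → ∀ u ∈ U,
        HasFDerivAt (g s) (N s u ∘L (_root_.fderiv ℝ (b s) u +
          (_root_.fderiv ℝ (fun u => T s u ∘L j h) u).flip (g r u))) u := by
      intro s r h h1 h2 u hu
      have e1 := ((hb s (by linarith)).hasFDerivAt (by linarith) hu).sub_const (b s u)
      have e2 := hasFDerivAt_bilin_of_continuousAt (ContinuousLinearMap.apply ℝ (X s))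
        (cont r h2 u hu) ((hT h).hasFDerivAt (by linarith) hu)
      have e3 := (((N s u).hasFDerivAt).comp u (e1.add e2)).const_add (g s u)
      refine e3.congr_of_eventuallyEq ?_
      filter_upwards [hU.mem_nhds hu] with v hv
      rw [formula s r h h2 u hu v hv]
      simp
    intro s hs
    refine fun _ => ⟨(bdd s hs).imp fun _ h => h.2, hol s hs, fun h1 => ⟨fun u hu => ?_, ?_⟩⟩
    · obtain ⟨r, hsr, h3, h4⟩ := between s 1 zero_le_one (by linarith)
      exact (der s r hsr h3 h4 u hu).differentiableAt
    -- The derivative solves an equation of the same kind in the spaces `B →L[ℝ] X s`, with `R - 1`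
    -- in place of `R`. The right-hand side `b` is defined as `(1 - T) Dg`, which makes the equation
    -- true by definition; its regularity is then read off from the formula for `Dg`.
    · have h2 := ih (X := fun s => B →L[ℝ] X s) (R := R - 1) (by linarith)
        (fun {s r} h => _root_.compBilin B (X r) (X s) (j h))
        (g := fun s => _root_.fderiv ℝ (g s))
        (b := fun s u => _root_.fderiv ℝ (g s) u - T s u ∘L _root_.fderiv ℝ (g s) u)
        (T := fun s u => _root_.compBilin B (X s) (X s) (T s u))
        (N := fun s u => _root_.compBilin B (X s) (X s) (N s u)) ?_
        (fun _ _ _ _ => rfl) ?_ ?_ ?_ ?_ ?_ s (by linarith)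
      · rwa [show (R : ℝ) - s - 1 = R - 1 - s by ring]
      · intro s r h hr u hu
        obtain ⟨q, hq, h3, h4⟩ := between r 1 zero_le_one (by linarith)
        have hsr := Subtype.coe_lt_coe.2 h
        have e1 := der r q hq h3 h4 u hu
        refine (((j h).hasFDerivAt.comp u e1.differentiableAt.hasFDerivAt).congr_of_eventuallyEq
          ?_).fderiv
        filter_upwards [hU.mem_nhds hu] with v hv using hg h (by linarith) v hv
      · intro s
        obtain ⟨C, hC⟩ := hN s
        exact ⟨C, fun u hu => (norm_compBilin_apply_le B _).trans (hC u hu)⟩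
      · intro s u hu x
        ext k
        simpa using hNl s u hu (x k)
      · intro s u hu x
        ext k
        simpa using hNr s u hu (x k)
      · intro s r h
        exact (hT h).of_succ.compBilin hU
      · intro s hs
        obtain ⟨r, hsr, h3, h4⟩ := between s 1 zero_le_one (by linarith)
        have e : ∀ u ∈ U, _root_.fderiv ℝ (g s) u - T s u ∘L _root_.fderiv ℝ (g s) u =
            _root_.fderiv ℝ (b s) u +
              (_root_.fderiv ℝ (fun u => T s u ∘L j hsr) u).flip (g r u) := fun u hu => by
          rw [(der s r hsr h3 h4 u hu).fderiv]
          ext k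
          exact hNr s u hu _
        refine HolderBelow.congr hU ?_ fun u hu => (e u hu).symm
        refine HolderBelow.add hU ?_ ?_
        · have := (hb s (by linarith)).fderiv
          rwa [show (R : ℝ) - s - 1 = R - 1 - s by ring] at this
        -- The term `(DT) g` involves `g` only to depth `n`, where the induction hypothesis for the
        -- original equation applies. The induction hypothesis is thus used twice, for `g` and for
        -- `Dg`.
        · exact fderiv_apply hU hR (fun i => (hT i.2.1))
            (fun i => ih hR j hg heq hN hNl hNr (fun h => (hT h).of_succ)
              (fun s hs => (hb s hs).of_succ) i.1 i.2.2)
            (fun i i' u _ v hv => by simp [← hg i.2.1 i.2.2 v hv, ← hg i'.2.1 i'.2.2 v hv])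
            ⟨r, hsr, h4⟩ h3

end HolderBelow

/-! ### The classes `C^{(k,α)}` and `C^t` -/

section IsCt

variable {B : Type*} [NormedAddCommGroup B] [NormedSpace ℝ B] {U : Set B}
variable {Z : Type*} [NormedAddCommGroup Z] [NormedSpace ℝ Z]

/-- Derivatives within `U` see only the values on `U`, so any given extension can serve as the
witness. -/
theorem isHolderCk_iff {k : ℕ} {α : ℝ} {F : B → Z} :
    IsHolderCk k α (fun u : U => F u) ↔ ContDiffOn ℝ k F U ∧
      (∀ q ≤ k, ∃ C : ℝ, ∀ u ∈ U, ‖iteratedFDerivWithin ℝ q F U u‖ ≤ C) ∧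
      ∃ C : ℝ, ∀ u ∈ U, ∀ v ∈ U,
        ‖iteratedFDerivWithin ℝ k F U u - iteratedFDerivWithin ℝ k F U v‖ ≤ C * ‖u - v‖ ^ α := by
  refine ⟨?_, fun h => ⟨F, fun _ => rfl, h⟩⟩
  rintro ⟨G, hG, h1, h2, C, hC⟩
  have hFG : EqOn F G U := fun u hu => (hG ⟨u, hu⟩).symm
  have e : ∀ q, ∀ u ∈ U, iteratedFDerivWithin ℝ q F U u = iteratedFDerivWithin ℝ q G U u :=
    fun q u hu => iteratedFDerivWithin_congr hFG hu q
  refine ⟨h1.congr hFG, fun q hq => ?_, C, fun u hu v hv => ?_⟩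
  · obtain ⟨C, hC⟩ := h2 q hq
    exact ⟨C, fun u hu => e q u hu ▸ hC u hu⟩
  · rw [e k u hu, e k v hv]
    exact hC u hu v hv

theorem isHolderCk_zero_iff {α : ℝ} {F : B → Z} :
    IsHolderCk 0 α (fun u : U => F u) ↔ ContinuousOn F U ∧ (∃ C : ℝ, ∀ u ∈ U, ‖F u‖ ≤ C) ∧
      ∃ C : ℝ, ∀ u ∈ U, ∀ v ∈ U, ‖F u - F v‖ ≤ C * ‖u - v‖ ^ α := by
  rw [isHolderCk_iff]
  refine and_congr (by simp) (and_congr ?_ ?_)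
  · simp
  · simp only [iteratedFDerivWithin_zero_eq_comp, Function.comp_apply, ← map_sub,
      LinearIsometryEquiv.norm_map]

/-- Currying is an isometry between the derivative of order `q + 1` of `F` and the derivative of
order `q` of `fderiv ℝ F`; openness of `U` lets ordinary derivatives replace those within `U`. -/
theorem isHolderCk_succ_iff (hU : IsOpen U) {k : ℕ} {α : ℝ} {F : B → Z} :
    IsHolderCk (k + 1) α (fun u : U => F u) ↔ (∃ C : ℝ, ∀ u ∈ U, ‖F u‖ ≤ C) ∧
      (∀ u ∈ U, DifferentiableAt ℝ F u) ∧ IsHolderCk k α (fun u : U => fderiv ℝ F u) := by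
  have e : ∀ q, ∀ u ∈ U, iteratedFDerivWithin ℝ (q + 1) F U u =
      (continuousMultilinearCurryRightEquiv' ℝ q B Z).symm
        (iteratedFDerivWithin ℝ q (fderiv ℝ F) U u) := fun q u hu => by
    rw [iteratedFDerivWithin_succ_eq_comp_right hU.uniqueDiffOn hu, Function.comp_apply]
    congr 1
    exact iteratedFDerivWithin_congr (fun v hv => fderivWithin_of_isOpen hU hv) hu q
  have en : ∀ q, ∀ u ∈ U, ‖iteratedFDerivWithin ℝ (q + 1) F U u‖ =
      ‖iteratedFDerivWithin ℝ q (fderiv ℝ F) U u‖ := fun q u hu => by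
    rw [e q u hu, LinearIsometryEquiv.norm_map]
  rw [isHolderCk_iff, isHolderCk_iff]
  have e1 : ContDiffOn ℝ ((k + 1 : ℕ) : WithTop ℕ∞) F U ↔
      (∀ u ∈ U, DifferentiableAt ℝ F u) ∧ ContDiffOn ℝ k (fderiv ℝ F) U := by
    rw [Nat.cast_add, Nat.cast_one, contDiffOn_succ_iff_fderiv_of_isOpen hU]
    refine ⟨fun h => ⟨fun u hu => (h.1 u hu).differentiableAt (hU.mem_nhds hu), h.2.2⟩,
      fun h => ⟨fun u hu => (h.1 u hu).differentiableWithinAt, fun h => by simp at h, h.2⟩⟩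
  have e2 : (∀ q ≤ k + 1, ∃ C : ℝ, ∀ u ∈ U, ‖iteratedFDerivWithin ℝ q F U u‖ ≤ C) ↔
      (∃ C : ℝ, ∀ u ∈ U, ‖F u‖ ≤ C) ∧
        ∀ q ≤ k, ∃ C : ℝ, ∀ u ∈ U, ‖iteratedFDerivWithin ℝ q (fderiv ℝ F) U u‖ ≤ C := by
    constructor
    · intro h
      refine ⟨by simpa using h 0 (Nat.zero_le _), fun q hq => ?_⟩
      obtain ⟨C, hC⟩ := h (q + 1) (by omega)
      exact ⟨C, fun u hu => en q u hu ▸ hC u hu⟩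
    · rintro ⟨h1, h2⟩ (_ | q) hq
      · simpa using h1
      · obtain ⟨C, hC⟩ := h2 q (by omega)
        exact ⟨C, fun u hu => (en q u hu).symm ▸ hC u hu⟩
  have e3 : (∃ C : ℝ, ∀ u ∈ U, ∀ v ∈ U, ‖iteratedFDerivWithin ℝ (k + 1) F U u -
      iteratedFDerivWithin ℝ (k + 1) F U v‖ ≤ C * ‖u - v‖ ^ α) ↔
      ∃ C : ℝ, ∀ u ∈ U, ∀ v ∈ U, ‖iteratedFDerivWithin ℝ k (fderiv ℝ F) U u -
        iteratedFDerivWithin ℝ k (fderiv ℝ F) U v‖ ≤ C * ‖u - v‖ ^ α := by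
    refine exists_congr fun C => forall₂_congr fun u hu => forall₂_congr fun v hv => ?_
    rw [e k u hu, e k v hv]
    have h := (continuousMultilinearCurryRightEquiv' ℝ k B Z).symm.dist_map
      (iteratedFDerivWithin ℝ k (fderiv ℝ F) U u) (iteratedFDerivWithin ℝ k (fderiv ℝ F) U v)
    rw [dist_eq_norm, dist_eq_norm] at h
    exact iff_of_eq (congrArg (· ≤ _) h)
  rw [e1, e2, e3]
  tauto

/-- Transport of `C^t` along an isometric change of parameters and a bounded linear map. -/
theorem IsCt.comp_isometry {B' : Type*} [NormedAddCommGroup B'] [NormedSpace ℝ B']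
    {Z' : Type*} [NormedAddCommGroup Z'] [NormedSpace ℝ Z'] (hU : IsOpen U) {t : ℝ} {f : U → Z}
    (hf : IsCt t f) (e : B' ≃ₗᵢ[ℝ] B) (Φ : Z →L[ℝ] Z') {U' : Set B'}
    (hUU' : ∀ u, u ∈ U' ↔ e u ∈ U) :
    IsCt t (fun u : U' => Φ (f ⟨e u, (hUU' u).1 u.2⟩)) := by
  obtain rfl : U' = e ⁻¹' U := Set.ext hUU'
  obtain ⟨F, hF, h1, h2, h3⟩ := hf
  set e' := e.toContinuousLinearEquiv
  have hU' := (hU.preimage e.continuous).uniqueDiffOn (𝕜 := ℝ)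
  have key : ∀ q ≤ ⌈t⌉₊ - 1, ∀ u ∈ e ⁻¹' U,
      iteratedFDerivWithin ℝ q (fun u => Φ (F (e u))) (e ⁻¹' U) u =
        Φ.compContinuousMultilinearMap ((iteratedFDerivWithin ℝ q F U
          (e u)).compContinuousLinearMap fun _ => (e' : B' →L[ℝ] B)) := by
    intro q hq u hu
    have h4 := e'.iteratedFDerivWithin_comp_right F hU.uniqueDiffOn (x := u) hu q
    have h5 : ContDiffOn ℝ ((⌈t⌉₊ - 1 : ℕ) : WithTop ℕ∞) (F ∘ e) (e ⁻¹' U) :=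
      h1.comp_continuousLinearMap (e' : B' →L[ℝ] B)
    have h6 := Φ.iteratedFDerivWithin_comp_left (h5 u hu) hU' hu
      (i := q) (by exact_mod_cast hq)
    exact h6.trans (congrArg Φ.compContinuousMultilinearMap h4)
  have hle : ∀ q, ∀ A : B [×q]→L[ℝ] Z, ‖Φ.compContinuousMultilinearMap
      (A.compContinuousLinearMap fun _ => (e' : B' →L[ℝ] B))‖ ≤ ‖Φ‖ * ‖A‖ := by
    intro q A
    refine (Φ.norm_compContinuousMultilinearMap_le _).trans ?_
    gcongr
    refine (A.norm_compContinuousLinearMap_le _).trans ?_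
    refine mul_le_of_le_one_right (norm_nonneg _) (Finset.prod_le_one (fun _ _ => norm_nonneg _)
      fun _ _ => ?_)
    exact ContinuousLinearMap.opNorm_le_bound _ zero_le_one fun x => by simp [e']
  refine ⟨fun u => Φ (F (e u)), fun u => congrArg Φ (hF ⟨e u, u.2⟩), ?_, fun q hq => ?_, ?_⟩
  · exact Φ.contDiff.comp_contDiffOn (h1.comp_continuousLinearMap (e' : B' →L[ℝ] B))
  · obtain ⟨C, hC⟩ := h2 q hq
    refine ⟨‖Φ‖ * C, fun u hu => ?_⟩
    rw [key q hq u hu]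
    exact (hle q _).trans (mul_le_mul_of_nonneg_left (hC _ hu) (norm_nonneg _))
  · obtain ⟨C, hC⟩ := h3
    refine ⟨‖Φ‖ * C, fun u hu v hv => ?_⟩
    have h7 := (hle _ _).trans (mul_le_mul_of_nonneg_left (hC _ hu _ hv) (norm_nonneg Φ))
    rw [← map_sub, e.norm_map, ← mul_assoc] at h7
    rw [key _ le_rfl u hu, key _ le_rfl v hv]
    refine le_of_eq_of_le (congrArg norm ?_) h7
    ext m
    simp

end IsCt

/-! ### Comparison of `HolderBelow` with the classes `C^t`. -/

section

variable {B : Type w} [NormedAddCommGroup B] [NormedSpace ℝ B] {U : Set B}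
variable {Z : Type w} [NormedAddCommGroup Z] [NormedSpace ℝ Z]

/-- If `F` is `C^{t+1}` with `t > 0` then `DF` is `C^t`: the ceiling in `IsCt` shifts by one and the
fractional part is unchanged. -/
theorem HolderBelow.of_isCt (hU : IsOpen U) {n : ℕ} {θ : ℝ} {F : B → Z}
    (h : ∀ t, 0 ≤ t → t < θ → IsCt t (fun u : U => F u)) : HolderBelow U n θ F := by
  induction n generalizing Z θ with
  | zero => trivial
  | succ n ih =>
    have small : ∀ α, 0 < α → α ≤ 1 → α < θ → IsHolderCk 0 α (fun u : U => F u) := by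
      intro α h0 h1 h2
      have h3 : ⌈α⌉₊ - 1 = 0 := by
        have := Nat.ceil_le.2 (show α ≤ (1 : ℕ) by simpa using h1)
        omega
      have := h α h0.le h2
      simpa [IsCt, h3] using this
    have large : ∀ t, 0 < t → t < θ - 1 → IsHolderCk (⌈t⌉₊ - 1 + 1) (t - (⌈t⌉₊ - 1 : ℕ))
        (fun u : U => F u) := by
      intro t h0 h1
      have h2 := h (t + 1) (by linarith) (by linarith)
      have h3 : ⌈t + 1⌉₊ = ⌈t⌉₊ + 1 := Nat.ceil_add_one h0.le
      have h4 : 0 < ⌈t⌉₊ := Nat.ceil_pos.2 h0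
      have h5 : ⌈t + 1⌉₊ - 1 = ⌈t⌉₊ - 1 + 1 := by omega
      rw [IsCt, h5] at h2
      convert h2 using 1
      push_cast
      ring
    refine succ hU (_root_.fderiv ℝ F) (fun h0 => ?_) (fun α h0 h1 h2 => ?_) (fun h1 u hu => ?_)
      fun h1 => ih fun t h0 h2 => ?_
    · exact (isHolderCk_zero_iff.1 (small (min 1 (θ / 2)) (by positivity) (min_le_left _ _)
        ((min_le_right _ _).trans_lt (by linarith)))).2.1
    · exact (isHolderCk_zero_iff.1 (small α h0 h1.le h2)).2.2
    · have := large ((θ - 1) / 2) (by linarith) (by linarith)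
      exact (((isHolderCk_succ_iff hU).1 this).2.1 u hu).hasFDerivAt
    -- At `t = 0` the ceiling does not shift in this way. Here a slightly larger order already makes
    -- `DF` bounded and continuous, and the Hölder condition of exponent zero costs only twice the
    -- bound.
    · rcases h0.eq_or_lt with rfl | h0
      · have := large ((θ - 1) / 2) (by linarith) (by linarith)
        have := ((isHolderCk_succ_iff hU).1 this).2.2
        obtain ⟨h3, h4, -⟩ := isHolderCk_iff.1 this
        simp only [IsCt, Nat.ceil_zero, zero_tsub, CharP.cast_eq_zero, sub_zero]
        obtain ⟨C, hC⟩ := h4 0 (Nat.zero_le _)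
        simp only [norm_iteratedFDerivWithin_zero] at hC
        refine isHolderCk_zero_iff.2 ⟨h3.continuousOn, ⟨C, hC⟩, 2 * C, fun u hu v hv => ?_⟩
        rw [Real.rpow_zero, mul_one, two_mul]
        exact norm_sub_le_of_le (hC u hu) (hC v hv)
      · exact ((isHolderCk_succ_iff hU).1 (large t h0 h2)).2.2

/-- The recursion provides Hölder exponents strictly below one only. For integral `t` the exponent
is one, and the Lipschitz bound comes from a bounded derivative on the convex set `U`. -/
theorem HolderBelow.isCt (hU : IsOpen U) (hc : Convex ℝ U) {n : ℕ} {θ t : ℝ} {F : B → Z}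
    (h : HolderBelow U n θ F) (h0 : 0 < t) (htθ : t < θ) (htn : t < n) :
    IsCt t (fun u : U => F u) := by
  have key : ∀ k : ℕ, ∀ {Z : Type w} [NormedAddCommGroup Z] [NormedSpace ℝ Z] {n : ℕ} {θ α : ℝ}
      {F : B → Z}, HolderBelow U n θ F → 0 < α → α ≤ 1 → k + α < θ → k + α < n →
      IsHolderCk k α (fun u : U => F u) := by
    intro k
    induction k with
    | zero =>
      intro Z _ _ n θ α F h h0 h1 h2 h3
      simp only [CharP.cast_eq_zero, zero_add] at h2 h3
      obtain ⟨n, rfl⟩ : ∃ m, n = m + 1 := Nat.exists_eq_succ_of_ne_zero (by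
        rintro rfl
        simp only [CharP.cast_eq_zero] at h3
        linarith)
      have hθ := h0.trans h2
      refine isHolderCk_zero_iff.2 ⟨fun u hu => (h.continuousAt hU hθ hu).continuousWithinAt,
        (h.bounded hθ).imp fun _ h => h.2, ?_⟩
      rcases h1.eq_or_lt with rfl | h1
      · obtain ⟨n, rfl⟩ : ∃ m, n = m + 1 := Nat.exists_eq_succ_of_ne_zero (by
          rintro rfl
          simp at h3)
        obtain ⟨C, hC0, hC⟩ := h.fderiv.bounded (by linarith)
        refine ⟨C, fun u hu v hv => ?_⟩
        rw [Real.rpow_one]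
        exact hc.norm_image_sub_le_of_norm_hasFDerivWithin_le
          (fun x hx => (h.hasFDerivAt h2 hx).hasFDerivWithinAt) hC hv hu
      · exact (h.holder h0 h1 h2).imp fun _ h => h.2
    | succ k ih =>
      intro Z _ _ n θ α F h h0 h1 h2 h3
      push_cast at h2 h3
      have hk : (0 : ℝ) ≤ k := Nat.cast_nonneg k
      obtain ⟨n, rfl⟩ : ∃ m, n = m + 1 := Nat.exists_eq_succ_of_ne_zero (by
        rintro rfl
        simp only [CharP.cast_eq_zero] at h3
        linarith)
      push_cast at h3
      exact (isHolderCk_succ_iff hU).2 ⟨(h.bounded (by linarith)).imp fun _ h => h.2,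
        fun u hu => (h.hasFDerivAt (by linarith) hu).differentiableAt,
        ih h.fderiv h0 h1 (by linarith) (by linarith)⟩
  have h1 : 0 < ⌈t⌉₊ := Nat.ceil_pos.2 h0
  have h2 : ((⌈t⌉₊ - 1 : ℕ) : ℝ) = ⌈t⌉₊ - 1 := by
    rw [Nat.cast_sub h1, Nat.cast_one]
  have h3 := Nat.le_ceil t
  have h4 := Nat.ceil_lt_add_one h0.le
  exact key _ h (by rw [h2]; linarith) (by rw [h2]; linarith) (by linarith) (by linarith)

end

/-! ### The pointwise ergodic theorem for bounded functions -/

section Ergodic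

variable {Ω : Type*}

/-- The maximum of the Birkhoff sums of order at most `n`. -/
def birkhoffMax (T : Ω → Ω) (h : Ω → ℝ) : ℕ → Ω → ℝ
  | 0, _ => 0
  | n + 1, ω => max 0 (h ω + birkhoffMax T h n (T ω))

theorem birkhoffMax_nonneg (T : Ω → Ω) (h : Ω → ℝ) (n : ℕ) (ω : Ω) : 0 ≤ birkhoffMax T h n ω := by
  cases n with
  | zero => exact le_rfl
  | succ n => exact le_max_left _ _

theorem birkhoffMax_le_succ (T : Ω → Ω) (h : Ω → ℝ) (n : ℕ) (ω : Ω) :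
    birkhoffMax T h n ω ≤ birkhoffMax T h (n + 1) ω := by
  induction n generalizing ω with
  | zero => exact le_max_left _ _
  | succ n ih => exact max_le_max le_rfl (add_le_add le_rfl (ih _))

theorem birkhoffSum_le_birkhoffMax (T : Ω → Ω) (h : Ω → ℝ) (n : ℕ) (ω : Ω) :
    birkhoffSum T h n ω ≤ birkhoffMax T h n ω := by
  induction n generalizing ω with
  | zero => simp [birkhoffMax]
  | succ n ih =>
    rw [birkhoffSum_succ']
    exact le_max_of_le_right (add_le_add le_rfl (ih _))

theorem birkhoffMax_le {T : Ω → Ω} {h : Ω → ℝ} {C : ℝ} (hC : ∀ ω, |h ω| ≤ C) (n : ℕ) (ω : Ω) :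
    birkhoffMax T h n ω ≤ n * C := by
  have hC0 : 0 ≤ C := (abs_nonneg _).trans (hC ω)
  induction n generalizing ω with
  | zero => simp [birkhoffMax]
  | succ n ih =>
    refine max_le (by positivity) ?_
    push_cast
    linarith [ih (T ω), (abs_le.1 (hC ω)).2]

variable [MeasurableSpace Ω] {P : Measure Ω} [IsProbabilityMeasure P]

theorem measurable_birkhoffMax {T : Ω → Ω} (hT : Measurable T) {h : Ω → ℝ} (hh : Measurable h)
    (n : ℕ) : Measurable (birkhoffMax T h n) := by
  induction n with
  | zero => exact measurable_const
  | succ n ih => exact measurable_const.max (hh.add (ih.comp hT))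

/-- The maximal ergodic inequality. -/
theorem setIntegral_birkhoffMax_pos_nonneg {T : Ω → Ω} (hT : MeasurePreserving T P P) {h : Ω → ℝ}
    (hh : Measurable h) {C : ℝ} (hC : ∀ ω, |h ω| ≤ C) (n : ℕ) :
    0 ≤ ∫ ω in {ω | 0 < birkhoffMax T h (n + 1) ω}, h ω ∂P := by
  have hm := fun n => measurable_birkhoffMax hT.measurable hh n
  have hi : ∀ n, Integrable (birkhoffMax T h n) P := fun n =>
    Integrable.of_bound (hm n).aestronglyMeasurable (n * C) (Eventually.of_forall fun ω => by
      rw [Real.norm_of_nonneg (birkhoffMax_nonneg T h n ω)]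
      exact birkhoffMax_le hC n ω)
  set A := {ω | 0 < birkhoffMax T h (n + 1) ω} with hA
  have hAm : MeasurableSet A := measurableSet_lt measurable_const (hm _)
  have hiT : Integrable (fun ω => birkhoffMax T h n (T ω)) P :=
    hT.integrable_comp_of_integrable (hi n)
  have e1 : ∫ ω in A, h ω ∂P =
      ∫ ω in A, birkhoffMax T h (n + 1) ω ∂P - ∫ ω in A, birkhoffMax T h n (T ω) ∂P := by
    rw [← integral_sub (hi _).integrableOn hiT.integrableOn]
    refine setIntegral_congr_fun hAm fun ω hω => ?_
    -- Where the maximum is positive it is attained by its second entry, so there `h` is the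
    -- difference of `birkhoffMax` at `n + 1` and `birkhoffMax` at `n` composed with `T`.
    -- Integrating and using invariance and monotonicity in `n` gives the inequality.
    have hω' : 0 < max 0 (h ω + birkhoffMax T h n (T ω)) := hω
    have : birkhoffMax T h (n + 1) ω = h ω + birkhoffMax T h n (T ω) :=
      max_eq_right (by
        rcases lt_max_iff.1 hω' with h | h
        · exact absurd h (lt_irrefl _)
        · exact h.le)
    simp [this]
  have e2 : ∫ ω in A, birkhoffMax T h (n + 1) ω ∂P = ∫ ω, birkhoffMax T h (n + 1) ω ∂P := by
    refine setIntegral_eq_integral_of_forall_compl_eq_zero fun ω hω => ?_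
    exact le_antisymm (not_lt.1 hω) (birkhoffMax_nonneg _ _ _ _)
  have e3 : ∫ ω in A, birkhoffMax T h n (T ω) ∂P ≤ ∫ ω, birkhoffMax T h n (T ω) ∂P :=
    setIntegral_le_integral hiT (Eventually.of_forall fun ω => birkhoffMax_nonneg _ _ _ _)
  have e4 : ∫ ω, birkhoffMax T h n (T ω) ∂P = ∫ ω, birkhoffMax T h n ω ∂P := by
    have := integral_map (μ := P) hT.measurable.aemeasurable
      (f := birkhoffMax T h n) (hm n).aestronglyMeasurable
    rw [hT.map_eq] at this
    exact this.symm
  have e5 : ∫ ω, birkhoffMax T h n ω ∂P ≤ ∫ ω, birkhoffMax T h (n + 1) ω ∂P :=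
    integral_mono (hi _) (hi _) fun ω => birkhoffMax_le_succ T h n ω
  linarith

/-- If a bounded function has negative mean, its Birkhoff sums are almost surely bounded above. -/
theorem ae_bddAbove_birkhoffSum {T : Ω → Ω} (hT : Ergodic T P) {h : Ω → ℝ}
    (hh : Measurable h) {C : ℝ} (hC : ∀ ω, |h ω| ≤ C) (hneg : ∫ ω, h ω ∂P < 0) :
    ∀ᵐ ω ∂P, ∃ K, ∀ n, birkhoffSum T h n ω ≤ K := by
  have hm := fun n => measurable_birkhoffMax hT.measurable hh n
  set A := {ω | ∀ k : ℕ, ∃ n, (k : ℝ) < birkhoffMax T h n ω} with hA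
  have hAm : MeasurableSet A := by
    have : A = ⋂ k : ℕ, ⋃ n, {ω | (k : ℝ) < birkhoffMax T h n ω} := by
      ext ω
      simp [hA]
    rw [this]
    exact MeasurableSet.iInter fun k => MeasurableSet.iUnion fun n =>
      measurableSet_lt measurable_const (hm n)
  -- Moving along the orbit changes the maxima by at most `C` and a shift of the index, so
  -- unboundedness is an invariant property.
  have hinv : T ⁻¹' A = A := by
    ext ω
    constructor
    · intro h1 k
      obtain ⟨m, hm⟩ := exists_nat_gt (k + C)
      obtain ⟨n, hn⟩ := h1 m
      refine ⟨n + 1, lt_max_of_lt_right ?_⟩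
      linarith [(abs_le.1 (hC ω)).1]
    · intro h1 k
      obtain ⟨m, hm⟩ := exists_nat_gt (k + C)
      obtain ⟨n, hn⟩ := h1 m
      have hC0 : 0 ≤ C := (abs_nonneg _).trans (hC ω)
      have hk : (0 : ℝ) ≤ k := Nat.cast_nonneg k
      cases n with
      | zero =>
        simp only [birkhoffMax] at hn
        linarith
      | succ n =>
        refine ⟨n, ?_⟩
        rcases lt_max_iff.1 hn with h2 | h2
        · linarith
        · linarith [(abs_le.1 (hC ω)).2]
  have hbd : ∀ ω, ω ∉ A → ∃ K, ∀ n, birkhoffSum T h n ω ≤ K := by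
    intro ω hω
    simp only [hA, mem_ofPred_eq, not_forall, not_exists, not_lt] at hω
    obtain ⟨k, hk⟩ := hω
    exact ⟨k, fun n => (birkhoffSum_le_birkhoffMax T h n ω).trans (hk n)⟩
  rcases hT.toPreErgodic.prob_eq_zero_or_one hAm hinv with h0 | h1
  · filter_upwards [measure_eq_zero_iff_ae_notMem.1 h0] with ω hω using hbd ω hω
  · exfalso
    -- If the sums were unbounded almost everywhere, the sets where `birkhoffMax` is positive would
    -- increase to full measure, and the maximal inequality would make the mean nonnegative.
    refine absurd ?_ hneg.not_ge
    have hae : ∀ᵐ ω ∂P, ω ∈ A := by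
      rw [← prob_compl_eq_zero_iff hAm] at h1
      simpa using measure_eq_zero_iff_ae_notMem.1 h1
    have hint : Integrable h P := Integrable.of_bound hh.aestronglyMeasurable C
      (Eventually.of_forall hC)
    have hlim : Tendsto (fun n : ℕ => ∫ ω in {ω | 0 < birkhoffMax T h (n + 1) ω}, h ω ∂P) atTop
        (𝓝 (∫ ω in ⋃ n : ℕ, {ω | 0 < birkhoffMax T h (n + 1) ω}, h ω ∂P)) := by
      refine tendsto_setIntegral_of_monotone
        (fun n => measurableSet_lt measurable_const (hm _)) ?_ hint.integrableOn
      exact monotone_nat_of_le_succ fun n ω hω => lt_of_lt_of_le hω (birkhoffMax_le_succ T h _ ω)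
    have hfull : ∫ ω in ⋃ n : ℕ, {ω | 0 < birkhoffMax T h (n + 1) ω}, h ω ∂P = ∫ ω, h ω ∂P := by
      rw [setIntegral_congr_set (t := univ), setIntegral_univ]
      rw [eventuallyEq_univ]
      filter_upwards [hae] with ω hω
      obtain ⟨n, hn⟩ := hω 0
      rw [Nat.cast_zero] at hn
      exact mem_iUnion.2 ⟨n, lt_of_lt_of_le hn (birkhoffMax_le_succ T h n ω)⟩
    rw [hfull] at hlim
    exact ge_of_tendsto' hlim fun n => setIntegral_birkhoffMax_pos_nonneg hT.toMeasurePreserving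
      hh hC n

/-- Eventual upper bound for the Birkhoff averages. -/
theorem ae_eventually_birkhoffSum_lt {T : Ω → Ω} (hT : Ergodic T P) {g : Ω → ℝ}
    (hg : Measurable g) {C : ℝ} (hC : ∀ ω, |g ω| ≤ C) {δ : ℝ} (hδ : 0 < δ) :
    ∀ᵐ ω ∂P, ∀ᶠ n : ℕ in atTop, (1 / (n : ℝ)) * birkhoffSum T g n ω < ∫ ω, g ω ∂P + δ := by
  set I := ∫ ω, g ω ∂P with hI
  have hint : Integrable g P := Integrable.of_bound hg.aestronglyMeasurable C
    (Eventually.of_forall hC)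
  -- The shifted function has mean `-δ / 2`. Boundedness above of its sums by `K` gives `S_n ≤ n (I
  -- + δ / 2) + K`, and `K < n δ / 2` for large `n`.
  have h1 := ae_bddAbove_birkhoffSum hT (h := fun ω => g ω - (I + δ / 2)) (hg.sub_const _)
    (C := C + |I + δ / 2|) (fun ω => (abs_sub _ _).trans (add_le_add (hC ω) le_rfl)) (by
      rw [integral_sub hint (integrable_const _)]
      simp only [integral_const, probReal_univ, smul_eq_mul, one_mul]
      linarith)
  filter_upwards [h1] with ω ⟨K, hK⟩
  have hsum : ∀ n : ℕ, birkhoffSum T (fun ω => g ω - (I + δ / 2)) n ω =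
      birkhoffSum T g n ω - n * (I + δ / 2) := fun n => by
    simp only [birkhoffSum, Finset.sum_sub_distrib, Finset.sum_const, Finset.card_range,
      nsmul_eq_mul]
  obtain ⟨m, hm⟩ := exists_nat_gt (2 * K / δ)
  filter_upwards [eventually_ge_atTop (max m 1)] with n hn
  have hn1 : (1 : ℝ) ≤ n := by exact_mod_cast (le_max_right _ _).trans hn
  have hnm : (m : ℝ) ≤ n := by exact_mod_cast (le_max_left _ _).trans hn
  have h2 := hK n
  rw [hsum] at h2
  rw [div_lt_iff₀ hδ] at hm
  rw [one_div, inv_mul_lt_iff₀ (by linarith)]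
  nlinarith [mul_le_mul_of_nonneg_right hnm hδ.le]

/-- The pointwise ergodic theorem for bounded functions. -/
theorem ae_tendsto_birkhoffSum {T : Ω → Ω} (hT : Ergodic T P) {g : Ω → ℝ}
    (hg : Measurable g) {C : ℝ} (hC : ∀ ω, |g ω| ≤ C) :
    ∀ᵐ ω ∂P, Tendsto (fun n : ℕ => (1 / (n : ℝ)) * birkhoffSum T g n ω) atTop
      (𝓝 (∫ ω, g ω ∂P)) := by
  have h1 : ∀ᵐ ω ∂P, ∀ m : ℕ, ∀ᶠ n : ℕ in atTop,
      (1 / (n : ℝ)) * birkhoffSum T g n ω < ∫ ω, g ω ∂P + 1 / (m + 1) :=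
    ae_all_iff.2 fun m => ae_eventually_birkhoffSum_lt hT hg hC (by positivity)
  have h2 : ∀ᵐ ω ∂P, ∀ m : ℕ, ∀ᶠ n : ℕ in atTop,
      (1 / (n : ℝ)) * birkhoffSum T (fun ω => -g ω) n ω < ∫ ω, -g ω ∂P + 1 / (m + 1) :=
    ae_all_iff.2 fun m => ae_eventually_birkhoffSum_lt hT hg.neg (C := C) (by simpa using hC)
      (by positivity)
  filter_upwards [h1, h2] with ω h1 h2
  rw [Metric.tendsto_atTop']
  intro ε hε
  obtain ⟨m, hm⟩ := exists_nat_one_div_lt hε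
  obtain ⟨N, hN⟩ := eventually_atTop.1 ((h1 m).and (h2 m))
  refine ⟨N, fun n hn => ?_⟩
  obtain ⟨h3, h4⟩ := hN n hn.le
  rw [integral_neg] at h4
  have h5 : birkhoffSum T (fun ω => -g ω) n ω = -birkhoffSum T g n ω := by
    simp [birkhoffSum]
  rw [h5] at h4
  rw [Real.dist_eq, abs_lt]
  constructor <;> linarith

end Ergodic

/-! ### Contraction of regular cones -/

namespace RegularCone

variable {E : Type*} [NormedAddCommGroup E] [NormedSpace ℝ E] (D : RegularCone E)

theorem K_pos : 0 < D.K := one_pos.trans_le D.one_le_K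

theorem norm_le {φ : E} (h : φ ∈ D.cone) : ‖φ‖ ≤ D.K * D.ℓ φ := by
  have := D.outer φ h
  rwa [one_div, inv_mul_le_iff₀ D.K_pos] at this

theorem ℓ_nonneg {φ : E} (h : φ ∈ D.cone) : 0 ≤ D.ℓ φ :=
  nonneg_of_mul_nonneg_right ((norm_nonneg φ).trans (D.norm_le h)) D.K_pos

theorem ℓ_pos {φ : E} (h : φ ∈ D.cone) (h0 : φ ≠ 0) : 0 < D.ℓ φ :=
  pos_of_mul_pos_right ((norm_pos_iff.2 h0).trans_le (D.norm_le h)) D.K_pos.le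

theorem abs_ℓ_le (φ : E) : |D.ℓ φ| ≤ ‖φ‖ := by
  simpa [D.norm_ℓ] using D.ℓ.le_opNorm φ

theorem ℓ_le (φ : E) : D.ℓ φ ≤ ‖φ‖ := (le_abs_self _).trans (D.abs_ℓ_le φ)

/-- The rate `ρ / K` of contraction of order intervals. -/
noncomputable def rate : ℝ := D.ρ / D.K

theorem rate_pos : 0 < D.rate := div_pos D.ρ_pos D.K_pos

theorem rate_le_one : D.rate ≤ 1 :=
  (div_le_one D.K_pos).2 (D.ρ_le_one.trans D.one_le_K)

theorem smul_mem {c : ℝ} (hc : 0 ≤ c) {φ : E} (h : φ ∈ D.cone) : c • φ ∈ D.cone :=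
  D.cone.smul_mem h hc

variable {D}

theorem zero_mem_core : (0 : E) ∈ D.core := ⟨zero_mem _, by simp⟩

/-- Since the cone is closed, the open ball in the definition of the core may be replaced by the
closed one, which gives the sharp non-strict condition. -/
theorem sub_mem_of_core {φ y : E} (h : φ ∈ D.core) (hy : ‖y‖ ≤ D.ρ * ‖φ‖) : φ - y ∈ D.cone := by
  rcases eq_or_ne φ 0 with rfl | h0
  · simp only [norm_zero, mul_zero, norm_le_zero_iff] at hy
    simp [hy]
  · have h1 : Metric.closedBall φ (D.ρ * ‖φ‖) ⊆ (D.cone : Set E) := by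
      rw [← closure_ball φ (mul_pos D.ρ_pos (norm_pos_iff.2 h0)).ne']
      exact closure_minimal h.2 D.cone.isClosed
    exact h1 (by simpa using hy)

theorem smul_mem_core {φ : E} (h : φ ∈ D.core) {c : ℝ} (hc : 0 < c) : c • φ ∈ D.core := by
  refine ⟨D.smul_mem hc.le h.1, fun y hy => ?_⟩
  have h1 : c⁻¹ • y ∈ D.cone := by
    refine h.2 ?_
    rw [mem_ball_iff_norm] at hy ⊢
    have : c⁻¹ • y - φ = c⁻¹ • (y - c • φ) := by
      rw [smul_sub, inv_smul_smul₀ hc.ne']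
    rw [this, norm_smul, norm_inv, Real.norm_of_nonneg hc.le, inv_mul_lt_iff₀ hc]
    rw [norm_smul, Real.norm_of_nonneg hc.le] at hy
    linarith
  have := D.smul_mem hc.le h1
  rwa [smul_inv_smul₀ hc.ne'] at this

/-- Elements of the core dominate the elements of the cone. -/
theorem sub_smul_mem_of_core {φ ψ : E} (hφ : φ ∈ D.core) (hψ : ψ ∈ D.cone) (h0 : ψ ≠ 0) :
    φ - (D.rate * (D.ℓ φ / D.ℓ ψ)) • ψ ∈ D.cone := by
  refine sub_mem_of_core hφ ?_
  have h1 := D.ℓ_pos hψ h0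
  have h2 := D.ℓ_nonneg hφ.1
  have h3 := D.rate_pos
  rw [norm_smul, Real.norm_of_nonneg (by positivity)]
  calc D.rate * (D.ℓ φ / D.ℓ ψ) * ‖ψ‖ ≤ D.rate * (D.ℓ φ / D.ℓ ψ) * (D.K * D.ℓ ψ) := by
        gcongr
        exact D.norm_le hψ
    _ = D.ρ * D.ℓ φ := by
        have := D.K_pos
        rw [rate]
        field_simp
    _ ≤ D.ρ * ‖φ‖ := mul_le_mul_of_nonneg_left (D.ℓ_le φ) D.ρ_pos.le

/-- A normalized element of the core is an order unit. -/
theorem smul_sub_mem_of_core {ψ : E} (hψ : ψ ∈ D.core) (h1 : D.ℓ ψ = 1) (y : E) :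
    (‖y‖ / D.ρ) • ψ - y ∈ D.cone := by
  rcases eq_or_ne y 0 with rfl | h0
  · simp
  · have hy := norm_pos_iff.2 h0
    have hρ := D.ρ_pos
    have h2 : ψ - (D.ρ / ‖y‖) • y ∈ D.cone := by
      refine sub_mem_of_core hψ ?_
      rw [norm_smul, Real.norm_of_nonneg (by positivity), div_mul_cancel₀ _ hy.ne']
      exact le_mul_of_one_le_right hρ.le (h1 ▸ D.ℓ_le ψ)
    have h3 := D.smul_mem (show 0 ≤ ‖y‖ / D.ρ by positivity) h2
    rwa [smul_sub, smul_smul, show ‖y‖ / D.ρ * (D.ρ / ‖y‖) = 1 by field_simp, one_smul] at h3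

theorem exists_core_normalized (D : RegularCone E) : ∃ φ ∈ D.core, D.ℓ φ = 1 := by
  obtain ⟨φ, h1, h0, h2⟩ := D.inner
  have h3 := D.ℓ_pos h1 h0
  exact ⟨(D.ℓ φ)⁻¹ • φ, smul_mem_core ⟨h1, h2⟩ (inv_pos.2 h3), by simp [h3.ne']⟩

theorem ne_zero_of_normalized {ψ : E} (h : D.ℓ ψ = 1) : ψ ≠ 0 := by
  rintro rfl
  simp at h

theorem norm_le_of_normalized {ψ : E} (h : ψ ∈ D.cone) (h1 : D.ℓ ψ = 1) : ‖ψ‖ ≤ D.K := by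
  simpa [h1] using D.norm_le h

/-- An operator preserving the cone is controlled by its value on one element of the core. -/
theorem norm_le_of_mapsTo {A : E →L[ℝ] E} (hA : ∀ φ ∈ D.cone, A φ ∈ D.cone) {ψ : E}
    (hψ : ψ ∈ D.core) (h1 : D.ℓ ψ = 1) : ‖A‖ ≤ 3 * D.K / D.ρ * D.ℓ (A ψ) := by
  have hρ := D.ρ_pos
  have hK := D.K_pos
  have hAψ := D.ℓ_nonneg (hA ψ hψ.1)
  refine A.opNorm_le_bound (by positivity) fun x => ?_
  -- Both `c • ψ - x` and `c • ψ + x` lie in the cone. Applying `A` bounds `D.ℓ (A x)` by `c * D.ℓ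
  -- (A ψ)`; the factor three is two for `‖c • A ψ + A x‖` and one for removing `c • A ψ`.
  set c := ‖x‖ / D.ρ with hc
  have hc0 : 0 ≤ c := by positivity
  have h2 : c • A ψ - A x ∈ D.cone := by
    simpa using hA _ (smul_sub_mem_of_core hψ h1 x)
  have h3 : c • A ψ + A x ∈ D.cone := by
    simpa [hc] using hA _ (smul_sub_mem_of_core hψ h1 (-x))
  have h4 := D.ℓ_nonneg h2
  have h5 := D.norm_le h3
  have h6 := D.norm_le (D.smul_mem hc0 (hA ψ hψ.1))
  simp only [map_sub, map_add, map_smul, smul_eq_mul] at h4 h5 h6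
  have h7 : ‖A x‖ ≤ ‖c • A ψ + A x‖ + ‖c • A ψ‖ := by
    simpa using norm_sub_le (c • A ψ + A x) (c • A ψ)
  have h8 : D.K * D.ℓ (A x) ≤ D.K * (c * D.ℓ (A ψ)) :=
    mul_le_mul_of_nonneg_left (by linarith) hK.le
  calc ‖A x‖ ≤ 3 * (D.K * (c * D.ℓ (A ψ))) := by linarith
    _ = _ := by rw [hc]; ring

section IsContraction

variable {A : E →L[ℝ] E} (hA : D.IsContraction A)
include hA

theorem IsContraction.mem_core {φ : E} (h : φ ∈ D.cone) : A φ ∈ D.core := by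
  rcases eq_or_ne φ 0 with rfl | h0
  · simpa using zero_mem_core
  · exact (hA.mapsTo φ h h0).1

theorem IsContraction.ℓ_pos {φ : E} (h : φ ∈ D.cone) (h0 : φ ≠ 0) : 0 < D.ℓ (A φ) :=
  D.ℓ_pos (hA.mem_core h).1 (hA.mapsTo φ h h0).2

/-- The lower bound for the normalization. -/
theorem IsContraction.le_ℓ {ψ : E} (hψ : ψ ∈ D.core) (h1 : D.ℓ ψ = 1) :
    D.ρ / (3 * D.K * D.ϑ) ≤ D.ℓ (A ψ) := by
  have h2 := hA.le_norm.trans (norm_le_of_mapsTo (fun φ h => (hA.mem_core h).1) hψ h1)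
  have hρ := D.ρ_pos
  have hK := D.K_pos
  have hϑ := one_pos.trans_le D.one_le_ϑ
  rw [div_le_iff₀ (by positivity)]
  rw [div_le_iff₀ hϑ] at h2
  calc D.ρ = D.ρ * 1 := (mul_one _).symm
    _ ≤ D.ρ * (3 * D.K / D.ρ * D.ℓ (A ψ) * D.ϑ) := mul_le_mul_of_nonneg_left h2 hρ.le
    _ = _ := by field_simp

/-- Order intervals are contracted by the factor `1 - ρ / K`. -/
theorem IsContraction.exists_interval {φ ψ : E} (hψ : ψ ∈ D.cone) (h0 : ψ ≠ 0) {m M : ℝ}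
    (hm : φ - m • ψ ∈ D.cone) (hM : M • ψ - φ ∈ D.cone) :
    ∃ m' M', m ≤ m' ∧ M' ≤ M ∧ M' - m' = (1 - D.rate) * (M - m) ∧
      A φ - m' • A ψ ∈ D.cone ∧ M' • A ψ - A φ ∈ D.cone := by
  have hc := (hA.mem_core hψ).1
  have hn := (hA.mapsTo ψ hψ h0).2
  have hp := D.ℓ_pos hc hn
  have h1 := sub_smul_mem_of_core (hA.mem_core hm) hc hn
  have h2 := sub_smul_mem_of_core (hA.mem_core hM) hc hn
  have h3 := D.ℓ_nonneg (hA.mem_core hm).1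
  have h4 := D.ℓ_nonneg (hA.mem_core hM).1
  have hr := D.rate_pos
  set a := D.rate * (D.ℓ (A (φ - m • ψ)) / D.ℓ (A ψ)) with ha
  set b := D.rate * (D.ℓ (A (M • ψ - φ)) / D.ℓ (A ψ)) with hb
  -- The gains at the two ends of the interval are individually unknown, but their sum is determined
  -- because `D.ℓ ∘ A` is linear.
  have hab : a + b = D.rate * (M - m) := by
    rw [ha, hb, ← mul_add, ← add_div, ← map_add, ← map_add]
    rw [show φ - m • ψ + (M • ψ - φ) = (M - m) • ψ by rw [sub_smul]; abel, map_smul, map_smul,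
      smul_eq_mul, mul_div_cancel_right₀ _ hp.ne']
  refine ⟨m + a, M - b, le_add_of_nonneg_right (by positivity), sub_le_self _ (by positivity),
    by linarith, ?_, ?_⟩
  · simpa [add_smul, sub_sub] using h1
  · convert h2 using 1
    simp only [map_sub, map_smul, sub_smul]
    abel

end IsContraction

/-- The gauge: `φ` lies in an order interval `[m ψ, (1 + c) m ψ]`. -/
def Close (D : RegularCone E) (c : ℝ) (φ ψ : E) : Prop :=
  ∃ m : ℝ, 0 < m ∧ φ - m • ψ ∈ D.cone ∧ ((1 + c) * m) • ψ - φ ∈ D.cone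

/-- The interval has length `c * m`; it shrinks by `1 - D.rate` while its lower end `m` does not
decrease, so the relative length shrinks at least as fast. -/
theorem Close.map {A : E →L[ℝ] E} (hA : D.IsContraction A) {c : ℝ} {φ ψ : E} (h : D.Close c φ ψ)
    (hc : 0 ≤ c) (hψ : ψ ∈ D.cone) (h0 : ψ ≠ 0) : D.Close ((1 - D.rate) * c) (A φ) (A ψ) := by
  obtain ⟨m, hm, h1, h2⟩ := h
  obtain ⟨m', M', h3, h4, h5, h6, h7⟩ := hA.exists_interval hψ h0 h1 h2
  refine ⟨m', hm.trans_le h3, h6, ?_⟩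
  have h8 : 0 ≤ (1 + (1 - D.rate) * c) * m' - M' := by
    have h9 : 0 ≤ (1 - D.rate) * c := mul_nonneg (sub_nonneg.2 D.rate_le_one) hc
    nlinarith [mul_le_mul_of_nonneg_left h3 h9]
  have h9 := add_mem (D.smul_mem h8 (hA.mem_core hψ).1) h7
  rwa [sub_smul, sub_add_sub_cancel] at h9

/-- Projective invariance of the gauge: normalizing both sections after each step costs nothing. -/
theorem Close.smul {c a b : ℝ} {φ ψ : E} (h : D.Close c φ ψ) (ha : 0 < a) (hb : 0 < b) :
    D.Close c (a • φ) (b • ψ) := by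
  obtain ⟨m, hm, h1, h2⟩ := h
  refine ⟨a / b * m, by positivity, ?_, ?_⟩
  · have := D.smul_mem ha.le h1
    rwa [smul_sub, smul_smul, show a * m = a / b * m * b by field_simp, ← smul_smul] at this
  · have := D.smul_mem ha.le h2
    rwa [smul_sub, smul_smul, show a * ((1 + c) * m) = (1 + c) * (a / b * m) * b by field_simp,
      ← smul_smul] at this

theorem Close.norm_sub_le {c : ℝ} {φ ψ : E} (h : D.Close c φ ψ) (hψ : ψ ∈ D.cone)
    (hφ1 : D.ℓ φ = 1) (hψ1 : D.ℓ ψ = 1) : ‖φ - ψ‖ ≤ 2 * D.K * c := by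
  obtain ⟨m, hm, h1, h2⟩ := h
  have h3 := D.ℓ_nonneg h1
  have h4 := D.ℓ_nonneg h2
  have h5 := D.norm_le h1
  simp only [map_sub, map_smul, hφ1, hψ1, smul_eq_mul, mul_one] at h3 h4 h5
  have h6 := D.norm_le_of_normalized hψ hψ1
  have hK := D.K_pos
  have h7 : ‖φ - ψ‖ ≤ ‖φ - m • ψ‖ + (1 - m) * ‖ψ‖ := by
    have : φ - ψ = (φ - m • ψ) - (1 - m) • ψ := by rw [sub_smul, one_smul]; abel
    rw [this]
    refine (_root_.norm_sub_le _ _).trans_eq ?_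
    rw [norm_smul, Real.norm_of_nonneg h3]
  have h8 : (1 - m) * ‖ψ‖ ≤ (1 - m) * D.K := mul_le_mul_of_nonneg_left h6 h3
  have hc : 1 - m ≤ c := by
    have : 0 ≤ c * m := by nlinarith
    have := nonneg_of_mul_nonneg_left this hm
    nlinarith
  nlinarith [mul_le_mul_of_nonneg_left hc hK.le]

/-- The order unit property gives the interval from `1 - d / ρ` to `1 + d / ρ`, whose lower end may
fail to be positive; it is replaced by the maximum with `D.rate`. The length is at most `2 d / ρ`,
and dividing by `D.rate = ρ / K` yields the constant. -/
theorem close_of_core {φ ψ : E} (hφ : φ ∈ D.core) (hψ : ψ ∈ D.core) (hφ1 : D.ℓ φ = 1)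
    (hψ1 : D.ℓ ψ = 1) : D.Close (2 * D.K / D.ρ ^ 2 * ‖φ - ψ‖) φ ψ := by
  have hρ := D.ρ_pos
  have hK := D.K_pos
  set d := ‖φ - ψ‖ with hd
  have h1 : φ - D.rate • ψ ∈ D.cone := by
    simpa [hφ1, hψ1] using sub_smul_mem_of_core hφ hψ.1 (ne_zero_of_normalized hψ1)
  have h2 : φ - (1 - d / D.ρ) • ψ ∈ D.cone := by
    have := smul_sub_mem_of_core hψ hψ1 (-(φ - ψ))
    rw [norm_neg] at this
    convert this using 1
    rw [sub_smul, one_smul]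
    abel
  have h3 : (1 + d / D.ρ) • ψ - φ ∈ D.cone := by
    convert smul_sub_mem_of_core hψ hψ1 (φ - ψ) using 1
    rw [add_smul, one_smul]
    abel
  have hm := D.rate_pos.trans_le (le_max_right (1 - d / D.ρ) D.rate)
  refine ⟨max (1 - d / D.ρ) D.rate, hm, ?_, ?_⟩
  · rcases max_choice (1 - d / D.ρ) D.rate with h | h <;> rwa [h]
  · have h4 : 0 ≤ (1 + 2 * D.K / D.ρ ^ 2 * d) * max (1 - d / D.ρ) D.rate - (1 + d / D.ρ) := by
      have h5 : 2 * D.K / D.ρ ^ 2 * d * D.rate ≤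
          2 * D.K / D.ρ ^ 2 * d * max (1 - d / D.ρ) D.rate :=
        mul_le_mul_of_nonneg_left (le_max_right _ _) (by positivity)
      have h6 : 2 * D.K / D.ρ ^ 2 * d * D.rate = 2 * (d / D.ρ) := by
        rw [rate]
        field_simp
      have h7 := le_max_left (1 - d / D.ρ) D.rate
      rw [h6] at h5
      linarith
    have h5 := add_mem (D.smul_mem h4 hψ.1) h3
    rwa [sub_smul, sub_add_sub_cancel] at h5

theorem Close.mono {c c' : ℝ} {φ ψ : E} (h : D.Close c φ ψ) (hc : c ≤ c') (hψ : ψ ∈ D.cone) :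
    D.Close c' φ ψ := by
  obtain ⟨m, hm, h1, h2⟩ := h
  refine ⟨m, hm, h1, ?_⟩
  have h3 := add_mem (D.smul_mem (mul_nonneg (sub_nonneg.2 hc) hm.le) hψ) h2
  convert h3 using 1
  rw [add_sub, ← add_smul]
  ring_nf

/-- `φ` lies in an order interval `[m ψ, M ψ]` with `M - m ≤ c`. -/
def Osc (D : RegularCone E) (ψ φ : E) (c : ℝ) : Prop :=
  ∃ m M : ℝ, M - m ≤ c ∧ φ - m • ψ ∈ D.cone ∧ M • ψ - φ ∈ D.cone

theorem osc_of_core {ψ : E} (hψ : ψ ∈ D.core) (hψ1 : D.ℓ ψ = 1) (φ : E) :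
    D.Osc ψ φ (2 / D.ρ * ‖φ‖) := by
  refine ⟨-(‖φ‖ / D.ρ), ‖φ‖ / D.ρ, by ring_nf; rfl, ?_, smul_sub_mem_of_core hψ hψ1 φ⟩
  simpa [add_comm] using smul_sub_mem_of_core hψ hψ1 (-φ)

theorem Osc.map {A : E →L[ℝ] E} (hA : D.IsContraction A) {c : ℝ} {φ ψ : E} (h : D.Osc ψ φ c)
    (hψ : ψ ∈ D.cone) (h0 : ψ ≠ 0) : D.Osc (A ψ) (A φ) ((1 - D.rate) * c) := by
  obtain ⟨m, M, hc, h1, h2⟩ := h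
  obtain ⟨m', M', -, -, h5, h6, h7⟩ := hA.exists_interval hψ h0 h1 h2
  exact ⟨m', M', h5.trans_le (mul_le_mul_of_nonneg_left hc (sub_nonneg.2 D.rate_le_one)), h6, h7⟩

theorem Osc.smul {c a : ℝ} {φ ψ : E} (h : D.Osc ψ φ c) (ha : 0 ≤ a) :
    D.Osc (a • ψ) (a • φ) c := by
  obtain ⟨m, M, hc, h1, h2⟩ := h
  refine ⟨m, M, hc, ?_, ?_⟩
  · simpa [smul_sub, smul_comm a m] using D.smul_mem ha h1
  · simpa [smul_sub, smul_comm a M] using D.smul_mem ha h2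

/-- Oscillation relative to `ψ` ignores multiples of `ψ`; hence the projection in the tangent map
does not affect it. -/
theorem Osc.sub_smul {c : ℝ} {φ ψ : E} (h : D.Osc ψ φ c) (a : ℝ) :
    D.Osc ψ (φ - a • ψ) c := by
  obtain ⟨m, M, hc, h1, h2⟩ := h
  refine ⟨m - a, M - a, by linarith, ?_, ?_⟩
  · rwa [_root_.sub_smul, sub_sub_sub_cancel_right]
  · rwa [_root_.sub_smul, sub_sub_sub_cancel_right]

/-- Applying `D.ℓ` forces `m ≤ 0 ≤ M`, so `-m` is at most the oscillation, and both `φ - m • ψ` and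
`m • ψ` have norm at most `D.K * (-m)`. -/
theorem Osc.norm_le {c : ℝ} {φ ψ : E} (h : D.Osc ψ φ c) (hψ : ψ ∈ D.cone) (hψ1 : D.ℓ ψ = 1)
    (hφ : D.ℓ φ = 0) : ‖φ‖ ≤ 2 * D.K * c := by
  obtain ⟨m, M, hc, h1, h2⟩ := h
  have h3 := D.ℓ_nonneg h1
  have h4 := D.ℓ_nonneg h2
  have h5 := D.norm_le h1
  simp only [map_sub, map_smul, hφ, hψ1, smul_eq_mul, mul_one, zero_sub, sub_zero] at h3 h4 h5
  have h6 := D.norm_le_of_normalized hψ hψ1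
  have hK := D.K_pos
  have h7 : ‖φ‖ ≤ ‖φ - m • ψ‖ + -m * ‖ψ‖ := by
    have : φ = (φ - m • ψ) + m • ψ := by abel
    refine (congrArg norm this).trans_le ((norm_add_le _ _).trans_eq ?_)
    rw [norm_smul, ← norm_neg m, Real.norm_of_nonneg h3]
  have h8 : -m * ‖ψ‖ ≤ -m * D.K := mul_le_mul_of_nonneg_left h6 h3
  nlinarith [mul_le_mul_of_nonneg_left (show -m ≤ c by linarith) hK.le]

end RegularCone

/-! ### The Banach space of bounded sections -/

namespace LInf

variable {Ω : Type*} [MeasurableSpace Ω]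
variable {E : Type*} [NormedAddCommGroup E] [NormedSpace ℝ E]

@[simp] theorem val_smul (a : ℝ) (φ : LInf Ω E) (ω : Ω) : (a • φ).val ω = a • φ.val ω := rfl

@[simp] theorem val_sub (φ ψ : LInf Ω E) (ω : Ω) : (φ - ψ).val ω = φ.val ω - ψ.val ω := rfl

/-- Evaluation at a point. -/
noncomputable def evalL (ω : Ω) : LInf Ω E →L[ℝ] E :=
  LinearMap.mkContinuous
    { toFun := fun φ => φ.val ω
      map_add' := fun _ _ => rfl
      map_smul' := fun _ _ => rfl } 1 fun φ => by
    rw [one_mul]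
    exact φ.norm_val_le ω

theorem tendsto_val {ι : Type*} {l : Filter ι} {φ : ι → LInf Ω E} {ψ : LInf Ω E}
    (h : Tendsto φ l (𝓝 ψ)) (ω : Ω) : Tendsto (fun i => (φ i).val ω) l (𝓝 (ψ.val ω)) :=
  ((evalL ω).continuous.tendsto ψ).comp h

instance [CompleteSpace E] : CompleteSpace (LInf Ω E) := by
  refine IsClosed.completeSpace_coe (hs := ?_)
  refine IsSeqClosed.isClosed fun φ ψ hφ h => ?_
  refine stronglyMeasurable_of_tendsto (f := fun n => (φ n : Ω → E)) atTop hφ ?_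
  rw [tendsto_pi_nhds]
  intro ω
  rw [tendsto_iff_norm_sub_tendsto_zero] at h ⊢
  exact squeeze_zero (fun _ => norm_nonneg _)
    (fun n => lp.norm_apply_le_norm ENNReal.top_ne_zero (φ n - ψ) ω) h

/-- Pointwise multiplication of a section by a bounded measurable function. -/
noncomputable def smulL (Ω : Type*) [MeasurableSpace Ω] (E : Type*) [NormedAddCommGroup E]
    [NormedSpace ℝ E] : LInf Ω ℝ →L[ℝ] LInf Ω E →L[ℝ] LInf Ω E :=
  LinearMap.mkContinuous₂
    (LinearMap.mk₂ ℝ (fun h φ => mk (fun ω => h.val ω • φ.val ω)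
        (h.stronglyMeasurable_val.smul φ.stronglyMeasurable_val) (‖h‖ * ‖φ‖) fun ω => by
          rw [norm_smul]
          exact mul_le_mul (h.norm_val_le ω) (φ.norm_val_le ω) (norm_nonneg _) (norm_nonneg _))
      (fun _ _ _ => ext fun _ => add_smul _ _ _)
      (fun _ _ _ => ext fun _ => by simp [mul_smul])
      (fun _ _ _ => ext fun _ => smul_add _ _ _)
      (fun _ _ _ => ext fun _ => smul_comm _ _ _)) 1 fun h φ => by
    rw [one_mul]
    refine norm_le (by positivity) fun ω => ?_
    simp only [LinearMap.mk₂_apply, val_mk]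
    rw [norm_smul]
    exact mul_le_mul (h.norm_val_le ω) (φ.norm_val_le ω) (norm_nonneg _) (norm_nonneg _)

@[simp] theorem val_smulL (h : LInf Ω ℝ) (φ : LInf Ω E) (ω : Ω) :
    (smulL Ω E h φ).val ω = h.val ω • φ.val ω := rfl

/-- A constant section. -/
noncomputable def const (Ω : Type*) [MeasurableSpace Ω] (x : E) : LInf Ω E :=
  mk (fun _ => x) stronglyMeasurable_const ‖x‖ fun _ => le_rfl

end LInf

/-! ### The fixed point -/

namespace ConeCocycle

variable {r₀ : ℝ} {E : Ioc 0 r₀ → Type*} [∀ r, NormedAddCommGroup (E r)]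
  [∀ r, NormedSpace ℝ (E r)] {S : GradedScale E} {B : Type*} {U : Set B}
  {Ω : Type*} [MeasurableSpace Ω] (c : ConeCocycle S U Ω) (τ : Ω ≃ᵐ Ω) (r : Ioc 0 r₀) (u : U)

theorem val_op (φ : LInf Ω (E r)) (ω : Ω) :
    (c.op τ r u φ).val ω = c.L r u (τ.symm ω) (φ.val (τ.symm ω)) := rfl

theorem val_normalization (φ : LInf Ω (E r)) (ω : Ω) :
    (c.normalization τ r u φ).val ω =
      (S.D r).ℓ (c.L r u (τ.symm ω) (φ.val (τ.symm ω))) := rfl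

theorem fracLin_eq (φ : LInf Ω (E r)) (ω : Ω) :
    c.fracLin τ r u φ ω = ((S.D r).ℓ (c.L r u (τ.symm ω) (φ.val (τ.symm ω))))⁻¹ •
      c.L r u (τ.symm ω) (φ.val (τ.symm ω)) := rfl

variable (S Ω) in
/-- Sections of the slice `{⟨ℓ, φ⟩ = 1}` of the cone. -/
def Slice : Set (LInf Ω (E r)) :=
  {φ | ∀ ω, φ.val ω ∈ (S.D r).cone ∧ (S.D r).ℓ (φ.val ω) = 1}

variable (S Ω) in
/-- Sections of the slice `{⟨ℓ, φ⟩ = 1}` of the core. -/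
def CoreSlice : Set (LInf Ω (E r)) :=
  {φ | ∀ ω, φ.val ω ∈ (S.D r).core ∧ (S.D r).ℓ (φ.val ω) = 1}

variable {r}

theorem CoreSlice.slice {φ : LInf Ω (E r)} (h : φ ∈ CoreSlice S Ω r) : φ ∈ Slice S Ω r :=
  fun ω => ⟨(h ω).1.1, (h ω).2⟩

theorem nonempty_coreSlice : (CoreSlice S Ω r).Nonempty := by
  obtain ⟨e, h1, h2⟩ := (S.D r).exists_core_normalized
  exact ⟨LInf.const Ω e, fun ω => ⟨h1, h2⟩⟩

theorem norm_le_of_slice {φ : LInf Ω (E r)} (h : φ ∈ Slice S Ω r) : ‖φ‖ ≤ (S.D r).K :=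
  LInf.norm_le (S.D r).K_pos.le fun ω => RegularCone.norm_le_of_normalized (h ω).1 (h ω).2

theorem fracLin_mem {φ : LInf Ω (E r)} (h : φ ∈ Slice S Ω r) (ω : Ω) :
    c.fracLin τ r u φ ω ∈ (S.D r).core ∧ (S.D r).ℓ (c.fracLin τ r u φ ω) = 1 := by
  obtain ⟨h1, h2⟩ := h (τ.symm ω)
  have h3 := c.contraction r u (τ.symm ω)
  have h4 := h3.ℓ_pos h1 (RegularCone.ne_zero_of_normalized h2)
  rw [fracLin_eq]
  exact ⟨RegularCone.smul_mem_core (h3.mem_core h1) (inv_pos.2 h4), by simp [h4.ne']⟩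

/-- The fractional linear map, acting on sections of the core. -/
noncomputable def step (φ : CoreSlice S Ω r) : CoreSlice S Ω r :=
  ⟨LInf.mk (c.fracLin τ r u φ)
    (((c.normalization τ r u φ).stronglyMeasurable_val.measurable.inv.stronglyMeasurable).smul
      (c.op τ r u φ).stronglyMeasurable_val) (S.D r).K
    fun ω => RegularCone.norm_le_of_normalized (c.fracLin_mem τ u (CoreSlice.slice φ.2) ω).1.1
      (c.fracLin_mem τ u (CoreSlice.slice φ.2) ω).2,
    fun ω => c.fracLin_mem τ u (CoreSlice.slice φ.2) ω⟩

theorem val_step (φ : CoreSlice S Ω r) (ω : Ω) :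
    (c.step τ u φ).1.val ω = c.fracLin τ r u φ ω := rfl

/-- The gauge contracts fibre by fibre with one rate, so a bound valid for all `ω` persists although
each step moves the fibre by `τ`. -/
theorem close_iterate_step {κ : ℝ} (hκ : 0 ≤ κ) {φ ψ : CoreSlice S Ω r}
    (h : ∀ ω, (S.D r).Close κ (φ.1.val ω) (ψ.1.val ω)) (n : ℕ) (ω : Ω) :
    (S.D r).Close ((1 - (S.D r).rate) ^ n * κ) (((c.step τ u)^[n] φ).1.val ω)
      (((c.step τ u)^[n] ψ).1.val ω) := by
  have hr := sub_nonneg.2 (S.D r).rate_le_one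
  induction n generalizing ω with
  | zero => simpa using h ω
  | succ n ih =>
    rw [Function.iterate_succ_apply', Function.iterate_succ_apply', val_step, val_step, fracLin_eq,
      fracLin_eq, pow_succ', mul_assoc]
    set ψ' := (c.step τ u)^[n] ψ
    set φ' := (c.step τ u)^[n] φ
    have hA := c.contraction r u (τ.symm ω)
    have h1 := ψ'.2 (τ.symm ω)
    have h2 := φ'.2 (τ.symm ω)
    refine ((ih (τ.symm ω)).map hA (by positivity) h1.1.1
      (RegularCone.ne_zero_of_normalized h1.2)).smul ?_ ?_
    · exact inv_pos.2 (hA.ℓ_pos h2.1.1 (RegularCone.ne_zero_of_normalized h2.2))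
    · exact inv_pos.2 (hA.ℓ_pos h1.1.1 (RegularCone.ne_zero_of_normalized h1.2))

/-- The iterates of the fractional linear map contract exponentially. -/
theorem norm_iterate_step_sub_le (φ ψ : CoreSlice S Ω r) (n : ℕ) :
    ‖((c.step τ u)^[n] φ).1 - ((c.step τ u)^[n] ψ).1‖ ≤
      4 * (S.D r).K ^ 2 / (S.D r).ρ ^ 2 * ‖φ.1 - ψ.1‖ * (1 - (S.D r).rate) ^ n := by
  have hr := sub_nonneg.2 (S.D r).rate_le_one
  have hK := (S.D r).K_pos
  have hρ := (S.D r).ρ_pos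
  refine LInf.norm_le (by positivity) fun ω => ?_
  have h1 : ∀ ω, (S.D r).Close (2 * (S.D r).K / (S.D r).ρ ^ 2 * ‖φ.1 - ψ.1‖) (φ.1.val ω)
      (ψ.1.val ω) := fun ω =>
    (RegularCone.close_of_core (φ.2 ω).1 (ψ.2 ω).1 (φ.2 ω).2 (ψ.2 ω).2).mono
      (mul_le_mul_of_nonneg_left ((φ.1 - ψ.1).norm_val_le ω) (by positivity)) (ψ.2 ω).1.1
  have h2 := (c.close_iterate_step τ u (by positivity) h1 n ω).norm_sub_le
    (((c.step τ u)^[n] ψ).2 ω).1.1 (((c.step τ u)^[n] φ).2 ω).2 (((c.step τ u)^[n] ψ).2 ω).2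
  refine h2.trans_eq ?_
  ring

theorem tendsto_pow_rate (C : ℝ) :
    Tendsto (fun n : ℕ => C * (1 - (S.D r).rate) ^ n) atTop (𝓝 0) := by
  have h := tendsto_pow_atTop_nhds_zero_of_lt_one (sub_nonneg.2 (S.D r).rate_le_one)
    (sub_lt_self 1 (S.D r).rate_pos)
  simpa using h.const_mul C

/-- An approximate fixed point is close to the fixed point. -/
theorem norm_sub_le_of_step_eq {φ ψ : CoreSlice S Ω r} (hψ : c.step τ u ψ = ψ) :
    ‖φ.1 - ψ.1‖ ≤ 4 * (S.D r).K ^ 2 / (S.D r).ρ ^ 2 * (S.D r).rate⁻¹ *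
      ‖φ.1 - (c.step τ u φ).1‖ := by
  set κ := 1 - (S.D r).rate with hκ
  set C := 4 * (S.D r).K ^ 2 / (S.D r).ρ ^ 2 with hC
  have hr0 := (S.D r).rate_pos
  have hκ0 : 0 ≤ κ := sub_nonneg.2 (S.D r).rate_le_one
  have hC0 : 0 ≤ C := by positivity
  have hlim : Tendsto (fun n : ℕ => ((c.step τ u)^[n] φ).1) atTop (𝓝 ψ.1) := by
    rw [tendsto_iff_norm_sub_tendsto_zero]
    refine squeeze_zero (fun _ => norm_nonneg _) (fun n => ?_)
      (tendsto_pow_rate (S := S) (r := r) (C * ‖φ.1 - ψ.1‖))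
    have := c.norm_iterate_step_sub_le τ u φ ψ n
    rwa [Function.iterate_fixed hψ] at this
  -- Successive iterates of `φ` differ by at most a constant times `κ ^ n`; summing the geometric
  -- series produces the factor `1 / (1 - κ) = (S.D r).rate⁻¹`.
  have h := dist_le_of_le_geometric_of_tendsto₀ κ (C * ‖φ.1 - (c.step τ u φ).1‖)
    (f := fun n => ((c.step τ u)^[n] φ).1) (by linarith) (fun n => ?_) hlim
  · rw [dist_eq_norm] at h
    refine h.trans_eq ?_
    rw [hκ]
    simp only [sub_sub_cancel]
    ring
  · rw [dist_eq_norm, Function.iterate_succ_apply]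
    exact c.norm_iterate_step_sub_le τ u φ _ n

/-- The limit of the iterates is first placed only in the slice of the closed cone. It is a fixed
point there, and an image under the fractional linear map automatically lies in the core. Working in
the space of strongly measurable sections makes the limit measurable. -/
theorem exists_step_eq [CompleteSpace (E r)] : ∃ φ : CoreSlice S Ω r, c.step τ u φ = φ := by
  obtain ⟨φ₀, h₀⟩ := nonempty_coreSlice (S := S) (Ω := Ω) (r := r)
  set φ : ℕ → CoreSlice S Ω r := fun n => (c.step τ u)^[n] ⟨φ₀, h₀⟩ with hφ
  have hcauchy : CauchySeq fun n => (φ n).1 := by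
    refine cauchySeq_of_le_geometric (1 - (S.D r).rate)
      (4 * (S.D r).K ^ 2 / (S.D r).ρ ^ 2 * ‖φ₀ - (c.step τ u ⟨φ₀, h₀⟩).1‖) (sub_lt_self 1 (S.D r).rate_pos)
      fun n => ?_
    rw [dist_eq_norm]
    simp only [hφ, Function.iterate_succ_apply]
    exact c.norm_iterate_step_sub_le τ u _ _ n
  obtain ⟨ψ, hψ⟩ := cauchySeq_tendsto_of_complete hcauchy
  have hs : ψ ∈ Slice S Ω r := fun ω => by
    have h1 := LInf.tendsto_val hψ ω
    refine ⟨(S.D r).cone.isClosed.mem_of_tendsto h1 (Eventually.of_forall fun n =>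
      ((φ n).2 ω).1.1), ?_⟩
    have h2 := ((S.D r).ℓ.continuous.tendsto _).comp h1
    refine tendsto_nhds_unique h2 (tendsto_const_nhds.congr fun n => ?_)
    exact ((φ n).2 ω).2.symm
  have hfix : ∀ ω, c.fracLin τ r u ψ ω = ψ.val ω := fun ω => by
    obtain ⟨h1, h2⟩ := hs (τ.symm ω)
    have h3 := (c.contraction r u (τ.symm ω)).ℓ_pos h1 (RegularCone.ne_zero_of_normalized h2)
    have h4 := LInf.tendsto_val hψ (τ.symm ω)
    have h5 := ((c.L r u (τ.symm ω)).continuous.tendsto _).comp h4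
    have h6 := (((S.D r).ℓ.continuous.tendsto _).comp h5).inv₀ h3.ne'
    have h7 := LInf.tendsto_val ((tendsto_add_atTop_iff_nat 1).2 hψ) ω
    refine tendsto_nhds_unique (h6.smul h5) (h7.congr fun n => ?_)
    simp only [hφ, Function.iterate_succ_apply']
    rfl
  refine ⟨⟨ψ, fun ω => hfix ω ▸ c.fracLin_mem τ u hs ω⟩, ?_⟩
  exact Subtype.ext (LInf.ext hfix)

theorem step_eq_unique {φ ψ : CoreSlice S Ω r} (hφ : c.step τ u φ = φ) (hψ : c.step τ u ψ = ψ) :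
    φ = ψ := by
  have h := c.norm_sub_le_of_step_eq τ u (φ := φ) hψ
  rw [hφ, sub_self, norm_zero, mul_zero, norm_le_zero_iff, sub_eq_zero] at h
  exact Subtype.ext h

end ConeCocycle

theorem LInf.measurable_log {Ω : Type*} [MeasurableSpace Ω] (φ : LInf Ω ℝ) :
    Measurable fun ω => Real.log (φ.val ω) :=
  φ.stronglyMeasurable_val.measurable.log

/-! ### Uniqueness and consistency of fixed families, bounds on the normalization, and the exponent.
-/

namespace ConeCocycle

variable {r₀ : ℝ} {E : Ioc 0 r₀ → Type*} [∀ r, NormedAddCommGroup (E r)]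
  [∀ r, NormedSpace ℝ (E r)] {S : GradedScale E} {B : Type*} {U : Set B}
  {Ω : Type*} [MeasurableSpace Ω] {c : ConeCocycle S U Ω} {τ : Ω ≃ᵐ Ω}

theorem step_eq_of_fixed {r : Ioc 0 r₀} {u : U} {φ : LInf Ω (E r)} (h : φ ∈ Slice S Ω r)
    (hφ : ∀ ω, φ.val ω = c.fracLin τ r u φ ω) :
    ∃ h' : φ ∈ CoreSlice S Ω r, c.step τ u ⟨φ, h'⟩ = ⟨φ, h'⟩ :=
  ⟨fun ω => hφ ω ▸ c.fracLin_mem τ u h ω, Subtype.ext (LInf.ext fun ω => (hφ ω).symm)⟩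

theorem slice_fixed_unique {r : Ioc 0 r₀} {u : U} {φ ψ : LInf Ω (E r)} (h : φ ∈ Slice S Ω r)
    (hφ : ∀ ω, φ.val ω = c.fracLin τ r u φ ω) (h' : ψ ∈ Slice S Ω r)
    (hψ : ∀ ω, ψ.val ω = c.fracLin τ r u ψ ω) : φ = ψ := by
  obtain ⟨h1, h2⟩ := step_eq_of_fixed h hφ
  obtain ⟨h3, h4⟩ := step_eq_of_fixed h' hψ
  exact congrArg Subtype.val (c.step_eq_unique τ u h2 h4)

theorem fracLin_postcomp {s r : Ioc 0 r₀} (h : s < r) (u : U) (φ : LInf Ω (E r)) (ω : Ω) :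
    c.fracLin τ s u (LInf.postcomp Ω (S.j h) φ) ω = S.j h (c.fracLin τ r u φ ω) := by
  have h1 := DFunLike.congr_fun (c.equivariant h u (τ.symm ω)) (φ.val (τ.symm ω))
  rw [ContinuousLinearMap.comp_apply, ContinuousLinearMap.comp_apply] at h1
  rw [fracLin_eq, fracLin_eq, LInf.val_postcomp, ← h1, S.j_ℓ h, map_smul]
  rfl

/-- The injections intertwine the fractional linear maps and preserve the slices, so the image of
the fixed point at level `r` is a fixed point at level `s`; uniqueness there gives consistency. -/
theorem exists_isFixedFamily [∀ r, CompleteSpace (E r)] (c : ConeCocycle S U Ω) (τ : Ω ≃ᵐ Ω) :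
    ∃ f : ∀ r : Ioc 0 r₀, U → LInf Ω (E r), c.IsFixedFamily τ f := by
  choose f hf using fun (r : Ioc 0 r₀) (u : U) => c.exists_step_eq τ (r := r) u
  have hs : ∀ r u, (f r u).1 ∈ Slice S Ω r := fun r u => CoreSlice.slice (f r u).2
  have hfix : ∀ r u ω, (f r u).1.val ω = c.fracLin τ r u (f r u).1 ω := fun r u ω =>
    congrArg (fun φ : CoreSlice S Ω r => φ.1.val ω) (hf r u).symm
  refine ⟨fun r u => (f r u).1, fun r u ω => (hs r u ω).1, fun r u ω => (hs r u ω).2, hfix,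
    fun {s r} h u => slice_fixed_unique (hs s u) (hfix s u) (fun ω => ⟨?_, ?_⟩) fun ω => ?_⟩
  · exact S.j_cone h _ (hs r u ω).1
  · rw [LInf.val_postcomp, ← (hs r u ω).2, S.j_ℓ h]
    rfl
  · rw [fracLin_postcomp, ← hfix]
    rfl

namespace IsFixedFamily

variable {f : ∀ r : Ioc 0 r₀, U → LInf Ω (E r)} (hf : c.IsFixedFamily τ f)
include hf

theorem slice (r : Ioc 0 r₀) (u : U) : f r u ∈ Slice S Ω r :=
  fun ω => ⟨hf.mem_cone r u ω, hf.normalized r u ω⟩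

theorem coreSlice (r : Ioc 0 r₀) (u : U) : f r u ∈ CoreSlice S Ω r :=
  (step_eq_of_fixed (hf.slice r u) (hf.fixed r u)).1

theorem step_eq (r : Ioc 0 r₀) (u : U) :
    c.step τ u ⟨f r u, hf.coreSlice r u⟩ = ⟨f r u, hf.coreSlice r u⟩ :=
  (step_eq_of_fixed (hf.slice r u) (hf.fixed r u)).2

theorem unique {g : ∀ r : Ioc 0 r₀, U → LInf Ω (E r)} (hg : c.IsFixedFamily τ g) : g = f :=
  funext fun r => funext fun u =>
    slice_fixed_unique (hg.slice r u) (hg.fixed r u) (hf.slice r u) (hf.fixed r u)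

theorem norm_le (r : Ioc 0 r₀) (u : U) : ‖f r u‖ ≤ (S.D r).K := norm_le_of_slice (hf.slice r u)

omit hf in
variable (S) in
/-- The uniform lower bound of the normalization. -/
noncomputable def _root_.GradedScale.low (S : GradedScale E) (r : Ioc 0 r₀) : ℝ :=
  (S.D r).ρ / (3 * (S.D r).K * (S.D r).ϑ)

omit hf in
theorem _root_.GradedScale.low_pos (S : GradedScale E) (r : Ioc 0 r₀) : 0 < S.low r := by
  have h1 := (S.D r).ρ_pos
  have h2 := (S.D r).K_pos
  have h3 := one_pos.trans_le (S.D r).one_le_ϑ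
  unfold GradedScale.low
  positivity

theorem low_le (r : Ioc 0 r₀) (u : U) (ω : Ω) : S.low r ≤ (c.normalization τ r u (f r u)).val ω :=
  (c.contraction r u _).le_ℓ (hf.coreSlice r u _).1 (hf.normalized r u _)

theorem normalization_pos (r : Ioc 0 r₀) (u : U) (ω : Ω) :
    0 < (c.normalization τ r u (f r u)).val ω := (S.low_pos r).trans_le (hf.low_le r u ω)

theorem val_op_eq (r : Ioc 0 r₀) (u : U) (ω : Ω) :
    (c.op τ r u (f r u)).val ω = (c.normalization τ r u (f r u)).val ω • (f r u).val ω := by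
  have h := hf.normalization_pos r u ω
  conv_rhs => rw [hf.fixed r u ω]
  rw [fracLin, smul_inv_smul₀ h.ne']

theorem normalization_eq_of_lt {s r : Ioc 0 r₀} (h : s < r) (u : U) :
    c.normalization τ s u (f s u) = c.normalization τ r u (f r u) := by
  refine LInf.ext fun ω => ?_
  have h1 := DFunLike.congr_fun (c.equivariant h u (τ.symm ω)) ((f r u).val (τ.symm ω))
  rw [ContinuousLinearMap.comp_apply, ContinuousLinearMap.comp_apply] at h1
  rw [val_normalization, val_normalization, hf.consistent h, LInf.val_postcomp, ← h1, S.j_ℓ h]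
  rfl

theorem normalization_eq (s r : Ioc 0 r₀) (u : U) :
    c.normalization τ s u (f s u) = c.normalization τ r u (f r u) := by
  rcases lt_trichotomy s r with h | rfl | h
  · exact hf.normalization_eq_of_lt h u
  · rfl
  · exact (hf.normalization_eq_of_lt h u).symm

theorem normalization_le (r : Ioc 0 r₀) (u : U) (ω : Ω) :
    (c.normalization τ r u (f r u)).val ω ≤ (S.D r).ϑ * (S.D r).K :=
  ((S.D r).ℓ_le _).trans ((c.L r u _).le_of_opNorm_le_of_le (c.contraction r u _).norm_le
    (RegularCone.norm_le_of_normalized (hf.mem_cone r u _) (hf.normalized r u _)))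

theorem abs_log_le (r : Ioc 0 r₀) (u : U) (ω : Ω) :
    |Real.log ((c.normalization τ r u (f r u)).val ω)| ≤
      max (-Real.log (S.low r)) (Real.log ((S.D r).ϑ * (S.D r).K)) := by
  have h0 := S.low_pos r
  have h1 := hf.low_le r u ω
  have h3 := Real.log_le_log h0 h1
  have h4 := Real.log_le_log (h0.trans_le h1) (hf.normalization_le r u ω)
  have h5 := le_max_left (-Real.log (S.low r)) (Real.log ((S.D r).ϑ * (S.D r).K))
  rw [abs_le]
  exact ⟨by linarith, h4.trans (le_max_right _ _)⟩

theorem integrable_log (P : Measure Ω) [IsProbabilityMeasure P] (r : Ioc 0 r₀) (u : U) :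
    Integrable (fun ω => Real.log ((c.normalization τ r u (f r u)).val ω)) P :=
  Integrable.of_bound (c.normalization τ r u (f r u)).measurable_log.aestronglyMeasurable _
    (Eventually.of_forall (hf.abs_log_le r u))

/-! #### The characteristic exponent -/

/-- The value of the normalization at `ω` belongs to the operator arriving at `ω` from `τ⁻¹ω`. Hence
the accumulated factor is a Birkhoff sum along `τ.symm`, starting at `ω` itself. -/
theorem cocycleIterate_apply (r : Ioc 0 r₀) (u : U) (n : ℕ) (ω : Ω) :
    cocycleIterate τ (c.L r u) n ω ((f r u).val (τ.symm^[n] ω)) =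
      Real.exp (birkhoffSum τ.symm
        (fun ω => Real.log ((c.normalization τ r u (f r u)).val ω)) n ω) • (f r u).val ω := by
  induction n generalizing ω with
  | zero => simp [cocycleIterate]
  | succ n ih =>
    rw [cocycleIterate, ContinuousLinearMap.comp_apply, Function.iterate_succ_apply, ih,
      birkhoffSum_succ', map_smul, ← val_op, hf.val_op_eq, smul_smul, Real.exp_add,
      Real.exp_log (hf.normalization_pos r u ω), mul_comm]

omit hf in
theorem cocycleIterate_mem (r : Ioc 0 r₀) (u : U) (n : ℕ) (ω : Ω) :
    ∀ φ ∈ (S.D r).cone, cocycleIterate τ (c.L r u) n ω φ ∈ (S.D r).cone := by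
  induction n generalizing ω with
  | zero => exact fun φ h => h
  | succ n ih => exact fun φ h => ((c.contraction r u _).mem_core (ih _ φ h)).1

/-- The iterate preserves the cone, so its norm is comparable, with constants independent of `n`, to
its value on the normalized core element `f`, and that value is the exponential of the Birkhoff sum.
-/
theorem abs_log_cocycleIterate_sub_le (r : Ioc 0 r₀) (u : U) (n : ℕ) (ω : Ω) :
    |Real.log ‖cocycleIterate τ (c.L r u) n ω‖ - birkhoffSum τ.symm
      (fun ω => Real.log ((c.normalization τ r u (f r u)).val ω)) n ω| ≤
        Real.log (3 * (S.D r).K / (S.D r).ρ) := by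
  set b := birkhoffSum τ.symm (fun ω => Real.log ((c.normalization τ r u (f r u)).val ω)) n ω
  have hK := (S.D r).K_pos
  have hρ := (S.D r).ρ_pos
  set q := (τ.symm^[n] ω)
  have h1 := hf.cocycleIterate_apply r u n ω
  have hup := RegularCone.norm_le_of_mapsTo (D := S.D r) (cocycleIterate_mem (c := c) (τ := τ) r u n ω)
    (hf.coreSlice r u q).1 (hf.normalized r u q)
  rw [h1, map_smul, hf.normalized, smul_eq_mul, mul_one] at hup
  have hlow : Real.exp b ≤ ‖cocycleIterate τ (c.L r u) n ω‖ * (S.D r).K := by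
    have h2 := (S.D r).ℓ_le (cocycleIterate τ (c.L r u) n ω ((f r u).val q))
    rw [h1, map_smul, hf.normalized, smul_eq_mul, mul_one, ← h1] at h2
    exact h2.trans ((cocycleIterate τ (c.L r u) n ω).le_opNorm_of_le
      (RegularCone.norm_le_of_normalized (hf.mem_cone r u q) (hf.normalized r u q)))
  have hpos : 0 < ‖cocycleIterate τ (c.L r u) n ω‖ :=
    pos_of_mul_pos_left ((Real.exp_pos b).trans_le hlow) hK.le
  have h2 := Real.log_le_log hpos hup
  have h3 := Real.log_le_log (Real.exp_pos b) hlow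
  rw [Real.log_mul (by positivity) (Real.exp_pos b).ne', Real.log_exp] at h2
  rw [Real.log_mul hpos.ne' hK.ne', Real.log_exp] at h3
  have h4 : Real.log (S.D r).K ≤ Real.log (3 * (S.D r).K / (S.D r).ρ) := by
    refine Real.log_le_log hK ?_
    rw [le_div_iff₀ hρ]
    nlinarith [(S.D r).ρ_le_one]
  rw [abs_le]
  constructor <;> linarith

/-- The error between the logarithm of the norm and the Birkhoff sum is bounded in `n`, so the upper
limit is an actual limit, given by the ergodic theorem for `τ.symm`. -/
theorem charExponent_eq {P : Measure Ω} [IsProbabilityMeasure P] (hτ : Ergodic τ P)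
    (r : Ioc 0 r₀) (u : U) : ∀ᵐ ω ∂P, charExponent τ (c.L r u) ω =
      ∫ ω', Real.log ((c.normalization τ r u (f r u)).val ω') ∂P := by
  filter_upwards [ae_tendsto_birkhoffSum (T := τ.symm) hτ.symm (c.normalization τ r u (f r u)).measurable_log
    (hf.abs_log_le r u)] with ω hω
  refine Tendsto.limsup_eq ?_
  have h1 : Tendsto (fun n : ℕ => (1 / (n : ℝ)) * (Real.log ‖cocycleIterate τ (c.L r u) n ω‖ -
      birkhoffSum τ.symm (fun ω => Real.log ((c.normalization τ r u (f r u)).val ω)) n ω))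
      atTop (𝓝 0) := by
    refine squeeze_zero_norm (a := fun n : ℕ => (1 / (n : ℝ)) *
      Real.log (3 * (S.D r).K / (S.D r).ρ)) (fun n => ?_) ?_
    · rw [norm_mul, Real.norm_of_nonneg (by positivity : (0 : ℝ) ≤ 1 / (n : ℝ))]
      exact mul_le_mul_of_nonneg_left (hf.abs_log_cocycleIterate_sub_le r u n ω) (by positivity)
    · simpa using tendsto_one_div_atTop_nhds_zero_nat.mul_const
        (Real.log (3 * (S.D r).K / (S.D r).ρ))
  have h2 := h1.add hω
  rw [zero_add] at h2
  refine h2.congr fun n => ?_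
  ring

end IsFixedFamily

end ConeCocycle

/-! ### Solutions of implicit equations in a graded scale -/

namespace HolderBelow

section

variable {B X Y Z : Type w} [NormedAddCommGroup B] [NormedSpace ℝ B]
  [NormedAddCommGroup X] [NormedSpace ℝ X] [NormedAddCommGroup Y] [NormedSpace ℝ Y]
  [NormedAddCommGroup Z] [NormedSpace ℝ Z] {U : Set B}

theorem comp (hU : IsOpen U) {n : ℕ} {θ : ℝ} {F : B → Y →L[ℝ] Z} {G : B → X →L[ℝ] Y}
    (hF : HolderBelow U n θ F) (hG : HolderBelow U n θ G) :
    HolderBelow U n θ fun u => F u ∘L G u :=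
  bilin' hU (_root_.compBilin X Y Z) hF hG

end

variable {B : Type w} [NormedAddCommGroup B] [NormedSpace ℝ B] {U : Set B}

/-- **Bootstrap for implicitly defined functions.** If `f_s` has derivative
`N_s(u) P_s(u) (DL_{s,r}(u)) f_r(u)`, where `N_s(u)` is a bounded inverse of `1 - P_s(u) L_s(u)` and
`P` is as regular as `f`, then `f_s` is of class `C^t` for all `t < r₀ - s`. -/
theorem of_implicit_equation (hU : IsOpen U) {r₀ : ℝ} {X : Ioc 0 r₀ → Type w}
    [∀ s, NormedAddCommGroup (X s)] [∀ s, NormedSpace ℝ (X s)]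
    (j : ∀ {s r : Ioc 0 r₀}, s < r → (X r →L[ℝ] X s))
    {f : ∀ s, B → X s} {L P N : ∀ s, B → X s →L[ℝ] X s}
    (hf : ∀ {s r : Ioc 0 r₀} (h : s < r), ∀ u ∈ U, f s u = j h (f r u))
    (hbd : ∀ s, ∃ C, ∀ u ∈ U, ‖f s u‖ ≤ C)
    (hhol : ∀ s : Ioc 0 r₀, ∀ α, 0 < α → α < 1 → α < r₀ - s →
      ∃ C, ∀ u ∈ U, ∀ v ∈ U, ‖f s u - f s v‖ ≤ C * ‖u - v‖ ^ α)
    (hder : ∀ {s r : Ioc 0 r₀} (h : s < r), (s : ℝ) + 1 < r → (r : ℝ) < r₀ →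
      ∀ u ∈ U, HasFDerivAt (f s)
      (N s u ∘L P s u ∘L (_root_.fderiv ℝ (fun u => L s u ∘L j h) u).flip (f r u)) u)
    (hL : ∀ (n : ℕ) {s r : Ioc 0 r₀} (h : s < r),
      HolderBelow U n (r - s : ℝ) fun u => L s u ∘L j h)
    (hP : ∀ n : ℕ, (∀ s : Ioc 0 r₀, HolderBelow U n (r₀ - s : ℝ) (f s)) →
      ∀ s : Ioc 0 r₀, HolderBelow U n (r₀ - s : ℝ) (P s))
    (hN : ∀ s, ∃ C, ∀ u ∈ U, ‖N s u‖ ≤ C)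
    (hNl : ∀ s, ∀ u ∈ U, ∀ x, N s u (x - P s u (L s u x)) = x)
    (hNr : ∀ s, ∀ u ∈ U, ∀ x, N s u x - P s u (L s u (N s u x)) = x) (n : ℕ) :
    ∀ s : Ioc 0 r₀, HolderBelow U n (r₀ - s : ℝ) (f s) := by
  induction n with
  | zero => exact fun _ => trivial
  | succ n ih =>
    have hP' := hP n ih
    have level : ∀ s : Ioc 0 r₀, (s : ℝ) + 1 < r₀ → ∃ i : Levels s r₀, (s : ℝ) + 1 < i.1 :=
      fun s hs => by
        obtain ⟨i, hi⟩ := exists_level le_rfl (show (s : ℝ) < (s + 1 + r₀) / 2 by linarith)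
          (show ((s : ℝ) + 1 + r₀) / 2 < r₀ by linarith)
        exact ⟨i, by rw [hi]; linarith⟩
    have hdiff : ∀ s : Ioc 0 r₀, (s : ℝ) + 1 < r₀ → ∀ u ∈ U,
        HasFDerivAt (f s) (_root_.fderiv ℝ (f s) u) u := fun s hs u hu => by
      obtain ⟨i, hi⟩ := level s hs
      exact (hder i.2.1 hi i.2.2 u hu).differentiableAt.hasFDerivAt
    intro s
    refine succ hU (_root_.fderiv ℝ (f s)) (fun _ => hbd s) (hhol s)
      (fun h => hdiff s (by linarith)) fun h1 => ?_
    -- Differentiation gives `(1 - P L) Df = P (DL) f`. The right-hand side contains only `P` and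
    -- `f` to depth `n`, so the linear theory gives `Df` to depth `n` and hence `f` to depth `n +
    -- 1`.
    have h2 := of_linear_equation hU (X := fun s => B →L[ℝ] X s) (n := n) (R := r₀ - 1)
      (by linarith) (fun {s r} h => _root_.compBilin B (X r) (X s) (j h))
      (g := fun s => _root_.fderiv ℝ (f s))
      (b := fun s u => _root_.fderiv ℝ (f s) u - (P s u ∘L L s u) ∘L _root_.fderiv ℝ (f s) u)
      (T := fun s u => _root_.compBilin B (X s) (X s) (P s u ∘L L s u))
      (N := fun s u => _root_.compBilin B (X s) (X s) (N s u)) ?_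
      (fun _ _ _ _ => rfl) ?_ ?_ ?_ ?_ ?_ s (by linarith)
    · rwa [show (r₀ : ℝ) - s - 1 = r₀ - 1 - s by ring]
    · intro s r h hr u hu
      refine (((j h).hasFDerivAt.comp u (hdiff r (by linarith) u hu)).congr_of_eventuallyEq
        ?_).fderiv
      filter_upwards [hU.mem_nhds hu] with v hv using hf h v hv
    · intro s
      obtain ⟨C, hC⟩ := hN s
      exact ⟨C, fun u hu => (norm_compBilin_apply_le B _).trans (hC u hu)⟩
    · intro s u hu x
      ext k
      simpa using hNl s u hu (x k)
    · intro s u hu x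
      ext k
      simpa using hNr s u hu (x k)
    · intro s r h
      have hr : (r : ℝ) - s ≤ r₀ - s := sub_le_sub_right r.2.2 _
      exact (HolderBelow.comp hU ((hP' s).mono hr) (hL n h)).compBilin hU
    · intro s hs
      obtain ⟨i, hi⟩ := level s (by linarith)
      have e : ∀ u ∈ U, _root_.fderiv ℝ (f s) u - (P s u ∘L L s u) ∘L _root_.fderiv ℝ (f s) u =
          P s u ∘L (_root_.fderiv ℝ (fun u => L s u ∘L j i.2.1) u).flip (f i.1 u) :=
        fun u hu => by
          rw [(hder i.2.1 hi i.2.2 u hu).fderiv]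
          ext k
          exact hNr s u hu _
      refine HolderBelow.congr hU ?_ fun u hu => (e u hu).symm
      refine HolderBelow.comp hU ((hP' s).mono (by linarith)) ?_
      exact fderiv_apply hU le_rfl (a := fun (i : Levels s r₀) u => L s u ∘L j i.2.1)
        (fun i => hL (n + 1) i.2.1) (fun i => ih i.1)
        (fun i i' u _ v hv => by simp [← hf i.2.1 v hv, ← hf i'.2.1 v hv]) i hi

end HolderBelow

/-- A product of two Hölder functions of exponent `3 / 4` vanishing at `u` has zero derivative. -/
theorem hasFDerivAt_zero_of_holder {B P Q Z : Type*} [NormedAddCommGroup B] [NormedSpace ℝ B]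
    [NormedAddCommGroup P] [NormedSpace ℝ P] [NormedAddCommGroup Q] [NormedSpace ℝ Q]
    [NormedAddCommGroup Z] [NormedSpace ℝ Z] (β : P →L[ℝ] Q →L[ℝ] Z) {a : B → P} {b : B → Q}
    {u : B} {C D : ℝ} (ha : ∀ᶠ v in 𝓝 u, ‖a v - a u‖ ≤ C * ‖v - u‖ ^ (3 / 4 : ℝ))
    (hb : ∀ᶠ v in 𝓝 u, ‖b v - b u‖ ≤ D * ‖v - u‖ ^ (3 / 4 : ℝ)) :
    HasFDerivAt (fun v => β (a v - a u) (b v - b u)) (0 : B →L[ℝ] Z) u := by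
  rw [hasFDerivAt_iff_isLittleO]
  have h1 : (fun v => β (a v - a u) (b v - b u)) =O[𝓝 u]
      fun v => ‖v - u‖ ^ (1 / 2 : ℝ) * ‖v - u‖ := by
    refine Asymptotics.IsBigO.of_bound (‖β‖ * C * D) ?_
    filter_upwards [ha, hb] with v hv hv'
    refine ((β).le_of_opNorm₂_le_of_le le_rfl hv hv').trans_eq ?_
    rcases eq_or_ne v u with rfl | hne
    · simp
    · have h0 : 0 < ‖v - u‖ := norm_sub_pos_iff.2 hne
      rw [Real.norm_of_nonneg (by positivity)]
      have : ‖v - u‖ ^ (3 / 4 : ℝ) * ‖v - u‖ ^ (3 / 4 : ℝ) = ‖v - u‖ ^ (1 / 2 : ℝ) * ‖v - u‖ := by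
        rw [← Real.rpow_add h0, ← Real.rpow_add_one h0.ne']
        norm_num
      rw [← this]
      ring
  have h2 : (fun v => ‖v - u‖ ^ (1 / 2 : ℝ) * ‖v - u‖) =o[𝓝 u] fun v => 1 * ‖v - u‖ := by
    refine Asymptotics.IsLittleO.mul_isBigO ?_ (Asymptotics.isBigO_refl _ _)
    rw [Asymptotics.isLittleO_one_iff]
    have h3 : Tendsto (fun v => ‖v - u‖) (𝓝 u) (𝓝 0) :=
      tendsto_iff_norm_sub_tendsto_zero.1 tendsto_id
    simpa using h3.rpow_const (p := 1 / 2) (Or.inr (by norm_num))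
  simp only [one_mul] at h2
  simpa using (h1.trans_isLittleO h2).of_norm_right

/-! ### Inverses and logarithms -/

namespace HolderBelow

variable {B X A : Type w} [NormedAddCommGroup B] [NormedSpace ℝ B] [NormedAddCommGroup X]
  [NormedSpace ℝ X] [NormedAddCommGroup A] [NormedSpace ℝ A] {U : Set B}

/-- The hypothesis `key` is the resolvent identity. It yields first Hölder continuity of `h`, then
the derivative `-h² DF`, which involves `h` only to the depth already known. -/
theorem inv (hU : IsOpen U) (μ : A →L[ℝ] A →L[ℝ] A) (hμ : ∀ x y, μ (μ x x) y = μ x (μ x y))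
    {n : ℕ} {θ : ℝ} {F h : B → A} (hF : HolderBelow U n θ F)
    (key : ∀ u ∈ U, ∀ v ∈ U, h u - h v = μ (μ (h u) (h v)) (F v - F u)) {M : ℝ}
    (hM : ∀ u ∈ U, ‖h u‖ ≤ M) : HolderBelow U n θ h := by
  induction n generalizing θ with
  | zero => trivial
  | succ n ih =>
    have hol : ∀ α, 0 < α → α < 1 → α < θ →
        ∃ C, ∀ u ∈ U, ∀ v ∈ U, ‖h u - h v‖ ≤ C * ‖u - v‖ ^ α := by
      intro α h0 h1 h2
      obtain ⟨C, hC0, hC⟩ := hF.holder h0 h1 h2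
      refine ⟨‖μ‖ * (‖μ‖ * M * M) * C, fun u hu v hv => ?_⟩
      rw [key u hu v hv, mul_assoc _ C]
      refine μ.le_of_opNorm₂_le_of_le le_rfl
        (μ.le_of_opNorm₂_le_of_le le_rfl (hM u hu) (hM v hv)) ?_
      rw [norm_sub_rev]
      exact hC u hu v hv
    have cont : 0 < θ → ∀ u ∈ U, ContinuousAt h u := fun h0 u hu =>
      continuousAt (n := 0) hU (θ := min 1 θ) (fun _ => ⟨⟨M, hM⟩,
        fun α h0 h1 h2 => hol α h0 h1 (h2.trans_le (min_le_right _ _)),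
        fun h => absurd (min_le_left _ _) h.not_ge⟩) (by simpa using h0) hu
    refine succ hU (fun u => -(μ (h u) ∘L μ (h u) ∘L _root_.fderiv ℝ F u)) (fun _ => ⟨M, hM⟩) hol
      (fun h1 u hu => ?_) fun h1 => ?_
    · have h0 := one_pos.trans h1
      have e1 := hasFDerivAt_bilin_of_continuousAt μ (a := fun v => μ (h u) (h v))
        ((μ (h u)).continuous.continuousAt.comp (cont h0 u hu)) (hF.hasFDerivAt h1 hu)
      have e2 := e1.const_sub (h u)
      have e3 : μ (μ (h u) (h u)) ∘L _root_.fderiv ℝ F u =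
          μ (h u) ∘L μ (h u) ∘L _root_.fderiv ℝ F u :=
        ContinuousLinearMap.ext fun k => hμ _ _
      rw [e3] at e2
      refine e2.congr_of_eventuallyEq ?_
      filter_upwards [hU.mem_nhds hu] with v hv
      rw [← key u hu v hv, sub_sub_cancel]
    · have h2 := (ih hF.of_succ).mono (show θ - 1 ≤ θ by linarith)
      have h3 := h2.clm_comp hU μ
      have h4 := HolderBelow.comp hU h3 (HolderBelow.comp hU h3 hF.fderiv)
      have h5 := HolderBelow.sub hU (HolderBelow.const hU 0) h4
      simpa only [zero_sub] using h5

/-- If `G` has formal derivative `h DF`, it is as regular as `F` and `h`. -/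
theorem of_quadratic_remainder (hU : IsOpen U) (μ : A →L[ℝ] A →L[ℝ] A) {n : ℕ} {θ : ℝ}
    {F h G : B → A} (hF : HolderBelow U n θ F) (hh : HolderBelow U n θ h) {C M : ℝ}
    (hM : ∀ u ∈ U, ‖G u‖ ≤ M) (hC : 0 ≤ C)
    (hG : ∀ u ∈ U, ∀ v ∈ U, ‖G u - G v‖ ≤ C * ‖F u - F v‖)
    (hG' : ∀ u ∈ U, ∀ v ∈ U, ‖G v - G u - μ (h u) (F v - F u)‖ ≤ C * ‖F v - F u‖ ^ 2) :
    HolderBelow U n θ G := by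
  cases n with
  | zero => trivial
  | succ n =>
    refine succ hU (fun u => μ (h u) ∘L _root_.fderiv ℝ F u) (fun _ => ⟨M, hM⟩)
      (fun α h0 h1 h2 => ?_) (fun h1 u hu => ?_) fun h1 => ?_
    · obtain ⟨D, hD0, hD⟩ := hF.holder h0 h1 h2
      refine ⟨C * D, fun u hu v hv => (hG u hu v hv).trans ?_⟩
      rw [mul_assoc]
      exact mul_le_mul_of_nonneg_left (hD u hu v hv) hC
    · have hd := hF.hasFDerivAt h1 hu
      have e1 : HasFDerivAt (fun v => G v - G u - μ (h u) (F v - F u)) (0 : B →L[ℝ] A) u := by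
        rw [hasFDerivAt_iff_isLittleO]
        have o1 : (fun v => G v - G u - μ (h u) (F v - F u)) =O[𝓝 u]
            fun v => ‖F v - F u‖ * ‖F v - F u‖ := by
          refine Asymptotics.IsBigO.of_bound C ?_
          filter_upwards [hU.mem_nhds hu] with v hv
          rw [Real.norm_of_nonneg (by positivity), ← sq]
          exact hG' u hu v hv
        have o2 : (fun v => ‖F v - F u‖ * ‖F v - F u‖) =o[𝓝 u] fun v => 1 * ‖v - u‖ := by
          refine Asymptotics.IsLittleO.mul_isBigO ?_ hd.isBigO_sub.norm_norm
          rw [Asymptotics.isLittleO_one_iff]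
          exact tendsto_iff_norm_sub_tendsto_zero.1 hd.continuousAt.tendsto
        simp only [one_mul] at o2
        simpa using (o1.trans_isLittleO o2).of_norm_right
      have e2 := ((μ (h u)).hasFDerivAt.comp u (hd.sub_const (F u)))
      have e3 := (e1.add e2).add_const (G u)
      rw [zero_add] at e3
      refine e3.congr_of_eventuallyEq (Eventually.of_forall fun v => ?_)
      simp
    · exact HolderBelow.comp hU ((hh.of_succ.mono (by linarith)).clm_comp hU μ) hF.fderiv

/-- Regularity of the operators `x ↦ h (x - ⟨ℓ, x⟩ f)`. -/
theorem proj (hU : IsOpen U) (ℓ : X →L[ℝ] A) (μ : A →L[ℝ] X →L[ℝ] X) {n : ℕ} {θ : ℝ}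
    {h : B → A} {f : B → X} (hh : HolderBelow U n θ h) (hf : HolderBelow U n θ f) :
    HolderBelow U n θ fun u => μ (h u) ∘L (ContinuousLinearMap.id ℝ X - μ.flip (f u) ∘L ℓ) :=
  HolderBelow.comp hU (hh.clm_comp hU μ) ((HolderBelow.const hU _).sub hU
    (HolderBelow.comp hU (hf.clm_comp hU μ.flip) (HolderBelow.const hU ℓ)))

end HolderBelow

/-- The inequality `log t ≤ t - 1` at `y / x` and at `x / y` traps `log y - log x` between `1 - x /
y` and `y / x - 1`, which differ by `(y - x)² / (x y)`. -/
theorem abs_log_sub_sub_le {x y l : ℝ} (hl : 0 < l) (hx : l ≤ x) (hy : l ≤ y) :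
    |Real.log y - Real.log x - x⁻¹ * (y - x)| ≤ (l ^ 2)⁻¹ * |y - x| ^ 2 := by
  have hx0 := hl.trans_le hx
  have hy0 := hl.trans_le hy
  have h1 := Real.log_le_sub_one_of_pos (div_pos hy0 hx0)
  have h2 := Real.log_le_sub_one_of_pos (div_pos hx0 hy0)
  rw [Real.log_div hy0.ne' hx0.ne'] at h1
  rw [Real.log_div hx0.ne' hy0.ne'] at h2
  have e1 : x⁻¹ * (y - x) = y / x - 1 := by field_simp
  have e2 : (y / x - 1) - (1 - x / y) = (x * y)⁻¹ * (y - x) ^ 2 := by field_simp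
  have e3 : (x * y)⁻¹ * (y - x) ^ 2 ≤ (l ^ 2)⁻¹ * (y - x) ^ 2 := by
    gcongr
    rw [sq]
    gcongr
  rw [sq_abs, e1, abs_le]
  have e4 : 0 ≤ (l ^ 2)⁻¹ * (y - x) ^ 2 := by positivity
  constructor <;> linarith

theorem abs_log_sub_le {x y l : ℝ} (hl : 0 < l) (hx : l ≤ x) (hy : l ≤ y) :
    |Real.log y - Real.log x| ≤ l⁻¹ * |y - x| := by
  have key : ∀ {x y : ℝ}, l ≤ x → l ≤ y → Real.log y - Real.log x ≤ l⁻¹ * |y - x| := by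
    intro x y hx hy
    have hx0 := hl.trans_le hx
    have h1 := Real.log_le_sub_one_of_pos (div_pos (hl.trans_le hy) hx0)
    rw [Real.log_div (hl.trans_le hy).ne' hx0.ne', show y / x - 1 = x⁻¹ * (y - x) by field_simp]
      at h1
    exact h1.trans ((mul_le_mul_of_nonneg_left (le_abs_self (y - x)) (inv_nonneg.2 hx0.le)).trans
      (mul_le_mul_of_nonneg_right (inv_anti₀ hl hx) (abs_nonneg _)))
  have h1 := key hx hy
  have h2 := key hy hx
  rw [abs_sub_comm] at h2
  rw [abs_le]
  constructor <;> linarith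

/-! ### Regularity of projective fixed points in a graded scale -/

/-- **Regularity of projective fixed points.** The fixed points `f_s(u)` of
`φ ↦ Λ(φ)⁻¹ L_s(u) φ`, `Λ(φ) = ⟨ℓ_s, L_s(u) φ⟩`, in a graded scale of spaces `X_s` over the algebra `A`
are of class `C^t` in `X_s`, `t < r₀ - s`, if `L_s(u) j_{s,r}` is so for `t < r - s`. -/
theorem HolderBelow.of_projective_fixed_point {B A : Type w} [NormedAddCommGroup B]
    [NormedSpace ℝ B] [NormedAddCommGroup A] [NormedSpace ℝ A] {U : Set B} (hU : IsOpen U) {r₀ : ℝ}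
    {X : Ioc 0 r₀ → Type w} [∀ s, NormedAddCommGroup (X s)] [∀ s, NormedSpace ℝ (X s)]
    (j : ∀ {s r : Ioc 0 r₀}, s < r → (X r →L[ℝ] X s)) (ℓ : ∀ s, X s →L[ℝ] A)
    (μ : ∀ s, A →L[ℝ] X s →L[ℝ] X s) (ν : A →L[ℝ] A →L[ℝ] A)
    (hν : ∀ x y, ν (ν x x) y = ν x (ν x y))
    {f : ∀ s, B → X s} {L N : ∀ s, B → X s →L[ℝ] X s} {Λ h : B → A}
    (hf : ∀ {s r : Ioc 0 r₀} (h : s < r), ∀ u ∈ U, f s u = j h (f r u))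
    (hbd : ∀ s, ∃ C, ∀ u ∈ U, ‖f s u‖ ≤ C)
    (hLbd : ∀ s, ∃ C, ∀ u ∈ U, ‖L s u‖ ≤ C)
    (hhbd : ∃ C, ∀ u ∈ U, ‖h u‖ ≤ C)
    (hΛ : ∀ s, ∀ u ∈ U, Λ u = ℓ s (L s u (f s u)))
    (hh : ∀ u ∈ U, ∀ v ∈ U, h u - h v = ν (ν (h u) (h v)) (Λ v - Λ u))
    (hclose : ∀ s, ∃ C, ∀ u ∈ U, ∀ v ∈ U,
      ‖f s u - f s v‖ ≤ C * ‖L s u (f s v) - L s v (f s v)‖)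
    (hkey : ∀ s, ∀ u ∈ U, ∀ v ∈ U, f s v - f s u - μ s (h u) (L s u (f s v - f s u) -
        μ s (ℓ s (L s u (f s v - f s u))) (f s u)) =
      μ s (h u) (L s v (f s v) - L s u (f s v) -
        μ s (ℓ s (L s v (f s v) - L s u (f s v))) (f s u)) -
      μ s (h u) (μ s (Λ v - Λ u) (f s v - f s u)))
    (hL : ∀ (n : ℕ) {s r : Ioc 0 r₀} (h : s < r),
      HolderBelow U n (r - s : ℝ) fun u => L s u ∘L j h)
    (hN : ∀ s, ∃ C, ∀ u ∈ U, ‖N s u‖ ≤ C)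
    (hNl : ∀ s, ∀ u ∈ U, ∀ x,
      N s u (x - μ s (h u) (L s u x - μ s (ℓ s (L s u x)) (f s u))) = x)
    (hNr : ∀ s, ∀ u ∈ U, ∀ x,
      N s u x - μ s (h u) (L s u (N s u x) - μ s (ℓ s (L s u (N s u x))) (f s u)) = x)
    (n : ℕ) (s : Ioc 0 r₀) : HolderBelow U n (r₀ - s : ℝ) (f s) ∧
      HolderBelow U n (r₀ - s : ℝ) Λ ∧ HolderBelow U n (r₀ - s : ℝ) h := by
  have level : ∀ (s : Ioc 0 r₀) (α : ℝ), 0 ≤ α → α < r₀ - s →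
      ∃ i : Levels s r₀, α < (i.1 : ℝ) - s := fun s α h0 hs => by
    obtain ⟨i, hi⟩ := exists_level le_rfl (show (s : ℝ) < (s + α + r₀) / 2 by linarith)
      (show ((s : ℝ) + α + r₀) / 2 < r₀ by linarith)
    exact ⟨i, by rw [hi]; linarith⟩
  -- The vector `f s v` is lifted to a level more than `α` above `s`, where the operators are
  -- `α`-Hölder.
  have hLf : ∀ (s : Ioc 0 r₀) (α : ℝ), 0 < α → α < 1 → α < r₀ - s → ∃ C, 0 ≤ C ∧
      ∀ u ∈ U, ∀ v ∈ U, ‖L s u (f s v) - L s v (f s v)‖ ≤ C * ‖u - v‖ ^ α := by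
    intro s α h0 h1 h2
    obtain ⟨i, hi⟩ := level s α h0.le h2
    obtain ⟨C, hC0, hC⟩ := (hL 1 i.2.1).holder h0 h1 hi
    obtain ⟨D, hD⟩ := hbd i.1
    refine ⟨C * |D|, by positivity, fun u hu v hv => ?_⟩
    rw [hf i.2.1 v hv, mul_right_comm]
    exact ContinuousLinearMap.le_of_opNorm_le_of_le (L s u ∘L j i.2.1 - L s v ∘L j i.2.1)
      (hC u hu v hv) ((hD v hv).trans (le_abs_self D))
  have hhol : ∀ s : Ioc 0 r₀, ∀ α, 0 < α → α < 1 → α < r₀ - s →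
      ∃ C, ∀ u ∈ U, ∀ v ∈ U, ‖f s u - f s v‖ ≤ C * ‖u - v‖ ^ α := by
    intro s α h0 h1 h2
    obtain ⟨C, hC0, hC⟩ := hLf s α h0 h1 h2
    obtain ⟨D, hD⟩ := hclose s
    refine ⟨|D| * C, fun u hu v hv => (hD u hu v hv).trans ?_⟩
    rw [mul_assoc]
    exact mul_le_mul (le_abs_self D) (hC u hu v hv) (norm_nonneg _) (abs_nonneg D)
  have hΛhol : ∀ s : Ioc 0 r₀, ∀ α, 0 < α → α < 1 → α < r₀ - s →
      ∃ C, ∀ u ∈ U, ∀ v ∈ U, ‖Λ u - Λ v‖ ≤ C * ‖u - v‖ ^ α := by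
    intro s α h0 h1 h2
    obtain ⟨C, hC0, hC⟩ := hLf s α h0 h1 h2
    obtain ⟨D, hD⟩ := hhol s α h0 h1 h2
    obtain ⟨M, hM⟩ := hLbd s
    refine ⟨‖ℓ s‖ * (M * D + C), fun u hu v hv => ?_⟩
    have e : Λ u - Λ v = ℓ s (L s u (f s u - f s v) + (L s u (f s v) - L s v (f s v))) := by
      rw [hΛ s u hu, hΛ s v hv]
      simp only [map_sub, map_add]
      abel
    rw [e, mul_assoc, add_mul, mul_assoc]
    exact (ℓ s).le_opNorm_of_le (norm_add_le_of_le
      ((L s u).le_of_opNorm_le_of_le (hM u hu) (hD u hu v hv)) (hC u hu v hv))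
  set P : ∀ s, B → X s →L[ℝ] X s := fun s u =>
    μ s (h u) ∘L (ContinuousLinearMap.id ℝ (X s) - (μ s).flip (f s u) ∘L ℓ s) with hPdef
  have hPapp : ∀ s u x, P s u x = μ s (h u) (x - μ s (ℓ s x) (f s u)) := fun s u x => rfl
  have reg : ∀ n : ℕ, (∀ s : Ioc 0 r₀, HolderBelow U n (r₀ - s : ℝ) (f s)) →
      ∀ s : Ioc 0 r₀, HolderBelow U n (r₀ - s : ℝ) Λ ∧ HolderBelow U n (r₀ - s : ℝ) h := by
    intro n hn s
    have h1 : HolderBelow U n (r₀ - s : ℝ) Λ :=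
      HolderBelow.apply hU le_rfl
        (a := fun (i : Levels s r₀) u => ℓ s ∘L L s u ∘L j i.2.1) (g := f)
        (fun i => HolderBelow.comp hU (HolderBelow.const hU (ℓ s)) (hL n i.2.1)) (fun i => hn i.1)
        (fun i i' u _ v hv => by simp [← hf i.2.1 v hv, ← hf i'.2.1 v hv])
        fun i u hu => by simp [← hf i.2.1 u hu, hΛ s u hu]
    obtain ⟨M, hM⟩ := hhbd
    exact ⟨h1, h1.inv hU ν hν hh hM⟩
  have hder : ∀ {s r : Ioc 0 r₀} (h : s < r), (s : ℝ) + 1 < r → (r : ℝ) < r₀ →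
      ∀ u ∈ U, HasFDerivAt (f s)
      (N s u ∘L P s u ∘L (_root_.fderiv ℝ (fun u => L s u ∘L j h) u).flip (f r u)) u := by
    intro s r hsr h1 hr0 u hu
    have hcont : ContinuousAt (f r) u :=
      HolderBelow.continuousAt (n := 0) hU (θ := min 1 (r₀ - r)) (fun _ => ⟨hbd r,
        fun α h0 h1 h2 => hhol r α h0 h1 (h2.trans_le (min_le_right _ _)),
        fun h => absurd (min_le_left _ _) h.not_ge⟩) (by simpa using hr0) hu
    -- The remainder is a product of two increments. Any exponent above `1 / 2` makes it of order
    -- above one; `3 / 4` is available for both factors because `r₀ - s > 1`.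
    obtain ⟨C, hC⟩ := hΛhol s (3 / 4) (by norm_num) (by norm_num) (by linarith)
    obtain ⟨D, hD⟩ := hhol s (3 / 4) (by norm_num) (by norm_num) (by linarith)
    have e1 := hasFDerivAt_bilin_of_continuousAt (ContinuousLinearMap.apply ℝ (X s))
      hcont ((hL 1 hsr).hasFDerivAt (by linarith) hu)
    have e2 : HasFDerivAt (fun v => μ s (Λ v - Λ u) (f s v - f s u)) (0 : B →L[ℝ] X s) u := by
      refine hasFDerivAt_zero_of_holder (μ s) (C := C) (D := D) ?_ ?_
      · filter_upwards [hU.mem_nhds hu] with v hv using hC v hv u hu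
      · filter_upwards [hU.mem_nhds hu] with v hv using hD v hv u hu
    have e3 := (((P s u).hasFDerivAt.comp u e1).sub ((μ s (h u)).hasFDerivAt.comp u e2))
    have e4 := ((N s u).hasFDerivAt.comp u e3).const_add (f s u)
    rw [ContinuousLinearMap.comp_zero, sub_zero] at e4
    refine e4.congr_of_eventuallyEq ?_
    filter_upwards [hU.mem_nhds hu] with v hv
    -- Applying the inverse to the difference equation expresses `f v - f u` through the two terms
    -- differentiated in `e1` and `e2`.
    have e5 := hNl s u hu (f s v - f s u)
    rw [hkey s u hu v hv] at e5
    rw [← sub_eq_iff_eq_add', ← e5]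
    simp only [Function.comp_apply, hPapp, ContinuousLinearMap.apply_apply, Pi.sub_apply,
      sub_apply, ContinuousLinearMap.comp_apply, ← hf hsr v hv]
  have main := HolderBelow.of_implicit_equation hU j hf hbd hhol hder hL
    (fun n hn s => HolderBelow.proj hU (ℓ s) (μ s) (reg n hn s).2 (hn s)) hN hNl hNr
  exact ⟨main n s, reg n (main n) s⟩

/-! ### Regularity of the fixed point -/

/-- The Neumann series of an operator with exponentially decaying powers. -/
theorem exists_inverse_one_sub {X : Type*} [NormedAddCommGroup X] [NormedSpace ℝ X]
    [CompleteSpace X] (T : X →L[ℝ] X) {C κ : ℝ} (hC : 0 ≤ C) (h0 : 0 ≤ κ) (h1 : κ < 1)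
    (hT : ∀ n x, ‖T^[n] x‖ ≤ C * κ ^ n * ‖x‖) :
    ∃ N : X →L[ℝ] X, ‖N‖ ≤ C * (1 - κ)⁻¹ ∧ (∀ x, N (x - T x) = x) ∧ ∀ x, N x - T (N x) = x := by
  have hn : ∀ n, ‖T ^ n‖ ≤ C * κ ^ n := fun n =>
    ContinuousLinearMap.opNorm_le_bound _ (by positivity) fun x => by
      rw [FunLike.coe_pow_eq_iterate]
      exact hT n x
  have hg := (hasSum_geometric_of_lt_one h0 h1).mul_left C
  have hs : Summable fun n => T ^ n := Summable.of_norm_bounded hg.summable hn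
  refine ⟨∑' n, T ^ n, tsum_of_norm_bounded hg hn, fun x => ?_, fun x => ?_⟩
  · exact DFunLike.congr_fun hs.tsum_pow_mul_one_sub x
  · exact DFunLike.congr_fun hs.one_sub_mul_tsum_pow x

namespace ConeCocycle.IsFixedFamily

section

variable {r₀ : ℝ} {E : Ioc 0 r₀ → Type*} [∀ r, NormedAddCommGroup (E r)]
  [∀ r, NormedSpace ℝ (E r)] {S : GradedScale E} {B : Type*} {U : Set B}
  {Ω : Type*} [MeasurableSpace Ω] {c : ConeCocycle S U Ω} {τ : Ω ≃ᵐ Ω}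
  {f : ∀ r : Ioc 0 r₀, U → LInf Ω (E r)} (hf : c.IsFixedFamily τ f)

/-- The inverse of the normalization of the fixed point. -/
noncomputable def invNorm (r : Ioc 0 r₀) (u : U) : LInf Ω ℝ :=
  LInf.mk (fun ω => ((c.normalization τ r u (f r u)).val ω)⁻¹)
    (c.normalization τ r u (f r u)).stronglyMeasurable_val.measurable.inv.stronglyMeasurable
    (S.low r)⁻¹ fun ω => by
      rw [norm_inv, Real.norm_of_nonneg (hf.normalization_pos r u ω).le]
      exact inv_anti₀ (S.low_pos r) (hf.low_le r u ω)

/-- The logarithm of the normalization of the fixed point. -/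
noncomputable def logNorm (r : Ioc 0 r₀) (u : U) : LInf Ω ℝ :=
  LInf.mk (fun ω => Real.log ((c.normalization τ r u (f r u)).val ω))
    (c.normalization τ r u (f r u)).measurable_log.stronglyMeasurable _ (hf.abs_log_le r u)

theorem val_invNorm (r : Ioc 0 r₀) (u : U) (ω : Ω) :
    (hf.invNorm r u).val ω = ((c.normalization τ r u (f r u)).val ω)⁻¹ := rfl

theorem val_logNorm (r : Ioc 0 r₀) (u : U) (ω : Ω) :
    (hf.logNorm r u).val ω = Real.log ((c.normalization τ r u (f r u)).val ω) := rfl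

theorem norm_invNorm_le (r : Ioc 0 r₀) (u : U) : ‖hf.invNorm r u‖ ≤ (S.low r)⁻¹ :=
  LInf.norm_le (inv_nonneg.2 (S.low_pos r).le) fun ω => by
    rw [val_invNorm, norm_inv, Real.norm_of_nonneg (hf.normalization_pos r u ω).le]
    exact inv_anti₀ (S.low_pos r) (hf.low_le r u ω)

theorem norm_logNorm_le (r : Ioc 0 r₀) (u : U) : ‖hf.logNorm r u‖ ≤
    |max (-Real.log (S.low r)) (Real.log ((S.D r).ϑ * (S.D r).K))| :=
  LInf.norm_le (abs_nonneg _) fun ω => (hf.abs_log_le r u ω).trans (le_abs_self _)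

/-- The derivative of the fractional linear map at the fixed point. -/
noncomputable def tangent (r : Ioc 0 r₀) (u : U) : LInf Ω (E r) →L[ℝ] LInf Ω (E r) :=
  LInf.smulL Ω (E r) (hf.invNorm r u) ∘L (ContinuousLinearMap.id ℝ _ -
    (LInf.smulL Ω (E r)).flip (f r u) ∘L LInf.postcomp Ω (S.D r).ℓ) ∘L c.op τ r u

theorem val_tangent (r : Ioc 0 r₀) (u : U) (x : LInf Ω (E r)) (ω : Ω) :
    (hf.tangent r u x).val ω = ((c.normalization τ r u (f r u)).val ω)⁻¹ •
      ((c.op τ r u x).val ω - (S.D r).ℓ ((c.op τ r u x).val ω) • (f r u).val ω) := rfl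

/-- At the fixed point, applying the operator and dividing by the normalization sends `f` to `f`, so
oscillation relative to `f` contracts; the subtracted multiple of `f` is invisible to it. -/
theorem osc_iterate_tangent (r : Ioc 0 r₀) (u : U) (x : LInf Ω (E r)) (n : ℕ) (ω : Ω) :
    (S.D r).Osc ((f r u).val ω) ((((hf.tangent r u))^[n] x).val ω)
      ((1 - (S.D r).rate) ^ n * (2 / (S.D r).ρ * ‖x‖)) := by
  induction n generalizing ω with
  | zero =>
    obtain ⟨m, M, h1, h2⟩ := RegularCone.osc_of_core (hf.coreSlice r u ω).1
      (hf.normalized r u ω) (x.val ω)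
    refine ⟨m, M, h1.trans ?_, h2⟩
    have := (S.D r).ρ_pos
    rw [pow_zero, one_mul]
    exact mul_le_mul_of_nonneg_left (x.norm_val_le ω) (by positivity)
  | succ n ih =>
    rw [Function.iterate_succ_apply', pow_succ', mul_assoc]
    set y := (hf.tangent r u)^[n] x
    have h0 := hf.normalization_pos r u ω
    have h1 := (ih (τ.symm ω)).map (c.contraction r u (τ.symm ω)) (hf.mem_cone r u _)
      (RegularCone.ne_zero_of_normalized (hf.normalized r u _))
    rw [← val_op, ← val_op, hf.val_op_eq] at h1
    have h2 := h1.smul (inv_nonneg.2 h0.le)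
    rw [inv_smul_smul₀ h0.ne'] at h2
    have h3 := h2.sub_smul (((c.normalization τ r u (f r u)).val ω)⁻¹ *
      (S.D r).ℓ ((c.op τ r u y).val ω))
    rw [val_tangent, smul_sub, smul_smul]
    exact h3

theorem norm_iterate_tangent_le (r : Ioc 0 r₀) (u : U) (n : ℕ) (x : LInf Ω (E r)) :
    ‖((hf.tangent r u))^[n] x‖ ≤
      4 * (S.D r).K / (S.D r).ρ * (1 - (S.D r).rate) ^ n * ‖x‖ := by
  have hK := (S.D r).K_pos
  have hρ := (S.D r).ρ_pos
  have hr := sub_nonneg.2 (S.D r).rate_le_one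
  -- The oscillation controls the norm only of sections annihilated by `ℓ`, which holds after at
  -- least one application. The constant is large enough to cover `n = 0` trivially.
  cases n with
  | zero =>
    simp only [Function.iterate_zero, id_eq, pow_zero, mul_one]
    refine le_mul_of_one_le_left (norm_nonneg x) ?_
    rw [le_div_iff₀ hρ]
    linarith [(S.D r).ρ_le_one, (S.D r).one_le_K]
  | succ n =>
    refine LInf.norm_le (by positivity) fun ω => ?_
    refine ((hf.osc_iterate_tangent r u x (n + 1) ω).norm_le (hf.mem_cone r u ω)
      (hf.normalized r u ω) ?_).trans_eq ?_
    · rw [Function.iterate_succ_apply', val_tangent]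
      simp [hf.normalized]
    · ring

theorem exists_tangent_inverse (r : Ioc 0 r₀) [CompleteSpace (E r)] (u : U) :
    ∃ N : LInf Ω (E r) →L[ℝ] LInf Ω (E r),
      ‖N‖ ≤ 4 * (S.D r).K / (S.D r).ρ * (1 - (1 - (S.D r).rate))⁻¹ ∧
      (∀ x, N (x - hf.tangent r u x) = x) ∧ ∀ x, N x - hf.tangent r u (N x) = x := by
  have hK := (S.D r).K_pos
  have hρ := (S.D r).ρ_pos
  exact exists_inverse_one_sub (hf.tangent r u) (by positivity)
    (sub_nonneg.2 (S.D r).rate_le_one) (sub_lt_self 1 (S.D r).rate_pos)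
    (hf.norm_iterate_tangent_le r u)

include hf in
/-- Dependence of the fixed point on the parameter is controlled by that of the operator. -/
theorem norm_sub_le (r : Ioc 0 r₀) (u v : U) : ‖f r u - f r v‖ ≤
    4 * (S.D r).K ^ 2 / (S.D r).ρ ^ 2 * (S.D r).rate⁻¹ * ((S.low r)⁻¹ * ((S.D r).K + 1)) *
      ‖c.op τ r u (f r v) - c.op τ r v (f r v)‖ := by
  have h := c.norm_sub_le_of_step_eq τ u (φ := ⟨f r v, hf.coreSlice r v⟩) (hf.step_eq r u)
  have hK := (S.D r).K_pos
  have hρ := (S.D r).ρ_pos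
  have hr := (S.D r).rate_pos
  have hl := S.low_pos r
  rw [norm_sub_rev, mul_assoc]
  refine h.trans (mul_le_mul_of_nonneg_left ?_ (by positivity))
  refine LInf.norm_le (by positivity) fun ω => ?_
  rw [LInf.val_sub, val_step, fracLin_eq, ← val_op]
  set x := (c.op τ r u (f r v)).val ω with hx
  have h1 : S.low r ≤ (S.D r).ℓ x :=
    (c.contraction r u _).le_ℓ (hf.coreSlice r v _).1 (hf.normalized r v _)
  have h2 := hf.val_op_eq r v ω
  have h3 : (S.D r).ℓ ((c.op τ r v (f r v)).val ω) =
      (c.normalization τ r v (f r v)).val ω := rfl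
  rw [← h3] at h2
  set y := (c.op τ r v (f r v)).val ω with hy
  set z := (f r v).val ω
  have hx0 := hl.trans_le h1
  -- With `y = ⟨ℓ, y⟩ • z`, the failure of `z = f_r(v)` to be fixed by the map for `u` is expressed
  -- through `x - y` alone.
  have e : z - ((S.D r).ℓ x)⁻¹ • x = ((S.D r).ℓ x)⁻¹ • (((S.D r).ℓ (x - y)) • z - (x - y)) := by
    rw [map_sub, _root_.sub_smul, ← h2, smul_sub, smul_sub, smul_sub, inv_smul_smul₀ hx0.ne']
    abel
  have hz : ‖z‖ ≤ (S.D r).K :=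
    RegularCone.norm_le_of_normalized (hf.mem_cone r v ω) (hf.normalized r v ω)
  have hxy : ‖x - y‖ ≤ ‖c.op τ r u (f r v) - c.op τ r v (f r v)‖ :=
    (c.op τ r u (f r v) - c.op τ r v (f r v)).norm_val_le ω
  rw [e, norm_smul, norm_inv, Real.norm_of_nonneg hx0.le, mul_assoc]
  refine mul_le_mul (inv_anti₀ hl h1) ?_ (norm_nonneg _) (inv_nonneg.2 hl.le)
  refine (_root_.norm_sub_le _ _).trans ?_
  rw [norm_smul, Real.norm_eq_abs]
  have h4 : |(S.D r).ℓ (x - y)| * ‖z‖ ≤ ‖x - y‖ * (S.D r).K :=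
    mul_le_mul ((S.D r).abs_ℓ_le _) hz (norm_nonneg _) (norm_nonneg _)
  nlinarith

/-- The exact difference equation for the fixed point. -/
theorem sub_sub_tangent (r : Ioc 0 r₀) (u v : U) :
    f r v - f r u - hf.tangent r u (f r v - f r u) =
      LInf.smulL Ω (E r) (hf.invNorm r u) (c.op τ r v (f r v) - c.op τ r u (f r v) -
        LInf.smulL Ω (E r) (LInf.postcomp Ω (S.D r).ℓ
          (c.op τ r v (f r v) - c.op τ r u (f r v))) (f r u)) -
      LInf.smulL Ω (E r) (hf.invNorm r u) (LInf.smulL Ω (E r)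
        (c.normalization τ r v (f r v) - c.normalization τ r u (f r u)) (f r v - f r u)) := by
  refine LInf.ext fun ω => ?_
  have hp := hf.normalization_pos r u ω
  rw [map_sub (hf.tangent r u)]
  simp only [LInf.val_sub, val_tangent, LInf.val_smulL, val_invNorm, LInf.val_postcomp,
    map_sub (S.D r).ℓ, hf.val_op_eq, map_smul, hf.normalized, smul_eq_mul, mul_one]
  set a := (f r v).val ω
  set b := (f r u).val ω
  set x := (c.op τ r u (f r v)).val ω
  set l := (c.normalization τ r u (f r u)).val ω
  set l' := (c.normalization τ r v (f r v)).val ω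
  have e : a - b = (l⁻¹ * l) • (a - b) := by rw [inv_mul_cancel₀ hp.ne', one_smul]
  nth_rewrite 1 [e]
  module

theorem val_invNorm_mul (r : Ioc 0 r₀) (u : U) (ω : Ω) :
    (hf.invNorm r u).val ω * (c.normalization τ r u (f r u)).val ω = 1 :=
  inv_mul_cancel₀ (hf.normalization_pos r u ω).ne'

theorem invNorm_sub (r : Ioc 0 r₀) (u v : U) : hf.invNorm r u - hf.invNorm r v =
    LInf.smulL Ω ℝ (LInf.smulL Ω ℝ (hf.invNorm r u) (hf.invNorm r v))
      (c.normalization τ r v (f r v) - c.normalization τ r u (f r u)) := by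
  refine LInf.ext fun ω => ?_
  have h1 := hf.val_invNorm_mul r u ω
  have h2 := hf.val_invNorm_mul r v ω
  simp only [LInf.val_sub, LInf.val_smulL, smul_eq_mul]
  linear_combination (hf.invNorm r v).val ω * h1 - (hf.invNorm r u).val ω * h2

theorem invNorm_eq (s r : Ioc 0 r₀) (u : U) : hf.invNorm s u = hf.invNorm r u :=
  LInf.ext fun ω => by rw [val_invNorm, val_invNorm, hf.normalization_eq s r]

end

end ConeCocycle.IsFixedFamily

universe a b

namespace ConeCocycle.IsFixedFamily

/-- Sections and operators are extended by zero off `U`, which is harmless because only derivatives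
at points of the open set enter. The normalization and its inverse do not depend on the level, so
they are taken at the level `s` throughout. -/
theorem holderBelow {r₀ : ℝ} {E : Ioc 0 r₀ → Type a} [∀ r, NormedAddCommGroup (E r)]
    [∀ r, NormedSpace ℝ (E r)] [∀ r, CompleteSpace (E r)] {S : GradedScale E}
    {B : Type (max a b)} [NormedAddCommGroup B] [NormedSpace ℝ B] {U : Set B} (hU : IsOpen U)
    {Ω : Type (max a b)} [MeasurableSpace Ω] {c : ConeCocycle S U Ω} {τ : Ω ≃ᵐ Ω}
    {f : ∀ r : Ioc 0 r₀, U → LInf Ω (E r)} (hf : c.IsFixedFamily τ f)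
    (hreg : ∀ {s r : Ioc 0 r₀} (h : s < r) (t : ℝ), 0 ≤ t → t < (r : ℝ) - s →
      IsCt t (fun u : U => c.op τ s u ∘L LInf.postcomp Ω (S.j h))) (n : ℕ) (s : Ioc 0 r₀) :
    HolderBelow U n (r₀ - s : ℝ) (Function.extend Subtype.val (f s) 0) ∧
    HolderBelow U n (r₀ - s : ℝ)
      (Function.extend Subtype.val (fun u => c.normalization τ s u (f s u)) 0) ∧
    HolderBelow U n (r₀ - s : ℝ) (Function.extend Subtype.val (hf.logNorm s) 0) := by
  have ext : ∀ {Z : Type (max a b)} [Zero Z] (g : U → Z) (u : B) (hu : u ∈ U),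
      Function.extend Subtype.val g 0 u = g ⟨u, hu⟩ := fun g u hu =>
    Subtype.val_injective.extend_apply g 0 ⟨u, hu⟩
  choose N hN hNl hNr using fun (r : Ioc 0 r₀) (u : U) => hf.exists_tangent_inverse r u
  have key := HolderBelow.of_projective_fixed_point hU (r₀ := r₀) (X := fun s => LInf Ω (E s))
    (A := LInf Ω ℝ) (fun h => LInf.postcomp Ω (S.j h)) (fun s => LInf.postcomp Ω (S.D s).ℓ)
    (fun s => LInf.smulL Ω (E s)) (LInf.smulL Ω ℝ)
    (fun x y => LInf.ext fun ω => mul_assoc _ _ _)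
    (f := fun s => Function.extend Subtype.val (f s) 0)
    (L := fun s => Function.extend Subtype.val (c.op τ s) 0)
    (N := fun s => Function.extend Subtype.val (N s) 0)
    (Λ := Function.extend Subtype.val (fun u => c.normalization τ s u (f s u)) 0)
    (h := Function.extend Subtype.val (hf.invNorm s) 0)
    ?_ ?_ ?_ ?_ ?_ ?_ ?_ ?_ ?_ ?_ ?_ ?_ n s
  · refine ⟨key.1, key.2.1, ?_⟩
    have hl := S.low_pos s
    -- The logarithm is treated by its second order expansion in the supremum norm, uniform because
    -- the normalization stays above `S.low s`; its formal derivative is the inverse of the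
    -- normalization.
    refine key.2.1.of_quadratic_remainder hU (LInf.smulL Ω ℝ) key.2.2
      (C := max (S.low s)⁻¹ (S.low s ^ 2)⁻¹)
      (M := |max (-Real.log (S.low s)) (Real.log ((S.D s).ϑ * (S.D s).K))|)
      (fun u hu => ?_) (by positivity) (fun u hu v hv => ?_) fun u hu v hv => ?_
    · rw [ext _ u hu]
      exact hf.norm_logNorm_le s _
    · simp only [ext _ u hu, ext _ v hv]
      refine LInf.norm_le (by positivity) fun ω => ?_
      refine (abs_log_sub_le hl (hf.low_le s _ ω) (hf.low_le s _ ω)).trans ?_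
      exact mul_le_mul (le_max_left _ _) ((c.normalization τ s ⟨u, hu⟩ (f s ⟨u, hu⟩) -
        c.normalization τ s ⟨v, hv⟩ (f s ⟨v, hv⟩)).norm_val_le ω) (abs_nonneg _) (by positivity)
    · simp only [ext _ u hu, ext _ v hv]
      refine LInf.norm_le (by positivity) fun ω => ?_
      refine (abs_log_sub_sub_le hl (hf.low_le s _ ω) (hf.low_le s _ ω)).trans ?_
      exact mul_le_mul (le_max_right _ _) (pow_le_pow_left₀ (abs_nonneg _)
        ((c.normalization τ s ⟨v, hv⟩ (f s ⟨v, hv⟩) -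
        c.normalization τ s ⟨u, hu⟩ (f s ⟨u, hu⟩)).norm_val_le ω) 2) (by positivity) (by positivity)
  · intro s r h u hu
    simp only [ext _ u hu]
    exact hf.consistent h ⟨u, hu⟩
  · intro s
    refine ⟨(S.D s).K, fun u hu => ?_⟩
    rw [ext _ u hu]
    exact hf.norm_le s _
  · intro s
    refine ⟨(S.D s).ϑ, fun u hu => ?_⟩
    rw [ext _ u hu]
    have h0 := zero_le_one.trans (S.D s).one_le_ϑ
    exact ContinuousLinearMap.opNorm_le_bound _ h0 fun φ => LInf.norm_le (by positivity) fun ω =>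
      (c.L s ⟨u, hu⟩ (τ.symm ω)).le_of_opNorm_le_of_le (c.contraction s _ _).norm_le
        (φ.norm_val_le _)
  · refine ⟨(S.low s)⁻¹, fun u hu => ?_⟩
    rw [ext _ u hu]
    exact hf.norm_invNorm_le s _
  · intro r u hu
    simp only [ext _ u hu]
    exact hf.normalization_eq s r ⟨u, hu⟩
  · intro u hu v hv
    simp only [ext _ u hu, ext _ v hv]
    exact hf.invNorm_sub s _ _
  · intro r
    refine ⟨4 * (S.D r).K ^ 2 / (S.D r).ρ ^ 2 * (S.D r).rate⁻¹ *
      ((S.low r)⁻¹ * ((S.D r).K + 1)), fun u hu v hv => ?_⟩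
    simp only [ext _ u hu, ext _ v hv]
    exact hf.norm_sub_le r ⟨u, hu⟩ ⟨v, hv⟩
  · intro r u hu v hv
    simp only [ext _ u hu, ext _ v hv]
    rw [hf.invNorm_eq s r, hf.normalization_eq s r, hf.normalization_eq s r]
    exact hf.sub_sub_tangent r ⟨u, hu⟩ ⟨v, hv⟩
  · intro n s r h
    refine HolderBelow.of_isCt hU fun t h0 h1 => ?_
    have := hreg h t h0 h1
    convert this using 2 with u
    rw [ext _ u.1 u.2]
  · intro r
    refine ⟨4 * (S.D r).K / (S.D r).ρ * (1 - (1 - (S.D r).rate))⁻¹, fun u hu => ?_⟩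
    rw [ext _ u hu]
    exact hN r ⟨u, hu⟩
  · intro r u hu x
    simp only [ext _ u hu]
    rw [hf.invNorm_eq s r]
    exact hNl r ⟨u, hu⟩ x
  · intro r u hu x
    simp only [ext _ u hu]
    rw [hf.invNorm_eq s r]
    exact hNr r ⟨u, hu⟩ x

end ConeCocycle.IsFixedFamily

/-! ### Transport to a common universe -/

theorem IsCt.conj {B B' X X' Y Y' : Type*} [NormedAddCommGroup B] [NormedSpace ℝ B]
    [NormedAddCommGroup B'] [NormedSpace ℝ B'] [NormedAddCommGroup X] [NormedSpace ℝ X]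
    [NormedAddCommGroup X'] [NormedSpace ℝ X'] [NormedAddCommGroup Y] [NormedSpace ℝ Y]
    [NormedAddCommGroup Y'] [NormedSpace ℝ Y'] {U : Set B} (hU : IsOpen U) {t : ℝ}
    {f : U → X →L[ℝ] Y} (hf : IsCt t f) (e : B' ≃ₗᵢ[ℝ] B) (P : Y →L[ℝ] Y') (Q : X' →L[ℝ] X) :
    IsCt t (fun u : ↥(e ⁻¹' U) => P ∘L f ⟨e u, u.2⟩ ∘L Q) :=
  hf.comp_isometry hU e (compBilin X' Y Y' P ∘L (compBilin X' X Y).flip Q) fun _ => Iff.rfl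

namespace LInf

variable {Ω Ω' : Type*} [MeasurableSpace Ω] [MeasurableSpace Ω']

/-- Pull-back of sections by an isomorphism of the base. -/
noncomputable def comap (E : Type*) [NormedAddCommGroup E] [NormedSpace ℝ E] (g : Ω' ≃ᵐ Ω) :
    LInf Ω E →L[ℝ] LInf Ω' E :=
  LinearMap.mkContinuous
    { toFun := fun φ => mk (fun ω => φ.val (g ω))
        (φ.stronglyMeasurable_val.comp_measurable g.measurable) ‖φ‖ fun _ => φ.norm_val_le _
      map_add' := fun _ _ => rfl
      map_smul' := fun _ _ => rfl } 1 fun φ => by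
    rw [one_mul]
    exact norm_le (norm_nonneg φ) fun _ => φ.norm_val_le _

@[simp] theorem val_comap {E : Type*} [NormedAddCommGroup E] [NormedSpace ℝ E] (g : Ω' ≃ᵐ Ω)
    (φ : LInf Ω E) (ω : Ω') : (comap E g φ).val ω = φ.val (g ω) := rfl

/-- The integral against a probability measure. -/
noncomputable def integralL (P : Measure Ω) [IsProbabilityMeasure P] : LInf Ω ℝ →L[ℝ] ℝ :=
  have hi (φ : LInf Ω ℝ) : Integrable φ.val P :=
    .of_bound φ.stronglyMeasurable_val.aestronglyMeasurable ‖φ‖ (.of_forall φ.norm_val_le)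
  LinearMap.mkContinuous
    { toFun := fun φ => ∫ ω, φ.val ω ∂P
      map_add' := fun φ ψ => integral_add (hi φ) (hi ψ)
      map_smul' := fun a φ => integral_smul a φ.val } 1 fun φ => by
    rw [one_mul]
    exact (norm_integral_le_of_norm_le_const (μ := P) (.of_forall φ.norm_val_le)).trans_eq (by simp)

end LInf

namespace ConeCocycle

universe u₁ u₂ u₃

variable {r₀ : ℝ} {E : Ioc 0 r₀ → Type u₂} [∀ r, NormedAddCommGroup (E r)]
  [∀ r, NormedSpace ℝ (E r)] {S : GradedScale E}

/-- Change of parameter and base space. -/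
def pullback {B B' : Type*} {U : Set B} {U' : Set B'} {Ω Ω' : Type*} [MeasurableSpace Ω]
    [MeasurableSpace Ω'] (c : ConeCocycle S U Ω) (e : U' → U) (g : Ω' ≃ᵐ Ω) :
    ConeCocycle S U' Ω' where
  L r u ω := c.L r (e u) (g ω)
  measurable r u x := (c.measurable r (e u) x).comp_measurable g.measurable
  contraction r u ω := c.contraction r (e u) (g ω)
  equivariant h u ω := c.equivariant h (e u) (g ω)

theorem IsFixedFamily.pullback {B B' : Type*} {U : Set B} {U' : Set B'} {Ω Ω' : Type*}
    [MeasurableSpace Ω] [MeasurableSpace Ω'] {c : ConeCocycle S U Ω} {τ : Ω ≃ᵐ Ω}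
    {f : ∀ r : Ioc 0 r₀, U → LInf Ω (E r)} (hf : c.IsFixedFamily τ f) (e : U' → U)
    (g : Ω' ≃ᵐ Ω) :
    (c.pullback e g).IsFixedFamily (g.trans (τ.trans g.symm))
      fun r u => LInf.comap (E r) g (f r (e u)) where
  mem_cone r u ω := hf.mem_cone r (e u) (g ω)
  normalized r u ω := hf.normalized r (e u) (g ω)
  fixed r u ω := by
    rw [LInf.val_comap, hf.fixed, fracLin_eq, fracLin_eq]
    simp [ConeCocycle.pullback]
  consistent h u := by
    refine LInf.ext fun ω => ?_
    rw [LInf.val_comap, hf.consistent h]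
    rfl

theorem op_pullback_comp {B B' : Type*} {U : Set B} {U' : Set B'} {Ω Ω' : Type*}
    [MeasurableSpace Ω] [MeasurableSpace Ω'] (c : ConeCocycle S U Ω) (τ : Ω ≃ᵐ Ω) (e : U' → U)
    (g : Ω' ≃ᵐ Ω) {s r : Ioc 0 r₀} (T : E r →L[ℝ] E s) (u : U') :
    (c.pullback e g).op (g.trans (τ.trans g.symm)) s u ∘L LInf.postcomp Ω' T =
      LInf.comap (E s) g ∘L (c.op τ s (e u) ∘L LInf.postcomp Ω T) ∘L LInf.comap (E r) g.symm := by
  ext1 φ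
  refine LInf.ext fun ω => ?_
  simp [val_op, ConeCocycle.pullback]

/-- The parameter space and the base are lifted to a common universe, where `holderBelow` applies,
and the result is carried back along isometries and pull-backs. A depth exceeding `t` suffices. -/
theorem IsFixedFamily.isCt {B : Type u₁} [NormedAddCommGroup B] [NormedSpace ℝ B]
    [∀ r, CompleteSpace (E r)] {U : Set B} (hU : IsOpen U) (hc : Convex ℝ U)
    {Ω : Type u₃} [MeasurableSpace Ω] {c : ConeCocycle S U Ω} {τ : Ω ≃ᵐ Ω}
    {f : ∀ r : Ioc 0 r₀, U → LInf Ω (E r)} (hf : c.IsFixedFamily τ f)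
    (hreg : ∀ {s r : Ioc 0 r₀} (h : s < r) (t : ℝ), 0 ≤ t → t < (r : ℝ) - s →
      IsCt t (fun u : U => c.op τ s u ∘L LInf.postcomp Ω (S.j h)))
    (s : Ioc 0 r₀) {t : ℝ} (ht : 0 < t) (hts : t < r₀ - s) :
    IsCt t (f s) ∧ IsCt t (fun u => c.normalization τ s u (f s u)) ∧ IsCt t (hf.logNorm s) := by
  let e : ULift.{max u₂ u₃} B ≃ₗᵢ[ℝ] B := LinearIsometryEquiv.ulift ℝ B
  let g : ULift.{max u₁ u₂} Ω ≃ᵐ Ω := MeasurableEquiv.ulift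
  let eU : ↥(e ⁻¹' U) → U := fun u => ⟨e u, u.2⟩
  have hU' : IsOpen (e ⁻¹' U) := hU.preimage e.continuous
  have hc' : Convex ℝ (e ⁻¹' U) := hc.linear_preimage e.toLinearEquiv.toLinearMap
  have hf' := hf.pullback eU g
  obtain ⟨n, hn⟩ := exists_nat_gt t
  obtain ⟨h1, h2, h3⟩ := holderBelow.{u₂, max u₁ u₃} hU' hf' (fun {s r} h t h0 h1 => by
    have := (hreg h t h0 h1).conj hU e (LInf.comap (E s) g) (LInf.comap (E r) g.symm)
    refine (congrArg (IsCt t) (funext fun u => ?_)).mpr this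
    exact op_pullback_comp c τ eU g (S.j h) u) n s
  have key1 := (h1.isCt hU' hc' ht hts hn).comp_isometry hU' e.symm (LInf.comap (E s) g.symm)
    (U' := U) fun u => by simp
  have key2 := (h2.isCt hU' hc' ht hts hn).comp_isometry hU' e.symm (LInf.comap ℝ g.symm)
    (U' := U) fun u => by simp
  have key3 := (h3.isCt hU' hc' ht hts hn).comp_isometry hU' e.symm (LInf.comap ℝ g.symm)
    (U' := U) fun u => by simp
  refine ⟨(congrArg (IsCt t) (funext fun u => ?_)).mpr key1,
    (congrArg (IsCt t) (funext fun u => ?_)).mpr key2,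
    (congrArg (IsCt t) (funext fun u => ?_)).mpr key3⟩
  all_goals
    rw [Subtype.val_injective.extend_apply]
    refine LInf.ext fun ω => ?_
  · rw [LInf.val_comap]
    simp [eU]
  · rw [LInf.val_comap]
    simp [eU, val_normalization, ConeCocycle.pullback]
  · rw [LInf.val_comap]
    simp [eU, val_logNorm, val_normalization, ConeCocycle.pullback]

end ConeCocycle

theorem mainTheorem1
    {B : Type*} [NormedAddCommGroup B] [NormedSpace ℝ B] [CompleteSpace B]
    {U : Set B} (hUo : IsOpen U) (hUc : Convex ℝ U)
    {r₀ : ℝ} (hr₀ : 0 < r₀)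
    {E : Ioc 0 r₀ → Type*} [∀ r, NormedAddCommGroup (E r)] [∀ r, NormedSpace ℝ (E r)]
    [∀ r, CompleteSpace (E r)]
    (S : GradedScale E)
    {Ω : Type*} [MeasurableSpace Ω] (P : Measure Ω) [IsProbabilityMeasure P]
    (τ : Ω ≃ᵐ Ω) (hτ : Ergodic τ P)
    (c : ConeCocycle S U Ω)
    (hreg : ∀ {s r : Ioc 0 r₀} (h : s < r) (t : ℝ), 0 ≤ t → t < (r : ℝ) - s →
      IsCt t (fun u : U => c.op τ s u ∘L LInf.postcomp Ω (S.j h))) :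
    ∃ f : ∀ r : Ioc 0 r₀, U → LInf Ω (E r),
      -- `f` is the unique fixed point family
      c.IsFixedFamily τ f ∧ (∀ g, c.IsFixedFamily τ g → g = f) ∧
      -- the normalization is positive, does not depend on the level, and has integrable logarithm
      (∀ r u ω, 0 < (c.normalization τ r u (f r u)).val ω) ∧
      (∀ s r u, c.normalization τ s u (f s u) = c.normalization τ r u (f r u)) ∧
      (∀ r u, Integrable (fun ω => Real.log ((c.normalization τ r u (f r u)).val ω)) P) ∧
      -- the integral of its logarithm is the top characteristic exponent
      (∀ r u, ∀ᵐ ω ∂P, charExponent τ (c.L r u) ω =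
        ∫ ω', Real.log ((c.normalization τ r u (f r u)).val ω') ∂P) ∧
      -- regularity in the parameter
      (∀ (s : Ioc 0 r₀) (t : ℝ), 0 < t → t < r₀ - s →
        IsCt t (fun u : U => f s u) ∧
        IsCt t (fun u : U => c.normalization τ s u (f s u)) ∧
        IsCt t (fun u : U => ∫ ω, Real.log ((c.normalization τ s u (f s u)).val ω) ∂P)) ∧
      (∀ (s : Ioc 0 r₀) (ε : ℝ), 0 < ε → ε < r₀ →
        IsCt (r₀ - ε)
          (fun u : U => ∫ ω, Real.log ((c.normalization τ s u (f s u)).val ω) ∂P)) := by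
  obtain ⟨f, hf⟩ := c.exists_isFixedFamily τ
  -- The logarithm is already regular as a map into bounded functions, and integration is a bounded
  -- linear functional.
  have hint : ∀ (s : Ioc 0 r₀) (t : ℝ), 0 < t → t < r₀ - s →
      IsCt t (fun u : U => ∫ ω, Real.log ((c.normalization τ s u (f s u)).val ω) ∂P) :=
    fun s t h0 h1 => ((hf.isCt hUo hUc hreg s h0 h1).2.2).comp_isometry hUo
      (LinearIsometryEquiv.refl ℝ B) (LInf.integralL P) fun _ => Iff.rfl
  refine ⟨f, hf, fun g hg => hf.unique hg, hf.normalization_pos, hf.normalization_eq,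
    hf.integrable_log P, hf.charExponent_eq hτ, fun s t h0 h1 => ?_, fun s ε h0 h1 => ?_⟩
  · obtain ⟨h2, h3, -⟩ := hf.isCt hUo hUc hreg s h0 h1
    exact ⟨h2, h3, hint s t h0 h1⟩
  -- Since the integral does not depend on the level, it may be computed at level `ε / 2`, where
  -- regularity of every order below `r₀ - ε / 2` is available.
  · have := hint ⟨ε / 2, by constructor <;> linarith⟩ (r₀ - ε) (by linarith)
      (show r₀ - ε < r₀ - ε / 2 by linarith)
    refine (congrArg (IsCt (r₀ - ε)) (funext fun u => ?_)).mpr this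
    rw [hf.normalization_eq s ⟨ε / 2, by constructor <;> linarith⟩ u]
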